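/- Consider $m\ge 1$ identical machines and $n$ jobs, job $j$ having a release time $r_j\ge 0$ and a processing time $p_j>0$ (real numbers). Job $j$ and its processing time become known at time $r_j$; the algorithm knows $n$ and $m$ in advance. A non-preemptive schedule gives each job $j$ a machine and a start time $s_j\ge r_j$ such that $j$ occupies its machine during $[s_j,s_j+p_j)$ and no machine serves two jobs at once; its total flow time is $\sum_j (s_j+p_j-r_j)$. Let $\mathrm{OPT}$ be the minimum total flow time $\sum_j (C_j-r_j)$ over all offline preemptive schedules without migration on the $m$ machines (each job is processed on one machine, possibly with interruptions, for $p_j$ time units in total, not before $r_j$, and is completed at time $C_j$). **Theorem.** There are a deterministic, non-preemptive, polynomial-time online algorithm and an absolute constant $C>0$ such that for all $n$, all $m\ge 1$ and every instance with $n$ jobs on $m$ machines, the algorithm produces a non-preemptive schedule of total flow time at most $$C\cdot\max\Bigl\{1,\ \frac{n}{m^2}+\sqrt{\frac nm}\,\log m\Bigr\}\cdot \mathrm{OPT}.$$ In particular its competitive ratio is $O\bigl(n/m^2+\sqrt{n/m}\,\log m\bigr)$ whenever $n\ge m$. Here polynomial time means that a single program, running on a random access machine on naturals and reals with unit-cost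 addition, subtraction and comparison and with indirect addressing, computes each decision of the algorithm from the jobs released and the starts made so far, in a number of steps bounded by a polynomial in $n$; a decision is made initially, after each release and after each start. -/

import Mathlib

/-! Online minimization of total flow time on identical machines: instances, schedules, online
algorithms, and a random access machine with a step count. -/

namespace FlowTime

/-- An instance with `n` jobs. Jobs are numbered in order of release, ties being broken in a fixed
way. -/
structure Instance (n : ℕ) where
  release : Fin n → ℝ
  proc : Fin n → ℝ
  release_nonneg : ∀ j, 0 ≤ release j
  release_mono : Monotone release
  proc_pos : ∀ j, 0 < proc j

/-- A non-preemptive schedule on `m` machines: job `j` occupies `machine j` during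
`[start j, start j + proc j)`. -/
structure NonpreemptiveSchedule {n : ℕ} (J : Instance n) (m : ℕ) where
  machine : Fin n → Fin m
  start : Fin n → ℝ
  release_le_start : ∀ j, J.release j ≤ start j
  disjoint : ∀ i j, i ≠ j → machine i = machine j →
    Disjoint (Set.Ico (start i) (start i + J.proc i)) (Set.Ico (start j) (start j + J.proc j))

/-- Total flow time `∑ (C_j - r_j)` with `C_j = s_j + p_j`. -/
def NonpreemptiveSchedule.flowTime {n m : ℕ} {J : Instance n}
    (S : NonpreemptiveSchedule J m) : ℝ :=
  ∑ j, (S.start j + J.proc j - J.release j)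

/-- A preemptive schedule without migration on `m` machines: job `j` is processed on `machine j`
exactly at the times in `work j`, for `proc j` time units in total and never before its release;
a machine processes at most one job at a time; `completion j` is the last moment at which `j` is
processed. -/
structure PreemptiveSchedule {n : ℕ} (J : Instance n) (m : ℕ) where
  machine : Fin n → Fin m
  work : Fin n → Set ℝ
  completion : Fin n → ℝ
  measurableSet_work : ∀ j, MeasurableSet (work j)
  release_le : ∀ j, ∀ t ∈ work j, J.release j ≤ t
  volume_work : ∀ j, MeasureTheory.volume (work j) = ENNReal.ofReal (J.proc j)
  isLUB_work : ∀ j, IsLUB (work j) (completion j)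
  disjoint : ∀ i j, i ≠ j → machine i = machine j → Disjoint (work i) (work j)

/-- Total flow time `∑ (C_j - r_j)`. -/
def PreemptiveSchedule.flowTime {n m : ℕ} {J : Instance n} (S : PreemptiveSchedule J m) : ℝ :=
  ∑ j, (S.completion j - J.release j)

/-! ### Online algorithms -/

/-- What an online algorithm knows at a decision point: the numbers `n` of jobs and `m` of machines,
the current time `now`, the number `k` of jobs released so far, the release and processing times
of the jobs `0, …, k - 1` (`0` at all other places), and for each job already started its machine
and its start time. -/
structure View where
  n : ℕ
  m : ℕ
  k : ℕ
  now : ℝ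
  release : ℕ → ℝ
  proc : ℕ → ℝ
  started : ℕ → Option (ℕ × ℝ)

/-- The decision to start the job `job` on the machine `machine` at the time `time`. -/
structure Start where
  job : ℕ
  machine : ℕ
  time : ℝ

/-- A deterministic non-preemptive online algorithm with knowledge of the number of jobs. At each
decision point (initially, after each release and after each start of a job) it announces the next
start it will make if no further job is released up to and including that moment, or `none` if it
waits for the next release. -/
abbrev OnlineAlgorithm := View → Option Start

/-- The state of a run: number of released jobs, current time, irrevocable starts made so far. -/
structure RunState where
  k : ℕ
  now : ℝ
  started : ℕ → Option (ℕ × ℝ)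

/-- Release time of the job with number `j`, extended by `0`. -/
def Instance.releaseAt {n : ℕ} (J : Instance n) (j : ℕ) : ℝ :=
  if h : j < n then J.release ⟨j, h⟩ else 0

/-- Processing time of the job with number `j`, extended by `0`. -/
def Instance.procAt {n : ℕ} (J : Instance n) (j : ℕ) : ℝ :=
  if h : j < n then J.proc ⟨j, h⟩ else 0

/-- The information available in a state; nothing about jobs not yet released. -/
def RunState.view {n : ℕ} (J : Instance n) (m : ℕ) (s : RunState) : View where
  n := n
  m := m
  k := s.k
  now := s.now
  release := fun j => if j < s.k then J.releaseAt j else 0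
  proc := fun j => if j < s.k then J.procAt j else 0
  started := s.started

/-- The next job, if there is one, is released. -/
def RunState.arrive {n : ℕ} (J : Instance n) (s : RunState) : RunState :=
  if s.k < n then { s with k := s.k + 1, now := J.releaseAt s.k } else s

/-- The start `a` is carried out if its job has been released and has not been started, its time is
not in the past, and no further job is released up to that time. -/
def RunState.Admits {n : ℕ} (J : Instance n) (s : RunState) (a : Start) : Prop :=
  a.job < s.k ∧ s.started a.job = none ∧ s.now ≤ a.time ∧
    ∀ j : Fin n, s.k ≤ j → a.time < J.release j

open Classical in
/-- One event of the run: the announced start, or the next release. -/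
noncomputable def RunState.step {n : ℕ} (A : OnlineAlgorithm) (J : Instance n) (m : ℕ)
    (s : RunState) : RunState :=
  match A (s.view J m) with
  | none => s.arrive J
  | some a =>
    if s.Admits J a then
      { s with
        now := a.time
        started := Function.update s.started a.job (some (a.machine, a.time)) }
    else s.arrive J

/-- The state after `i` events. -/
noncomputable def OnlineAlgorithm.state (A : OnlineAlgorithm) {n : ℕ} (J : Instance n) (m : ℕ)
    (i : ℕ) : RunState :=
  (RunState.step A J m)^[i] { k := 0, now := 0, started := fun _ => none }

/-- The run of `A` on `J` (it has at most `n` releases and `n` starts) produces the schedule `S`. -/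
def OnlineAlgorithm.Produces (A : OnlineAlgorithm) {n m : ℕ} {J : Instance n}
    (S : NonpreemptiveSchedule J m) : Prop :=
  ∀ j : Fin n, (A.state J m (2 * n)).started j = some ((S.machine j : ℕ), S.start j)

/-- `A` is `Γ n m`-competitive against the optimal preemptive schedule without migration: on each
instance it produces a feasible non-preemptive schedule whose total flow time is at most `Γ n m`
times that of every (in particular of an optimal) preemptive schedule. -/
def OnlineAlgorithm.IsCompetitive (A : OnlineAlgorithm) (Γ : ℕ → ℕ → ℝ) : Prop :=
  ∀ (n m : ℕ), 0 < m → ∀ J : Instance n,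
    ∃ S : NonpreemptiveSchedule J m, A.Produces S ∧
      ∀ O : PreemptiveSchedule J m, S.flowTime ≤ Γ n m * O.flowTime

/-! ### A random access machine

Structured programs over arrays of natural numbers and arrays of reals, with indirect addressing.
The operations, at unit cost each, are addition, subtraction and comparison; there is no
multiplication, division or rounding, and no conversion between reals and naturals. (Hence on
rational data `t` steps can be carried out in time polynomial in `t` and in the bit length of the
data.) -/

/-- The memory: entry `i` of the array `a` of naturals, and of the array `a` of reals. -/
structure Store where
  nat : ℕ → ℕ → ℕ
  real : ℕ → ℕ → ℝ

/-- Write `x` into entry `i` of array `a` of naturals. -/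
def Store.writeNat (σ : Store) (a i x : ℕ) : Store where
  nat := fun b j => if b = a ∧ j = i then x else σ.nat b j
  real := σ.real

/-- Write `x` into entry `i` of array `a` of reals. -/
def Store.writeReal (σ : Store) (a i : ℕ) (x : ℝ) : Store where
  nat := σ.nat
  real := fun b j => if b = a ∧ j = i then x else σ.real b j

inductive NatExpr where
  | const (c : ℕ)
  | get (a : ℕ) (i : NatExpr)
  | add (e f : NatExpr)
  | sub (e f : NatExpr)

/-- Subtraction of naturals is truncated. -/
def NatExpr.eval (σ : Store) : NatExpr → ℕ
  | const c => c
  | get a i => σ.nat a (i.eval σ)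
  | add e f => e.eval σ + f.eval σ
  | sub e f => e.eval σ - f.eval σ

def NatExpr.cost : NatExpr → ℕ
  | const _ => 1
  | get _ i => i.cost + 1
  | add e f => e.cost + f.cost + 1
  | sub e f => e.cost + f.cost + 1

inductive RealExpr where
  | zero
  | get (a : ℕ) (i : NatExpr)
  | add (e f : RealExpr)
  | sub (e f : RealExpr)

def RealExpr.eval (σ : Store) : RealExpr → ℝ
  | zero => 0
  | get a i => σ.real a (i.eval σ)
  | add e f => e.eval σ + f.eval σ
  | sub e f => e.eval σ - f.eval σ

def RealExpr.cost : RealExpr → ℕ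
  | zero => 1
  | get _ i => i.cost + 1
  | add e f => e.cost + f.cost + 1
  | sub e f => e.cost + f.cost + 1

inductive Test where
  | natLt (e f : NatExpr)
  | realLt (e f : RealExpr)
  | not (b : Test)
  | and (b c : Test)

def Test.Holds (σ : Store) : Test → Prop
  | natLt e f => e.eval σ < f.eval σ
  | realLt e f => e.eval σ < f.eval σ
  | not b => ¬ b.Holds σ
  | and b c => b.Holds σ ∧ c.Holds σ

def Test.cost : Test → ℕ
  | natLt e f => e.cost + f.cost + 1
  | realLt e f => e.cost + f.cost + 1
  | not b => b.cost + 1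
  | and b c => b.cost + c.cost + 1

/-- `setNat a i e` and `setReal a i e` write the value of `e` into entry `i` of array `a`;
`loop b p` is the while loop. -/
inductive Program where
  | skip
  | setNat (a : ℕ) (i e : NatExpr)
  | setReal (a : ℕ) (i : NatExpr) (e : RealExpr)
  | seq (p q : Program)
  | ite (b : Test) (p q : Program)
  | loop (b : Test) (p : Program)

/-- `Exec p σ t τ`: started in the memory `σ`, the program `p` halts after `t` steps with the
memory `τ`. -/
inductive Exec : Program → Store → ℕ → Store → Prop
  | skip (σ : Store) : Exec .skip σ 1 σ
  | setNat (a : ℕ) (i e : NatExpr) (σ : Store) :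
      Exec (.setNat a i e) σ (i.cost + e.cost + 1)
        (σ.writeNat a (i.eval σ) (e.eval σ))
  | setReal (a : ℕ) (i : NatExpr) (e : RealExpr) (σ : Store) :
      Exec (.setReal a i e) σ (i.cost + e.cost + 1)
        (σ.writeReal a (i.eval σ) (e.eval σ))
  | seq {p q : Program} {σ τ υ : Store} {s t : ℕ} :
      Exec p σ s τ → Exec q τ t υ → Exec (.seq p q) σ (s + t) υ
  | iteTrue {b : Test} {p q : Program} {σ τ : Store} {t : ℕ} :
      b.Holds σ → Exec p σ t τ → Exec (.ite b p q) σ (b.cost + t) τ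
  | iteFalse {b : Test} {p q : Program} {σ τ : Store} {t : ℕ} :
      ¬ b.Holds σ → Exec q σ t τ → Exec (.ite b p q) σ (b.cost + t) τ
  | loopFalse {b : Test} {p : Program} {σ : Store} :
      ¬ b.Holds σ → Exec (.loop b p) σ b.cost σ
  | loopTrue {b : Test} {p : Program} {σ τ υ : Store} {s t : ℕ} :
      b.Holds σ → Exec p σ s τ → Exec (.loop b p) τ t υ →
        Exec (.loop b p) σ (b.cost + s + t) υ

/-- The outcome and the number of steps of a program are determined by the initial memory. -/
theorem Exec.unique {p : Program} {σ τ τ' : Store} {t t' : ℕ} (h : Exec p σ t τ)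
    (h' : Exec p σ t' τ') : t = t' ∧ τ = τ' := by
  induction h generalizing t' τ' with
  | skip σ => cases h'; exact ⟨rfl, rfl⟩
  | setNat a i e σ => cases h'; exact ⟨rfl, rfl⟩
  | setReal a i e σ => cases h'; exact ⟨rfl, rfl⟩
  | seq _ _ ih₁ ih₂ =>
    cases h' with
    | seq h₁ h₂ =>
      obtain ⟨rfl, rfl⟩ := ih₁ h₁
      obtain ⟨rfl, rfl⟩ := ih₂ h₂
      exact ⟨rfl, rfl⟩
  | iteTrue hb _ ih =>
    cases h' with
    | iteTrue _ h₁ => obtain ⟨rfl, rfl⟩ := ih h₁; exact ⟨rfl, rfl⟩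
    | iteFalse hb' _ => exact absurd hb hb'
  | iteFalse hb _ ih =>
    cases h' with
    | iteTrue hb' _ => exact absurd hb' hb
    | iteFalse _ h₁ => obtain ⟨rfl, rfl⟩ := ih h₁; exact ⟨rfl, rfl⟩
  | loopFalse hb =>
    cases h' with
    | loopFalse _ => exact ⟨rfl, rfl⟩
    | loopTrue hb' _ _ => exact absurd hb' hb
  | loopTrue hb _ _ ih₁ ih₂ =>
    cases h' with
    | loopFalse hb' => exact absurd hb hb'
    | loopTrue _ h₁ h₂ =>
      obtain ⟨rfl, rfl⟩ := ih₁ h₁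
      obtain ⟨rfl, rfl⟩ := ih₂ h₂
      exact ⟨rfl, rfl⟩

/-- Input: array `0` of naturals holds `n, m, k`; entry `j` of array `1` of naturals is `0` if job
`j` has not been started and `i + 1` if it was started on machine `i`; array `0` of reals holds the
current time, arrays `1`, `2`, `3` of reals hold release, processing and start times. Everything
else is `0`. -/
def View.toStore (v : View) : Store where
  nat
    | 0, 0 => v.n
    | 0, 1 => v.m
    | 0, 2 => v.k
    | 1, j => match v.started j with
      | none => 0
      | some (i, _) => i + 1
    | _, _ => 0
  real
    | 0, 0 => v.now
    | 1, j => v.release j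
    | 2, j => v.proc j
    | 3, j => match v.started j with
      | none => 0
      | some (_, t) => t
    | _, _ => 0

/-- Output: array `2` of naturals holds a flag (`0` means waiting), the job and the machine; the
first entry of array `4` of reals is the start time. -/
def Store.decision (σ : Store) : Option Start :=
  if σ.nat 2 0 = 0 then none
  else some { job := σ.nat 2 1, machine := σ.nat 2 2, time := σ.real 4 0 }

/-- A single program computes every decision that `A` makes in any of its runs, each within a number
of steps bounded by a polynomial in the number of jobs. (A run has at most `2 n + 1` decision
points, so the total number of steps is polynomial as well.) -/
def OnlineAlgorithm.PolynomialTime (A : OnlineAlgorithm) : Prop :=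
  ∃ (p : Program) (q : Polynomial ℕ), ∀ (n m : ℕ), 0 < m → ∀ (J : Instance n) (i : ℕ),
    ∃ (t : ℕ) (τ : Store), Exec p ((A.state J m i).view J m).toStore t τ ∧
      t ≤ q.eval n ∧ τ.decision = A ((A.state J m i).view J m)

end FlowTime

/-!
The algorithm works on `M = min m n` machines. Let `ρ` be the least natural number with
`n ≤ ρ ^ 2 * M`, let `V` be the processing time released so far, and call a running job heavy for a
job of length `p` if up to a factor of two it is at least as long as `min p (V / M)`. Whenever a
machine is idle, the algorithm starts the shortest pending job whose length `p` satisfies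
`c * ρ * min p (V / M) ≤ V`, where `c` counts the running jobs that are heavy for it. So few machines
are ever given to long jobs. A job is short once `M * ρ * p ≤ V`; short jobs may always be started,
and since they are preferred, long jobs start only when no short job is waiting.

*Long phase.* While a job of length `p` is not short, less than `M * ρ * p` has been released. Hence
all machines are busy for a time of at most `ρ * p`, and while some machine is idle more than
`V / (ρ * p)` jobs run, which by a dyadic decomposition in `V / p` lasts for a time `O(ρ * p * log n)`
(`GreedyRun.volume_long_le`). In total this is `O(ρ * log n)` times the sum of the processing times.

*Short phase.* While a short job waits, all machines are busy, and only short jobs are started. The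
jobs that already ran when such a period began block the machines for a time that adds up to at most
`O(V / M + log n * V / ρ)`, since in each dyadic class of lengths the job started last saw all the
others (`GreedyRun.card_mul_le`, `GreedyRun.sum_min_le`). Up to a delay by the `M`-th part `Δ` of this
time, the volume of the waiting jobs of length at most `x` exceeds that of the preemptive schedule by
at most `M * ρ * x` (`GreedyRun.sum_pending_le`). Summing over dyadic `x` bounds the number of short
waiting jobs by twice the number of jobs alive in the delayed preemptive schedule plus
`O(M * ρ * log n)` (`GreedyRun.card_shortPending_le`), and this surplus is paid only while all machines
are busy, that is for a time of at most `V / M`. Extremely short jobs, whose total volume is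
negligible, wait for `O(Δ)` each (`GreedyRun.volume_short_le`). The delay costs
`n * Δ = O(n / M ^ 2 + ρ * log n) * V`.

As `V` is a lower bound for the cost of every schedule, the ratio is `O(n / m ^ 2 + √(n / m) * log n)`
when `m ≤ n`, and `log n` can be replaced by `log m` because the first term dominates when `n` is
large compared with `m` (`sqrt_mul_log_le`). For `m ≥ n` no job waits.

Without further releases, a start becomes possible only when a running job completes. So the next
decision is found by testing all jobs and machines at the current time and at the completion times of
the running jobs, which the random access machine does in four nested loops (`View.hoare_greedy`).
-/

/-! ### Greedy runs -/

namespace FlowTime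

open Classical in
/-- The total processing time of the jobs released up to the time `t`. -/
noncomputable def Instance.volume {n : ℕ} (J : Instance n) (t : ℝ) : ℝ :=
  ∑ j with J.release j ≤ t, J.proc j

/-- The total processing time of all jobs. -/
noncomputable def Instance.total {n : ℕ} (J : Instance n) : ℝ := ∑ j, J.proc j

/-- Job `a` is heavy for job `j` when a processing time `V` has been released: up to the factor `2`
it is as long as `j`, or as long as the average load `V / M`. -/
def Instance.Heavy {n : ℕ} (J : Instance n) (M : ℕ) (V : ℝ) (a j : Fin n) : Prop :=
  J.proc j ≤ 2 * J.proc a ∨ V ≤ 2 * (M * J.proc a)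

/-- A job of length `p` may be started next to `c` heavy running jobs when a processing time `V` has
been released. This is `c * ρ * min p (V / M) ≤ V`, written without division. -/
def Startable (M ρ c : ℕ) (p V : ℝ) : Prop := (c : ℝ) * (ρ * p) ≤ V ∨ c * ρ ≤ M

open Classical in
/-- The outcome of the greedy rule "whenever a machine is idle, start the shortest startable pending
job" on `M` machines. The starts are carried out in the order of `rank`, so that simultaneous starts
are ordered as well; `startable` refers to the jobs started before `j` in this order. Of the
preference for short jobs, `shortest` keeps only that a job `i` with `M * ρ * p_i ≤ V`, which is
startable whatever is running, is not left waiting in favour of a longer one. -/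
structure GreedyRun {n : ℕ} (J : Instance n) (M ρ : ℕ) where
  machine : Fin n → ℕ
  start : Fin n → ℝ
  rank : Fin n → ℕ
  machine_lt : ∀ j, machine j < M
  release_le_start : ∀ j, J.release j ≤ start j
  disjoint : ∀ i j, i ≠ j → machine i = machine j →
    start i + J.proc i ≤ start j ∨ start j + J.proc j ≤ start i
  rank_injective : Function.Injective rank
  startable : ∀ j, Startable M ρ
    (Finset.card {a | rank a < rank j ∧ start j < start a + J.proc a ∧
      J.Heavy M (J.volume (start j)) a j}) (J.proc j) (J.volume (start j))
  shortest : ∀ y i, J.release i ≤ start y → start y < start i →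
    M * ρ * J.proc i ≤ J.volume (start y) → J.proc y ≤ J.proc i
  nonidle : ∀ t j, J.release j ≤ t → t < start j →
    (∀ i < M, ∃ a, machine a = i ∧ start a ≤ t ∧ t < start a + J.proc a) ∨
    ¬ Startable M ρ (Finset.card {a | start a ≤ t ∧ t < start a + J.proc a ∧
      J.Heavy M (J.volume t) a j}) (J.proc j) (J.volume t)

end FlowTime

/-! ### Volumes and running jobs -/

namespace FlowTime

open MeasureTheory
open scoped Classical

section Volume

variable {n : ℕ} (J : Instance n)

theorem Instance.volume_mono : Monotone J.volume := by
  intro s t hst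
  refine Finset.sum_le_sum_of_subset_of_nonneg ?_ fun j _ _ => (J.proc_pos j).le
  intro j hj
  simp only [Finset.mem_filter, Finset.mem_univ, true_and] at hj ⊢
  exact hj.trans hst

theorem Instance.volume_le_total (t : ℝ) : J.volume t ≤ J.total :=
  Finset.sum_le_sum_of_subset_of_nonneg (Finset.subset_univ _) fun j _ _ => (J.proc_pos j).le

theorem Instance.sum_le_volume {t : ℝ} (I : Finset (Fin n)) (hI : ∀ i ∈ I, J.release i ≤ t) :
    ∑ i ∈ I, J.proc i ≤ J.volume t := by
  refine Finset.sum_le_sum_of_subset_of_nonneg ?_ fun j _ _ => (J.proc_pos j).le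
  intro j hj
  simpa using hI j hj

theorem Instance.proc_le_volume {t : ℝ} {j : Fin n} (hj : J.release j ≤ t) :
    J.proc j ≤ J.volume t := by
  simpa using J.sum_le_volume {j} (by simpa using hj)

theorem Instance.proc_le_total (j : Fin n) : J.proc j ≤ J.total :=
  (J.proc_le_volume le_rfl).trans (J.volume_le_total (J.release j))

theorem Instance.total_nonneg : 0 ≤ J.total :=
  Finset.sum_nonneg fun j _ => (J.proc_pos j).le

/-- If nothing is released in `(b, t]`, then the released volume does not change. -/
theorem Instance.volume_eq_of_forall {b t : ℝ} (hbt : b ≤ t)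
    (h : ∀ i, J.release i ≤ t → J.release i ≤ b) : J.volume b = J.volume t := by
  unfold Instance.volume
  congr 1
  ext i
  simp only [Finset.mem_filter, Finset.mem_univ, true_and]
  exact ⟨fun hi => hi.trans hbt, h i⟩

/-- Jobs that are processed at the same time occupy different machines. -/
theorem card_le_of_disjoint {n M : ℕ} {J : Instance n} {machine : Fin n → ℕ} {start : Fin n → ℝ}
    (hlt : ∀ j, machine j < M) (hdisj : ∀ i j, i ≠ j → machine i = machine j →
      start i + J.proc i ≤ start j ∨ start j + J.proc j ≤ start i) {t : ℝ} (H : Finset (Fin n))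
    (hH : ∀ a ∈ H, start a ≤ t ∧ t < start a + J.proc a) : H.card ≤ M := by
  have := Finset.card_le_card_of_injOn (s := H) (t := Finset.range M) machine
    (fun a _ => by simpa using hlt a) fun a ha b hb hab => by
      by_contra hne
      have h1 := hH a ha
      have h2 := hH b hb
      rcases hdisj a b hne hab with h | h <;> linarith [h1.1, h1.2, h2.1, h2.2]
  simpa using this

end Volume

namespace GreedyRun

variable {n M ρ : ℕ} {J : Instance n} (G : GreedyRun J M ρ)

/-- The jobs being processed at the time `t`. -/
noncomputable def running (t : ℝ) : Finset (Fin n) :=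
  {a | G.start a ≤ t ∧ t < G.start a + J.proc a}

theorem mem_running {t : ℝ} {a : Fin n} :
    a ∈ G.running t ↔ G.start a ≤ t ∧ t < G.start a + J.proc a := by
  simp [running]

theorem card_running_le (t : ℝ) : (G.running t).card ≤ M :=
  card_le_of_disjoint G.machine_lt G.disjoint _ fun _ ha => G.mem_running.1 ha

/-- All machines are busy at the time `t`. -/
def Busy (t : ℝ) : Prop := ∀ i < M, ∃ a, G.machine a = i ∧ G.start a ≤ t ∧ t < G.start a + J.proc a

theorem Busy.le_card {G : GreedyRun J M ρ} {t : ℝ} (h : G.Busy t) : M ≤ (G.running t).card := by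
  have : Finset.range M ⊆ (G.running t).image G.machine := by
    intro i hi
    obtain ⟨a, ha, hs⟩ := h i (by simpa using hi)
    exact Finset.mem_image.2 ⟨a, G.mem_running.2 hs, ha⟩
  simpa using (Finset.card_le_card this).trans Finset.card_image_le

/-- While at least `κ` jobs are processed and a volume of at most `v` has been released, a volume of
at most `v` is processed. So this happens during a time of at most `v / κ`. -/
theorem measure_le_of_le_card_running {κ v : ℝ} (hκ : 0 < κ) (hv : 0 ≤ v) (T : Set ℝ)
    (hT : ∀ t ∈ T, κ ≤ (G.running t).card ∧ J.volume t ≤ v) :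
    volume T ≤ ENNReal.ofReal (v / κ) := by
  set I : Finset (Fin n) := {a | ∃ t ∈ T, a ∈ G.running t} with hI
  have hIv : ∑ i ∈ I, J.proc i ≤ v := by
    rcases I.eq_empty_or_nonempty with h0 | hne
    · simpa [h0] using hv
    · have hex : ∀ i ∈ I, ∃ t ∈ T, i ∈ G.running t := fun i hi => by simpa [hI] using hi
      choose! τ hτT hτ using hex
      obtain ⟨i₀, hi₀, hmax⟩ := I.exists_max_image τ hne
      refine (J.sum_le_volume I fun i hi => ?_).trans (hT _ (hτT i₀ hi₀)).2
      exact ((G.release_le_start i).trans (G.mem_running.1 (hτ i hi)).1).trans (hmax i hi)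
  set f : ℝ → ENNReal := fun t => ∑ i ∈ I,
    (Set.Ico (G.start i) (G.start i + J.proc i)).indicator 1 t with hf
  have hfm : Measurable f := Finset.measurable_fun_sum _ fun i _ =>
    measurable_one.indicator measurableSet_Ico
  have hfint : ∫⁻ t, f t = ENNReal.ofReal (∑ i ∈ I, J.proc i) := by
    rw [hf, lintegral_finsetSum _ fun i _ => measurable_one.indicator measurableSet_Ico,
      ENNReal.ofReal_sum_of_nonneg fun i _ => (J.proc_pos i).le]
    refine Finset.sum_congr rfl fun i _ => ?_
    rw [lintegral_indicator_one measurableSet_Ico, Real.volume_Ico]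
    simp
  have hsub : T ⊆ {t | ENNReal.ofReal κ ≤ f t} := by
    intro t ht
    have h1 : f t = ((G.running t).card : ENNReal) := by
      have hsubI : G.running t ⊆ I := fun a ha => by
        simp only [hI, Finset.mem_filter, Finset.mem_univ, true_and]
        exact ⟨t, ht, ha⟩
      rw [hf, Finset.card_eq_sum_ones, Nat.cast_sum]
      simp only [Set.indicator_apply, Set.mem_Ico, Pi.one_apply]
      rw [← Finset.sum_filter]
      have : I.filter (fun i => G.start i ≤ t ∧ t < G.start i + J.proc i) = G.running t := by
        ext a
        simp only [Finset.mem_filter, mem_running]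
        exact ⟨fun h => h.2, fun h => ⟨hsubI (G.mem_running.2 h), h⟩⟩
      rw [this]
      simp
    simp only [Set.mem_ofPred_eq, h1]
    rw [← ENNReal.ofReal_natCast]
    exact ENNReal.ofReal_le_ofReal (hT t ht).1
  have h2 : ENNReal.ofReal κ * volume T ≤ ENNReal.ofReal v := by
    calc ENNReal.ofReal κ * volume T
        ≤ ENNReal.ofReal κ * volume {t | ENNReal.ofReal κ ≤ f t} := by gcongr
      _ ≤ ∫⁻ t, f t := mul_meas_ge_le_lintegral hfm _
      _ ≤ ENNReal.ofReal v := by rw [hfint]; exact ENNReal.ofReal_le_ofReal hIv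
  rw [ENNReal.ofReal_div_of_pos hκ, ENNReal.le_div_iff_mul_le (by simp [hκ]) (by simp), mul_comm]
  exact h2

/-- Among jobs processed simultaneously that are heavy for each other, the one started last saw all
the others. -/
theorem card_mul_le {t y : ℝ} (hρ : 0 < ρ) (hM : 0 < M) (hy : 0 ≤ y) (hyX : y ≤ J.total / M)
    (H : Finset (Fin n)) (hH : ∀ g ∈ H, G.start g < t ∧ t < G.start g + J.proc g ∧ y ≤ J.proc g)
    (hheavy : ∀ g ∈ H, ∀ h ∈ H, J.Heavy M (J.volume (G.start h)) g h) :
    H.card * y ≤ y + J.total / ρ := by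
  have hρ' : (0 : ℝ) < ρ := by exact_mod_cast hρ
  have hM' : (0 : ℝ) < M := by exact_mod_cast hM
  have htot := J.total_nonneg
  rcases H.eq_empty_or_nonempty with h0 | hne
  · simp only [h0, Finset.card_empty, Nat.cast_zero, zero_mul]
    positivity
  obtain ⟨h, hh, hmax⟩ := H.exists_max_image G.rank hne
  set c := Finset.card {a | G.rank a < G.rank h ∧ G.start h < G.start a + J.proc a ∧
      J.Heavy M (J.volume (G.start h)) a h} with hc
  have hcard : H.card ≤ c + 1 := by
    rw [← Finset.card_erase_add_one hh]
    refine Nat.add_le_add_right (Finset.card_le_card fun a ha => ?_) 1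
    simp only [Finset.mem_erase] at ha
    simp only [Finset.mem_filter, Finset.mem_univ, true_and]
    refine ⟨lt_of_le_of_ne (hmax a ha.2) fun h' => ha.1 (G.rank_injective h'), ?_,
      hheavy a ha.2 h hh⟩
    linarith [(hH a ha.2).2.1, (hH h hh).1]
  have hcard' : (H.card : ℝ) ≤ c + 1 := by exact_mod_cast hcard
  suffices hs : (c : ℝ) * y ≤ J.total / ρ by nlinarith
  rw [le_div_iff₀ hρ']
  rcases G.startable h with h1 | h1
  · calc (c : ℝ) * y * ρ ≤ c * J.proc h * ρ := by gcongr; exact (hH h hh).2.2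
      _ = c * (ρ * J.proc h) := by ring
      _ ≤ _ := h1.trans (J.volume_le_total _)
  · have h1' : (c : ℝ) * ρ ≤ M := by exact_mod_cast h1
    calc (c : ℝ) * y * ρ = c * ρ * y := by ring
      _ ≤ M * (J.total / M) := by gcongr
      _ = J.total := by field_simp

theorem le_sum_dyadic {p X : ℝ} (hX : 0 ≤ X) (hp : p ≤ X) (L : ℕ) :
    p ≤ ∑ l ∈ Finset.range L, (if X / 2 ^ (l + 1) < p ∧ p ≤ X / 2 ^ l then X / 2 ^ l else 0) +
      (if p ≤ X / 2 ^ L then X / 2 ^ L else 0) := by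
  induction L with
  | zero => simp [hp]
  | succ L ih =>
    rw [Finset.sum_range_succ]
    have hnn : 0 ≤ ∑ l ∈ Finset.range L,
        (if X / 2 ^ (l + 1) < p ∧ p ≤ X / 2 ^ l then X / 2 ^ l else 0) :=
      Finset.sum_nonneg fun l _ => by split_ifs <;> positivity
    by_cases h1 : p ≤ X / 2 ^ L
    · by_cases h2 : p ≤ X / 2 ^ (L + 1)
      · have : ¬ (X / 2 ^ (L + 1) < p ∧ p ≤ X / 2 ^ L) := fun h => absurd h.1 (not_lt.2 h2)
        rw [if_neg this, if_pos h2]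
        linarith
      · rw [if_pos ⟨not_le.1 h2, h1⟩, if_neg h2]
        linarith
    · rw [if_neg h1] at ih
      have : (0 : ℝ) ≤ if p ≤ X / 2 ^ (L + 1) then X / 2 ^ (L + 1) else 0 := by
        split_ifs <;> positivity
      have : (0 : ℝ) ≤ if X / 2 ^ (L + 1) < p ∧ p ≤ X / 2 ^ L then X / 2 ^ L else 0 := by
        split_ifs <;> positivity
      linarith

/-- The time for which the jobs processed at the time `t` can block the machines within a busy period,
which lasts for at most `total / M`. -/
theorem sum_min_le (hρ : 0 < ρ) (hM : 0 < M) (L : ℕ) (t : ℝ) :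
    ∑ i with G.start i < t ∧ t < G.start i + J.proc i, min (J.proc i) (J.total / M) ≤
      3 * (J.total / M) + (2 * L + 1) * (J.total / ρ) + J.total / 2 ^ L := by
  have hρ' : (0 : ℝ) < ρ := by exact_mod_cast hρ
  have hM' : (0 : ℝ) < M := by exact_mod_cast hM
  have htot := J.total_nonneg
  set X := J.total / M with hX
  have hX0 : 0 ≤ X := by positivity
  set R : Finset (Fin n) := {i | G.start i < t ∧ t < G.start i + J.proc i} with hR
  have hRmem : ∀ i ∈ R, G.start i < t ∧ t < G.start i + J.proc i := fun i hi => by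
    simpa [hR] using hi
  have hpt : ∀ i ∈ R, min (J.proc i) X ≤ (if X < J.proc i then X else 0) +
      ((∑ l ∈ Finset.range L, (if X / 2 ^ (l + 1) < J.proc i ∧ J.proc i ≤ X / 2 ^ l
        then X / 2 ^ l else 0)) + (if J.proc i ≤ X / 2 ^ L then X / 2 ^ L else 0)) := by
    intro i _
    by_cases h : X < J.proc i
    · rw [if_pos h, min_eq_right h.le]
      have : 0 ≤ (∑ l ∈ Finset.range L, (if X / 2 ^ (l + 1) < J.proc i ∧ J.proc i ≤ X / 2 ^ l
        then X / 2 ^ l else 0)) := Finset.sum_nonneg fun l _ => by split_ifs <;> positivity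
      have : 0 ≤ (if J.proc i ≤ X / 2 ^ L then X / 2 ^ L else 0) := by split_ifs <;> positivity
      linarith
    · rw [if_neg h, zero_add]
      exact (min_le_left _ _).trans (le_sum_dyadic hX0 (not_lt.1 h) L)
  refine (Finset.sum_le_sum hpt).trans ?_
  rw [Finset.sum_add_distrib, Finset.sum_add_distrib, Finset.sum_comm]
  have e1 : ∑ i ∈ R, (if X < J.proc i then X else 0) ≤ X + J.total / ρ := by
    rw [← Finset.sum_filter, Finset.sum_const, nsmul_eq_mul]
    refine G.card_mul_le (t := t) hρ hM hX0 le_rfl _ (fun g hg => ?_) fun g hg h _ => ?_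
    · rw [Finset.mem_filter] at hg
      exact ⟨(hRmem g hg.1).1, (hRmem g hg.1).2, hg.2.le⟩
    · rw [Finset.mem_filter] at hg
      right
      have : J.total = M * X := by rw [hX]; field_simp
      have h1 : (M : ℝ) * X ≤ M * J.proc g := by gcongr; exact hg.2.le
      linarith [J.volume_le_total (G.start h)]
  have e2 : ∑ l ∈ Finset.range L, ∑ i ∈ R, (if X / 2 ^ (l + 1) < J.proc i ∧
      J.proc i ≤ X / 2 ^ l then X / 2 ^ l else 0) ≤ 2 * X + 2 * L * (J.total / ρ) := by
    have hcl : ∀ l ∈ Finset.range L, ∑ i ∈ R, (if X / 2 ^ (l + 1) < J.proc i ∧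
      J.proc i ≤ X / 2 ^ l then X / 2 ^ l else 0) ≤ X * (1 / 2) ^ l + 2 * (J.total / ρ) := by
      intro l _
      rw [← Finset.sum_filter, Finset.sum_const, nsmul_eq_mul]
      have hhalf : X / 2 ^ l = 2 * (X / 2 ^ (l + 1)) := by rw [pow_succ]; field_simp
      have := G.card_mul_le (t := t) (y := X / 2 ^ (l + 1)) hρ hM (by positivity)
        (div_le_self hX0 (one_le_pow₀ (by norm_num)))
        (R.filter fun i => X / 2 ^ (l + 1) < J.proc i ∧ J.proc i ≤ X / 2 ^ l) (fun g hg => ?_)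
        fun g hg h hh => ?_
      · refine (fun (N : ℝ) (hN : N * (X / 2 ^ (l + 1)) ≤ X / 2 ^ (l + 1) + J.total / ρ) => ?_ :
          ∀ N : ℝ, _ → N * (X / 2 ^ l) ≤ _) _ this
        rw [one_div, inv_pow, ← div_eq_mul_inv, hhalf]
        linarith
      · rw [Finset.mem_filter] at hg
        exact ⟨(hRmem g hg.1).1, (hRmem g hg.1).2, hg.2.1.le⟩
      · rw [Finset.mem_filter] at hg hh
        left
        linarith [hg.2.1, hh.2.2]
    refine (Finset.sum_le_sum hcl).trans ?_
    rw [Finset.sum_add_distrib, ← Finset.mul_sum, Finset.sum_const, Finset.card_range,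
      nsmul_eq_mul]
    have : ∑ l ∈ Finset.range L, ((1 : ℝ) / 2) ^ l ≤ 2 := by
      rw [geom_sum_eq (by norm_num)]
      have : (0 : ℝ) ≤ (1 / 2) ^ L := by positivity
      rw [div_le_iff_of_neg (by norm_num)]
      linarith
    nlinarith
  have e3 : ∑ i ∈ R, (if J.proc i ≤ X / 2 ^ L then X / 2 ^ L else 0) ≤ J.total / 2 ^ L := by
    have hcard : (R.card : ℝ) ≤ M := by
      have : R ⊆ G.running t := fun i hi =>
        G.mem_running.2 ⟨(hRmem i hi).1.le, (hRmem i hi).2⟩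
      exact_mod_cast (Finset.card_le_card this).trans (G.card_running_le t)
    calc _ ≤ ∑ i ∈ R, X / 2 ^ L := Finset.sum_le_sum fun i _ => by
            split_ifs
            · exact le_rfl
            · positivity
      _ = R.card * (X / 2 ^ L) := by simp
      _ ≤ M * (X / 2 ^ L) := by gcongr
      _ = J.total / 2 ^ L := by rw [hX]; field_simp
  linarith

end GreedyRun

end FlowTime

/-! ### Short jobs against the preemptive schedule -/

namespace FlowTime

open MeasureTheory
open scoped Classical

namespace PreemptiveSchedule

variable {n m : ℕ} {J : Instance n} (O : PreemptiveSchedule J m)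

/-- The processing that job `i` receives before the time `s`. -/
noncomputable def done (i : Fin n) (s : ℝ) : ℝ := volume.real (O.work i ∩ Set.Iio s)

theorem volume_work_ne_top (i : Fin n) : volume (O.work i) ≠ ⊤ := by
  simp [O.volume_work]

theorem done_le (i : Fin n) (s : ℝ) : O.done i s ≤ J.proc i := by
  have h := measureReal_mono (μ := volume) (Set.inter_subset_left (s := O.work i) (t := Set.Iio s))
    (O.volume_work_ne_top i)
  refine h.trans (le_of_eq ?_)
  rw [measureReal_def, O.volume_work, ENNReal.toReal_ofReal (J.proc_pos i).le]

theorem done_nonneg (i : Fin n) (s : ℝ) : 0 ≤ O.done i s := measureReal_nonneg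

theorem done_eq (i : Fin n) {s : ℝ} (hs : O.completion i ≤ s) : O.done i s = J.proc i := by
  have h1 : volume (O.work i) ≤ volume (O.work i ∩ Set.Iio s) + volume {s} := by
    refine (measure_mono ?_).trans (measure_union_le _ _)
    intro t ht
    rcases lt_or_eq_of_le (((O.isLUB_work i).1 ht).trans hs) with h | h
    · exact Or.inl ⟨ht, h⟩
    · exact Or.inr h
  rw [Real.volume_singleton, add_zero] at h1
  have h2 := le_antisymm h1 (measure_mono Set.inter_subset_left)
  rw [done, measureReal_def, ← h2, O.volume_work, ENNReal.toReal_ofReal (J.proc_pos i).le]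

theorem done_eq_zero (i : Fin n) {s : ℝ} (hs : s ≤ J.release i) : O.done i s = 0 := by
  have : O.work i ∩ Set.Iio s = ∅ := by
    ext t
    simp only [Set.mem_inter_iff, Set.mem_Iio, Set.mem_empty_iff_false, iff_false, not_and, not_lt]
    exact fun ht => hs.trans (O.release_le i t ht)
  simp [done, this]

theorem proc_le (i : Fin n) : J.proc i ≤ O.completion i - J.release i := by
  have h : volume (O.work i) ≤ volume (Set.Icc (J.release i) (O.completion i)) :=
    measure_mono fun t ht => ⟨O.release_le i t ht, (O.isLUB_work i).1 ht⟩
  rw [O.volume_work, Real.volume_Icc] at h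
  by_contra hlt
  exact absurd h (not_le.2 ((ENNReal.ofReal_lt_ofReal_iff (J.proc_pos i)).2 (not_le.1 hlt)))

theorem total_le_flowTime : J.total ≤ O.flowTime := Finset.sum_le_sum fun i _ => O.proc_le i

/-- In the time from `a` to `s` the machines process a volume of at most `m * (s - a)`. -/
theorem sum_done_le (Q : Finset (Fin n)) {a s : ℝ} (has : a ≤ s) :
    ∑ i ∈ Q, O.done i s ≤ ∑ i ∈ Q, O.done i a + m * (s - a) := by
  have hsplit : ∀ i ∈ Q, O.done i s ≤ O.done i a + volume.real (O.work i ∩ Set.Ico a s) := by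
    intro i _
    refine le_trans (measureReal_mono (fun t ht => ?_) ?_) (measureReal_union_le _ _)
    · by_cases h : t < a
      · exact Or.inl ⟨ht.1, h⟩
      · exact Or.inr ⟨ht.1, not_lt.1 h, ht.2⟩
    · refine ne_top_of_le_ne_top (O.volume_work_ne_top i) (measure_mono ?_)
      rintro t (ht | ht) <;> exact ht.1
  refine (Finset.sum_le_sum hsplit).trans ?_
  rw [Finset.sum_add_distrib]
  gcongr
  rw [← Finset.sum_fiberwise_of_maps_to (s := Q) (t := Finset.univ) (g := O.machine)
    (fun _ _ => Finset.mem_univ _)]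
  have hk : ∀ k ∈ (Finset.univ : Finset (Fin m)),
      ∑ i ∈ Q with O.machine i = k, volume.real (O.work i ∩ Set.Ico a s) ≤ s - a := by
    intro k _
    rw [← measureReal_biUnion_finset (h := fun i _ => ne_top_of_le_ne_top
      (O.volume_work_ne_top i) (measure_mono Set.inter_subset_left))]
    · have : volume.real (Set.Ico a s) = s - a := by
        rw [measureReal_def, Real.volume_Ico, ENNReal.toReal_ofReal (by linarith)]
      rw [← this]
      refine measureReal_mono ?_ (by simp)
      exact Set.iUnion₂_subset fun i _ => Set.inter_subset_right
    · intro i hi j hj hij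
      simp only [Finset.coe_filter, Set.mem_ofPred_eq] at hi hj
      exact (O.disjoint i j hij (hi.2.trans hj.2.symm)).mono Set.inter_subset_left
        Set.inter_subset_left
    · exact fun i _ => (O.measurableSet_work i).inter measurableSet_Ico
  refine (Finset.sum_le_sum hk).trans ?_
  rw [Finset.sum_const, Finset.card_univ, Fintype.card_fin, nsmul_eq_mul]

end PreemptiveSchedule

namespace GreedyRun

variable {n M ρ : ℕ} {J : Instance n} (G : GreedyRun J M ρ)

/-- At the time `t` job `i` is waiting and is short compared with the volume released so far. -/
def ShortPending (t : ℝ) (i : Fin n) : Prop :=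
  J.release i ≤ t ∧ t < G.start i ∧ M * ρ * J.proc i ≤ J.volume t

variable {G}

theorem ShortPending.busy {t : ℝ} {i : Fin n} (h : G.ShortPending t i) : G.Busy t := by
  refine (G.nonidle t i h.1 h.2.1).resolve_right (not_not.2 (Or.inl ?_))
  have hc : Finset.card {a | G.start a ≤ t ∧ t < G.start a + J.proc a ∧
      J.Heavy M (J.volume t) a i} ≤ M := by
    refine (Finset.card_le_card fun a ha => ?_).trans (G.card_running_le t)
    simp only [Finset.mem_filter, Finset.mem_univ, true_and] at ha
    exact G.mem_running.2 ⟨ha.1, ha.2.1⟩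
  have hp := J.proc_pos i
  calc _ ≤ (M : ℝ) * (ρ * J.proc i) := by gcongr
    _ = M * ρ * J.proc i := by ring
    _ ≤ _ := h.2.2

variable (G)

/-- The beginning `a` of the busy period before `t` in which always a short job of length at most `x`
is waiting: the jobs of length at most `x` that were waiting just before `a` were not short, and so
had a small total volume. -/
theorem exists_busy_period {t x : ℝ} (hx : 0 ≤ x) (ht : ∃ i, G.ShortPending t i ∧ J.proc i ≤ x) :
    ∃ a ≤ t, (∀ s ∈ Set.Icc a t, ∃ i, G.ShortPending s i ∧ J.proc i ≤ x) ∧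
      ∑ i with J.proc i ≤ x ∧ J.release i < a ∧ a ≤ G.start i, J.proc i ≤ M * ρ * x ∧
      ∀ b ≤ t, (∀ s ∈ Set.Icc b t, ∃ i, G.ShortPending s i ∧ J.proc i ≤ x) → a ≤ b := by
  set Z : Finset (Fin n) := {k | J.release k ≤ t ∧
    ∀ s ∈ Set.Icc (J.release k) t, ∃ i, G.ShortPending s i ∧ J.proc i ≤ x} with hZ
  have hmemZ : ∀ k, k ∈ Z ↔ (J.release k ≤ t ∧
    ∀ s ∈ Set.Icc (J.release k) t, ∃ i, G.ShortPending s i ∧ J.proc i ≤ x) := by simp [hZ]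
  -- A busy period can be extended to the last release before it.
  have hext : ∀ b ≤ t, (∀ s ∈ Set.Icc b t, ∃ i, G.ShortPending s i ∧ J.proc i ≤ x) →
      ∃ k ∈ Z, J.release k ≤ b := by
    intro b hb hP
    obtain ⟨i, hi, hix⟩ := hP b ⟨le_rfl, hb⟩
    obtain ⟨k, hk, hmax⟩ := Finset.exists_max_image ({k | J.release k ≤ b} : Finset (Fin n))
      J.release ⟨i, by simpa using hi.1⟩
    simp only [Finset.mem_filter, Finset.mem_univ, true_and] at hk hmax
    refine ⟨k, (hmemZ k).2 ⟨hk.trans hb, fun s hs => ?_⟩, hk⟩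
    rcases le_or_gt b s with h | h
    · exact hP s ⟨h, hs.2⟩
    · refine ⟨i, ⟨(hmax i hi.1).trans hs.1, h.trans hi.2.1, ?_⟩, hix⟩
      rw [J.volume_eq_of_forall h.le fun j hj => (hmax j hj).trans hs.1]
      exact hi.2.2
  obtain ⟨k₀, hk₀, -⟩ := hext t le_rfl (by
    intro s hs
    rw [Set.Icc_self] at hs
    rw [Set.mem_singleton_iff.1 hs]
    exact ht)
  obtain ⟨k, hk, hmin⟩ := Z.exists_min_image J.release ⟨k₀, hk₀⟩
  obtain ⟨hkt, hkP⟩ := (hmemZ k).1 hk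
  refine ⟨J.release k, hkt, hkP, ?_, fun b hb hP => ?_⟩
  · set a := J.release k with ha
    set H : Finset (Fin n) := {i | J.proc i ≤ x ∧ J.release i < a ∧ a ≤ G.start i} with hH
    have hHm : ∀ i ∈ H, J.proc i ≤ x ∧ J.release i < a ∧ a ≤ G.start i := fun i hi => by
      simpa [hH] using hi
    rcases H.eq_empty_or_nonempty with h0 | ⟨h, hh⟩
    · rw [h0, Finset.sum_empty]
      positivity
    obtain ⟨l, hl, hmax⟩ := Finset.exists_max_image ({k | J.release k < a} : Finset (Fin n))
      J.release ⟨h, by simpa using (hHm h hh).2.1⟩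
    simp only [Finset.mem_filter, Finset.mem_univ, true_and] at hl hmax
    have hlong : J.volume (J.release l) ≤ M * ρ * J.proc h := by
      by_contra hlt
      have : l ∈ Z := by
        refine (hmemZ l).2 ⟨hl.le.trans hkt, fun s hs => ?_⟩
        rcases le_or_gt a s with h' | h'
        · exact hkP s ⟨h', hs.2⟩
        · exact ⟨h, ⟨(hmax h (hHm h hh).2.1).trans hs.1, h'.trans_le (hHm h hh).2.2,
            (not_le.1 hlt).le.trans (J.volume_mono hs.1)⟩, (hHm h hh).1⟩
      exact absurd (hmin l this) (not_le.2 hl)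
    calc _ ≤ J.volume (J.release l) := J.sum_le_volume H fun i hi => hmax i (hHm i hi).2.1
      _ ≤ M * ρ * J.proc h := hlong
      _ ≤ M * ρ * x := by gcongr; exact (hHm h hh).1
  · obtain ⟨l, hl, hlb⟩ := hext b hb hP
    exact (hmin l hl).trans hlb

/-- When all machines are busy from `a` to `t`, they process the jobs started meanwhile, except for
the time needed by the jobs already running at the time `a`. -/
theorem mul_le_of_busy (hM : 0 < M) {a t : ℝ} (hbusy : ∀ s ∈ Set.Ico a t, G.Busy s) :
    M * (t - a) ≤ ∑ i with G.start i < a ∧ a < G.start i + J.proc i,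
        min (J.proc i) (J.total / M) +
      ∑ i with a ≤ G.start i ∧ G.start i < t, J.proc i := by
  have hM' : (0 : ℝ) < M := by exact_mod_cast hM
  have htot := J.total_nonneg
  have hlen : t - a ≤ J.total / M := by
    have := G.measure_le_of_le_card_running hM' htot (Set.Ico a t) fun s hs =>
      ⟨by exact_mod_cast (hbusy s hs).le_card, J.volume_le_total s⟩
    rw [Real.volume_Ico] at this
    exact (ENNReal.ofReal_le_ofReal_iff (by positivity)).1 this
  have hint : ENNReal.ofReal (M * (t - a)) ≤
      ∑ i, volume (Set.Ico (G.start i) (G.start i + J.proc i) ∩ Set.Ico a t) := by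
    calc ENNReal.ofReal (M * (t - a)) = ∫⁻ _ in Set.Ico a t, (M : ENNReal) := by
          rw [lintegral_const, Measure.restrict_apply MeasurableSet.univ, Set.univ_inter,
            Real.volume_Ico, ENNReal.ofReal_mul hM'.le, ENNReal.ofReal_natCast]
      _ ≤ ∫⁻ s in Set.Ico a t, ∑ i, (Set.Ico (G.start i) (G.start i + J.proc i)).indicator 1 s := by
          refine setLIntegral_mono (Finset.measurable_fun_sum _ fun i _ =>
            measurable_one.indicator measurableSet_Ico) fun s hs => ?_
          simp only [Set.indicator_apply, Set.mem_Ico, Pi.one_apply]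
          rw [← Finset.sum_filter, Finset.sum_const, nsmul_eq_mul, mul_one]
          exact_mod_cast (hbusy s hs).le_card
      _ = _ := by
          rw [lintegral_finsetSum _ fun i _ => measurable_one.indicator measurableSet_Ico]
          refine Finset.sum_congr rfl fun i _ => ?_
          rw [lintegral_indicator_one measurableSet_Ico,
            Measure.restrict_apply measurableSet_Ico]
  have hterm : ∀ i, volume (Set.Ico (G.start i) (G.start i + J.proc i) ∩ Set.Ico a t) ≤
      ENNReal.ofReal ((if G.start i < a ∧ a < G.start i + J.proc i then
        min (J.proc i) (J.total / M) else 0) +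
        (if a ≤ G.start i ∧ G.start i < t then J.proc i else 0)) := by
    intro i
    have hp := J.proc_pos i
    rw [Set.Ico_inter_Ico, Real.volume_Ico]
    rw [ENNReal.ofReal_le_ofReal_iff']
    rcases lt_or_ge (G.start i) a with h1 | h1
    · rw [max_eq_right h1.le, if_neg (c := a ≤ G.start i ∧ G.start i < t) (by intro h; linarith [h.1])]
      by_cases h2 : a < G.start i + J.proc i
      · left
        rw [if_pos ⟨h1, h2⟩, add_zero]
        refine le_min ?_ ?_
        · linarith [min_le_left (G.start i + J.proc i) t]
        · linarith [min_le_right (G.start i + J.proc i) t]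
      · right
        linarith [min_le_left (G.start i + J.proc i) t]
    · rw [max_eq_left h1, if_neg (c := G.start i < a ∧ a < G.start i + J.proc i)
        (by intro h; linarith [h.1])]
      by_cases h2 : G.start i < t
      · left
        rw [if_pos ⟨h1, h2⟩]
        linarith [min_le_left (G.start i + J.proc i) t]
      · right
        linarith [min_le_right (G.start i + J.proc i) t]
  have hnn : ∀ i ∈ (Finset.univ : Finset (Fin n)),
      0 ≤ (if G.start i < a ∧ a < G.start i + J.proc i then
        min (J.proc i) (J.total / M) else 0) +
        (if a ≤ G.start i ∧ G.start i < t then J.proc i else 0) := by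
    intro i _
    have hp := (J.proc_pos i).le
    have : 0 ≤ min (J.proc i) (J.total / M) := le_min hp (by positivity)
    split_ifs <;> simp [hp, this]
    all_goals positivity
  have hfin := hint.trans (Finset.sum_le_sum fun i _ => hterm i)
  rw [← ENNReal.ofReal_sum_of_nonneg hnn,
    ENNReal.ofReal_le_ofReal_iff (Finset.sum_nonneg hnn), Finset.sum_add_distrib] at hfin
  rw [Finset.sum_filter, Finset.sum_filter]
  exact hfin

/-- The waiting volume of jobs of length at most `x`, at a time when such a job is short, compared
with the preemptive schedule delayed by `Δ`. -/
theorem sum_pending_le (hM : 0 < M) (O : PreemptiveSchedule J M) {Δ : ℝ}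
    (hΔ : ∀ a, ∑ i with G.start i < a ∧ a < G.start i + J.proc i,
      min (J.proc i) (J.total / M) ≤ M * Δ)
    {t x : ℝ} (hx : 0 ≤ x) (ht : ∃ i, G.ShortPending t i ∧ J.proc i ≤ x) :
    ∑ i with J.proc i ≤ x ∧ J.release i ≤ t ∧ t < G.start i, J.proc i ≤
      ∑ i with J.proc i ≤ x ∧ J.release i ≤ t ∧ t < O.completion i + Δ, J.proc i + M * ρ * x := by
  have hM' : (0 : ℝ) < M := by exact_mod_cast hM
  obtain ⟨a, hat, hP, hbefore, -⟩ := G.exists_busy_period hx ht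
  have hstart : ∀ y, a ≤ G.start y → G.start y < t → J.proc y ≤ x := by
    intro y hay hyt
    obtain ⟨i, hi, hix⟩ := hP (G.start y) ⟨hay, hyt.le⟩
    exact (G.shortest y i hi.1 hi.2.1 hi.2.2).trans hix
  have hbusy := G.mul_le_of_busy hM fun s hs => by
    obtain ⟨i, hi, -⟩ := hP s ⟨hs.1, hs.2.le⟩
    exact hi.busy
  have hΔa := hΔ a
  have hnew0 : 0 ≤ ∑ i with a ≤ G.start i ∧ G.start i < t, J.proc i :=
    Finset.sum_nonneg fun i _ => (J.proc_pos i).le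
  -- The preemptive schedule, stopped at `t - Δ`, has not done more than what was released before
  -- `a` together with what the greedy run has started since `a`.
  have hdone : ∑ i with J.proc i ≤ x, O.done i (t - Δ) ≤
      ∑ i with J.proc i ≤ x ∧ J.release i < a, J.proc i +
        ∑ i with a ≤ G.start i ∧ G.start i < t, J.proc i := by
    have hrel : ∀ s ≤ a, ∑ i with J.proc i ≤ x, O.done i s ≤
        ∑ i with J.proc i ≤ x ∧ J.release i < a, J.proc i := by
      intro s hs
      rw [← Finset.filter_filter, Finset.sum_filter (p := fun i => J.release i < a)]
      refine Finset.sum_le_sum fun i _ => ?_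
      split_ifs with h
      · exact O.done_le i s
      · exact (O.done_eq_zero i (hs.trans (not_lt.1 h))).le
    rcases le_or_gt (t - Δ) a with h | h
    · linarith [hrel (t - Δ) h]
    · have := O.sum_done_le ({i | J.proc i ≤ x} : Finset (Fin n)) h.le
      have := hrel a le_rfl
      nlinarith
  have hleft : ∑ i with J.proc i ≤ x ∧ J.release i ≤ t, J.proc i ≤
      ∑ i with J.proc i ≤ x ∧ J.release i ≤ t ∧ t < O.completion i + Δ, J.proc i +
        ∑ i with J.proc i ≤ x, O.done i (t - Δ) := by
    simp only [Finset.sum_filter]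
    rw [← Finset.sum_add_distrib]
    refine Finset.sum_le_sum fun i _ => ?_
    have hp := J.proc_pos i
    have h0 := O.done_nonneg i (t - Δ)
    by_cases hQ : J.proc i ≤ x
    · by_cases hr : J.release i ≤ t
      · by_cases hc : t < O.completion i + Δ
        · simp [hQ, hr, hc, h0]
        · have := O.done_eq i (s := t - Δ) (by linarith)
          simp [hQ, hr, hc, this]
      · simp [hQ, hr, h0]
    · simp [hQ]
  have hmain : ∑ i with J.proc i ≤ x ∧ J.release i ≤ t ∧ t < G.start i, J.proc i +
      ∑ i with J.proc i ≤ x ∧ J.release i < a, J.proc i +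
      ∑ i with a ≤ G.start i ∧ G.start i < t, J.proc i ≤
      ∑ i with J.proc i ≤ x ∧ J.release i < a ∧ a ≤ G.start i, J.proc i +
      ∑ i with J.proc i ≤ x ∧ J.release i ≤ t, J.proc i := by
    simp only [Finset.sum_filter]
    simp only [← Finset.sum_add_distrib]
    refine Finset.sum_le_sum fun i _ => ?_
    have hp := J.proc_pos i
    have hs := hstart i
    have hr := G.release_le_start i
    grind
  linarith

end GreedyRun

end FlowTime

/-! ### Waiting times -/

namespace FlowTime

open MeasureTheory
open scoped Classical

/-- The weights `1, 1, 2, 4, …` with partial sums `1, 2, 4, 8, …`. -/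
def dyadicWeight (l : ℕ) : ℝ := if l = 0 then 1 else 2 ^ (l - 1)

theorem dyadicWeight_nonneg (l : ℕ) : 0 ≤ dyadicWeight l := by
  unfold dyadicWeight
  split_ifs <;> positivity

theorem sum_dyadicWeight (L : ℕ) : ∑ l ∈ Finset.range (L + 1), dyadicWeight l = 2 ^ L := by
  induction L with
  | zero => simp [dyadicWeight]
  | succ L ih =>
    rw [Finset.sum_range_succ, ih]
    simp only [dyadicWeight, Nat.add_eq_zero_iff, one_ne_zero, and_false, if_false,
      Nat.add_sub_cancel]
    ring

theorem sum_dyadicWeight_div (L : ℕ) :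
    ∑ l ∈ Finset.range (L + 1), dyadicWeight l / 2 ^ l = 1 + L / 2 := by
  induction L with
  | zero => simp [dyadicWeight]
  | succ L ih =>
    rw [Finset.sum_range_succ, ih]
    simp only [dyadicWeight, Nat.add_eq_zero_iff, one_ne_zero, and_false, if_false,
      Nat.add_sub_cancel]
    push_cast
    field_simp
    ring

theorem sum_dyadicWeight_mul_le {z : ℝ} (hz : 0 ≤ z) (L : ℕ) :
    (∑ l ∈ Finset.range (L + 1), if 2 ^ l * z ≤ 1 then dyadicWeight l else 0) * z ≤ 1 := by
  induction L with
  | zero =>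
    simp only [zero_add, Finset.sum_range_one, pow_zero, one_mul, dyadicWeight, if_true]
    split_ifs with h
    · simpa using h
    · simp
  | succ L ih =>
    by_cases h : 2 ^ (L + 1) * z ≤ 1
    · refine le_trans (mul_le_mul_of_nonneg_right ?_ hz) h
      rw [← sum_dyadicWeight]
      refine Finset.sum_le_sum fun l _ => ?_
      split_ifs
      · exact le_rfl
      · exact dyadicWeight_nonneg l
    · rw [Finset.sum_range_succ, if_neg h, add_zero]
      exact ih

theorem le_sum_dyadicWeight_mul {z : ℝ} (hz : 0 ≤ z) (hz1 : z ≤ 1) {L : ℕ} (hL : 1 < 2 ^ L * z) :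
    1 ≤ 2 * ((∑ l ∈ Finset.range (L + 1), if 2 ^ l * z ≤ 1 then dyadicWeight l else 0) * z) := by
  induction L with
  | zero => linarith
  | succ L ih =>
    by_cases h : 1 < 2 ^ L * z
    · refine (ih h).trans ?_
      rw [Finset.sum_range_succ _ (L + 1), if_neg (not_le.2 hL), add_zero]
    · have hle : (2 : ℝ) ^ L ≤
          ∑ l ∈ Finset.range (L + 1 + 1), if 2 ^ l * z ≤ 1 then dyadicWeight l else 0 := by
        rw [Finset.sum_range_succ _ (L + 1), if_neg (not_le.2 hL), add_zero, ← sum_dyadicWeight]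
        refine Finset.sum_le_sum fun l hl => ?_
        rw [if_pos]
        refine le_trans ?_ (not_lt.1 h)
        gcongr
        · norm_num
        · simpa [Nat.lt_succ_iff] using hl
      rw [pow_succ] at hL
      nlinarith

namespace GreedyRun

variable {n M ρ : ℕ} {J : Instance n} (G : GreedyRun J M ρ)

/-- A job waits only for a time of order `ρ * p * L` until it becomes short. -/
theorem volume_long_le (hρ : 0 < ρ) (hM : 0 < M) {L : ℕ} (hML : M ≤ 2 ^ L) (hρL : ρ ≤ 2 ^ L)
    (j : Fin n) :
    volume {t | J.release j ≤ t ∧ t < G.start j ∧ J.volume t < M * ρ * J.proc j} ≤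
      ENNReal.ofReal ((1 + 4 * L) * (ρ * J.proc j)) := by
  have hρ' : (0 : ℝ) < ρ := by exact_mod_cast hρ
  have hM' : (0 : ℝ) < M := by exact_mod_cast hM
  have hp := J.proc_pos j
  set T := {t | J.release j ≤ t ∧ t < G.start j ∧ J.volume t < M * ρ * J.proc j} with hT
  have hsub : T ⊆ (T ∩ {t | G.Busy t}) ∪ ⋃ l ∈ Finset.range (2 * L),
      (T ∩ {t | ¬ G.Busy t ∧ 2 ^ l * J.proc j ≤ J.volume t ∧
        J.volume t ≤ 2 ^ (l + 1) * J.proc j}) := by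
    intro t ht
    by_cases hb : G.Busy t
    · exact Or.inl ⟨ht, hb⟩
    right
    obtain ⟨l, hl1, hl2⟩ := exists_nat_pow_near (x := J.volume t / J.proc j) (y := (2 : ℝ))
      ((one_le_div hp).2 (J.proc_le_volume ht.1)) (by norm_num)
    rw [le_div_iff₀ hp] at hl1
    rw [div_lt_iff₀ hp] at hl2
    refine Set.mem_biUnion (x := l) ?_ ⟨ht, hb, hl1, hl2.le⟩
    have h1 : (2 : ℝ) ^ l * J.proc j < 2 ^ (2 * L) * J.proc j := by
      refine hl1.trans_lt (ht.2.2.trans_le ?_)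
      have hML' : (M : ℝ) ≤ 2 ^ L := by exact_mod_cast hML
      have hρL' : (ρ : ℝ) ≤ 2 ^ L := by exact_mod_cast hρL
      rw [two_mul, pow_add]
      gcongr
    have h2 := lt_of_mul_lt_mul_right h1 hp.le
    simpa using (pow_lt_pow_iff_right₀ (by norm_num : (1 : ℝ) < 2)).1 h2
  have h1 : volume (T ∩ {t | G.Busy t}) ≤ ENNReal.ofReal (ρ * J.proc j) := by
    have := G.measure_le_of_le_card_running (κ := M) (v := M * ρ * J.proc j) hM' (by positivity)
      (T ∩ {t | G.Busy t}) fun t ht => ⟨by exact_mod_cast Busy.le_card ht.2, ht.1.2.2.le⟩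
    convert this using 2
    field_simp
  have h2 : ∀ l ∈ Finset.range (2 * L), volume (T ∩ {t | ¬ G.Busy t ∧
      2 ^ l * J.proc j ≤ J.volume t ∧ J.volume t ≤ 2 ^ (l + 1) * J.proc j}) ≤
      ENNReal.ofReal (2 * (ρ * J.proc j)) := by
    intro l _
    have := G.measure_le_of_le_card_running (κ := 2 ^ l / ρ) (v := 2 ^ (l + 1) * J.proc j)
      (by positivity) (by positivity) (T ∩ {t | ¬ G.Busy t ∧
      2 ^ l * J.proc j ≤ J.volume t ∧ J.volume t ≤ 2 ^ (l + 1) * J.proc j}) fun t ht => by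
        refine ⟨?_, ht.2.2.2⟩
        have hns := (G.nonidle t j ht.1.1 ht.1.2.1).resolve_left ht.2.1
        have hlt := not_le.1 (not_or.1 hns).1
        rw [div_le_iff₀ hρ']
        refine le_of_mul_le_mul_right (ht.2.2.1.trans (hlt.le.trans ?_)) hp
        rw [← mul_assoc]
        gcongr
        intro a ha
        simp only [Finset.mem_filter, Finset.mem_univ, true_and] at ha
        exact G.mem_running.2 ⟨ha.1, ha.2.1⟩
    convert this using 2
    rw [pow_succ]
    field_simp
  calc volume T ≤ _ := measure_mono hsub
    _ ≤ _ := measure_union_le _ _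
    _ ≤ ENNReal.ofReal (ρ * J.proc j) +
        ∑ l ∈ Finset.range (2 * L), ENNReal.ofReal (2 * (ρ * J.proc j)) :=
      add_le_add h1 ((measure_biUnion_finset_le _ _).trans (Finset.sum_le_sum h2))
    _ = _ := by
      rw [Finset.sum_const, Finset.card_range, nsmul_eq_mul, ← ENNReal.ofReal_natCast,
        ← ENNReal.ofReal_mul (by positivity), ← ENNReal.ofReal_add (by positivity) (by positivity)]
      push_cast
      ring_nf

/-- The jobs running at any one moment block the machines, within a busy period, for a total time of
at most `M * Δ`; a job longer than `J.total / M` is counted with `J.total / M` only, as no busy period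
is longer than that. -/
def BlockedAtMost (Δ : ℝ) : Prop :=
  ∀ a, ∑ i with G.start i < a ∧ a < G.start i + J.proc i,
    min (J.proc i) (J.total / M) ≤ M * Δ

/-- After it has become short, a job of length at most `x` waits for running jobs and for jobs of
length at most `x` only. -/
theorem volume_short_le (hM : 0 < M) {Δ : ℝ} (hΔ : G.BlockedAtMost Δ) {x : ℝ}
    {j : Fin n} (hj : J.proc j ≤ x) :
    volume {t | G.ShortPending t j} ≤ ENNReal.ofReal (Δ + n * x / M) := by
  have hM' : (0 : ℝ) < M := by exact_mod_cast hM
  have hx : 0 ≤ x := (J.proc_pos j).le.trans hj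
  have key : ∀ s t, s ≤ t → G.ShortPending s j → G.ShortPending t j → t - s ≤ Δ + n * x / M := by
    intro s t hst hs ht
    obtain ⟨a, hat, hP, -, hmin⟩ := G.exists_busy_period hx ⟨j, ht, hj⟩
    have has : a ≤ s := hmin s hst fun u hu =>
      ⟨j, ⟨hs.1.trans hu.1, hu.2.trans_lt ht.2.1, hs.2.2.trans (J.volume_mono hu.1)⟩, hj⟩
    have hbusy := G.mul_le_of_busy hM (a := a) (t := t) fun s hs => by
      obtain ⟨i, hi, -⟩ := hP s ⟨hs.1, hs.2.le⟩
      exact hi.busy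
    have hnew : ∑ i with a ≤ G.start i ∧ G.start i < t, J.proc i ≤ n * x := by
      refine (Finset.sum_le_card_nsmul _ _ x fun y hy => ?_).trans ?_
      · simp only [Finset.mem_filter, Finset.mem_univ, true_and] at hy
        obtain ⟨i, hi, hix⟩ := hP (G.start y) ⟨hy.1, hy.2.le⟩
        exact (G.shortest y i hi.1 hi.2.1 hi.2.2).trans hix
      · rw [nsmul_eq_mul]
        gcongr
        exact_mod_cast (Finset.card_le_univ _).trans (by simp)
    have h1 : M * (t - a) ≤ M * (Δ + n * x / M) := by
      rw [mul_add, mul_div_cancel₀ _ hM'.ne']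
      linarith [hΔ a]
    linarith [le_of_mul_le_mul_left h1 hM']
  refine (Real.volume_le_diam _).trans (Metric.ediam_le fun s hs t ht => ?_)
  rw [edist_dist, Real.dist_eq]
  refine ENNReal.ofReal_le_ofReal ?_
  rcases le_total s t with h | h
  · rw [abs_sub_comm, abs_of_nonneg (by linarith)]
    exact key s t h hs ht
  · rw [abs_of_nonneg (by linarith)]
    exact key t s h ht hs

/-- The number of short waiting jobs whose length is not too small, compared with the number of jobs
alive in the preemptive schedule delayed by `Δ`. -/
theorem card_shortPending_le (hρ : 0 < ρ) (hM : 0 < M) (O : PreemptiveSchedule J M) {Δ : ℝ}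
    (hΔ : G.BlockedAtMost Δ) (L : ℕ) (t : ℝ) :
    (Finset.card {i | G.ShortPending t i ∧ J.total / (M * ρ) < 2 ^ L * J.proc i} : ℝ) ≤
      2 * Finset.card {i | J.release i ≤ t ∧ t < O.completion i + Δ} +
        if ∃ i, G.ShortPending t i then (M * ρ * (2 + L) : ℝ) else 0 := by
  by_cases hex : ∃ i, G.ShortPending t i
  swap
  · rw [if_neg hex, Finset.filter_false_of_mem fun i _ h => hex ⟨i, h.1⟩]
    simp
  rw [if_pos hex]
  have hρ' : (0 : ℝ) < ρ := by exact_mod_cast hρ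
  have hM' : (0 : ℝ) < M := by exact_mod_cast hM
  have hK : (0 : ℝ) < M * ρ := by positivity
  obtain ⟨i₀, -⟩ := hex
  have htot : 0 < J.total := (J.proc_pos i₀).trans_le (J.proc_le_total i₀)
  set x := J.total / (M * ρ) with hx
  have hx0 : 0 < x := by positivity
  set S : Finset (Fin n) := {i | G.ShortPending t i} with hS
  set A : Finset (Fin n) := {i | J.release i ≤ t ∧ t < O.completion i + Δ} with hA
  -- The volume comparison, for jobs of length at most `x / 2 ^ l`.
  have hU : ∀ l : ℕ, ∑ i ∈ S, (if 2 ^ l * (J.proc i / x) ≤ 1 then J.proc i else 0) ≤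
      ∑ i ∈ A, (if 2 ^ l * (J.proc i / x) ≤ 1 then J.proc i else 0) + M * ρ * (x / 2 ^ l) := by
    intro l
    have hiff : ∀ i, 2 ^ l * (J.proc i / x) ≤ 1 ↔ J.proc i ≤ x / 2 ^ l := fun i => by
      rw [le_div_iff₀ (by positivity), ← mul_div_assoc, div_le_one hx0, mul_comm]
    simp only [hiff]
    by_cases h : ∃ i, G.ShortPending t i ∧ J.proc i ≤ x / 2 ^ l
    · have := G.sum_pending_le hM O hΔ (by positivity) h
      rw [← Finset.sum_filter, ← Finset.sum_filter, hS, hA, Finset.filter_filter,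
        Finset.filter_filter]
      refine le_trans (Finset.sum_le_sum_of_subset_of_nonneg (fun i hi => ?_)
        fun j _ _ => (J.proc_pos j).le) (this.trans (le_of_eq ?_))
      · simp only [Finset.mem_filter, Finset.mem_univ, true_and] at hi ⊢
        exact ⟨hi.2, hi.1.1, hi.1.2.1⟩
      · congr 2
        ext i
        simp only [Finset.mem_filter, Finset.mem_univ, true_and]
        tauto
    · rw [Finset.sum_eq_zero]
      · have : 0 ≤ ∑ i ∈ A, (if J.proc i ≤ x / 2 ^ l then J.proc i else 0) :=
          Finset.sum_nonneg fun i _ => by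
            have := (J.proc_pos i).le
            split_ifs
            · exact this
            · exact le_rfl
        positivity
      · intro i hi
        rw [if_neg]
        intro hle
        exact h ⟨i, by simpa [hS] using hi, hle⟩
  have hswap : ∀ B : Finset (Fin n), ∑ l ∈ Finset.range (L + 1), dyadicWeight l / x *
      ∑ i ∈ B, (if 2 ^ l * (J.proc i / x) ≤ 1 then J.proc i else 0) =
      ∑ i ∈ B, (∑ l ∈ Finset.range (L + 1),
        if 2 ^ l * (J.proc i / x) ≤ 1 then dyadicWeight l else 0) * (J.proc i / x) := by
    intro B
    simp only [Finset.mul_sum, Finset.sum_mul]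
    rw [Finset.sum_comm]
    refine Finset.sum_congr rfl fun i _ => Finset.sum_congr rfl fun l _ => ?_
    split_ifs
    · ring
    · ring
  have hsum := Finset.sum_le_sum fun l (_ : l ∈ Finset.range (L + 1)) =>
    mul_le_mul_of_nonneg_left (hU l) (div_nonneg (dyadicWeight_nonneg l) hx0.le)
  simp only [mul_add] at hsum
  rw [Finset.sum_add_distrib, hswap, hswap] at hsum
  have hlast : ∑ l ∈ Finset.range (L + 1), dyadicWeight l / x * (M * ρ * (x / 2 ^ l)) =
      M * ρ * (1 + L / 2) := by
    rw [← sum_dyadicWeight_div, Finset.mul_sum]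
    refine Finset.sum_congr rfl fun l _ => ?_
    field_simp
  rw [hlast] at hsum
  have hz : ∀ i, 0 ≤ J.proc i / x := fun i => div_nonneg (J.proc_pos i).le hx0.le
  have hAle : ∑ i ∈ A, (∑ l ∈ Finset.range (L + 1),
      if 2 ^ l * (J.proc i / x) ≤ 1 then dyadicWeight l else 0) * (J.proc i / x) ≤ A.card := by
    refine (Finset.sum_le_card_nsmul _ _ 1 fun i _ => sum_dyadicWeight_mul_le (hz i) L).trans ?_
    simp
  have hSle : (Finset.card {i | G.ShortPending t i ∧ x < 2 ^ L * J.proc i} : ℝ) ≤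
      2 * ∑ i ∈ S, (∑ l ∈ Finset.range (L + 1),
        if 2 ^ l * (J.proc i / x) ≤ 1 then dyadicWeight l else 0) * (J.proc i / x) := by
    rw [Finset.card_eq_sum_ones, Nat.cast_sum, Finset.mul_sum, ← Finset.filter_filter,
      Finset.sum_filter]
    refine Finset.sum_le_sum fun i hi => ?_
    split_ifs with h
    · rw [Nat.cast_one]
      refine le_sum_dyadicWeight_mul (hz i) ?_ ?_
      · rw [div_le_one hx0, hx, le_div_iff₀ hK, mul_comm]
        have hi' : G.ShortPending t i := by simpa [hS] using hi
        exact hi'.2.2.trans (J.volume_le_total t)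
      · rw [← mul_div_assoc, lt_div_iff₀ hx0, one_mul]
        exact h
    · refine mul_nonneg (by norm_num) (mul_nonneg (Finset.sum_nonneg fun l _ => ?_) (hz i))
      split_ifs
      · exact dyadicWeight_nonneg l
      · exact le_rfl
  linarith

theorem measurableSet_shortPending (j : Fin n) : MeasurableSet {t | G.ShortPending t j} := by
  have : {t | G.ShortPending t j} =
      Set.Ico (J.release j) (G.start j) ∩ {t | M * ρ * J.proc j ≤ J.volume t} := by
    ext t
    simp only [ShortPending, Set.mem_inter_iff, Set.mem_Ico, Set.mem_ofPred_eq]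
    tauto
  rw [this]
  exact measurableSet_Ico.inter (measurableSet_le measurable_const J.volume_mono.measurable)

/-- The total waiting time of short jobs that are not extremely short. The surplus of
`card_shortPending_le` is paid only while all machines are busy. -/
theorem sum_volume_short_le (hρ : 0 < ρ) (hM : 0 < M) (O : PreemptiveSchedule J M) {Δ : ℝ}
    (hΔ0 : 0 ≤ Δ) (hΔ : G.BlockedAtMost Δ) (L : ℕ) :
    ∑ j with J.total / (M * ρ) < 2 ^ L * J.proc j, volume {t | G.ShortPending t j} ≤
      ENNReal.ofReal (2 * (O.flowTime + n * Δ) + ρ * (2 + L) * J.total) := by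
  have hM' : (0 : ℝ) < M := by exact_mod_cast hM
  have htot := J.total_nonneg
  set B : Set ℝ := {t | ∃ i, G.ShortPending t i} with hB
  have hBm : MeasurableSet B := by
    have : B = ⋃ i, {t | G.ShortPending t i} := by
      ext t
      simp [hB]
    rw [this]
    exact MeasurableSet.iUnion G.measurableSet_shortPending
  have hBv : volume B ≤ ENNReal.ofReal (J.total / M) :=
    G.measure_le_of_le_card_running hM' htot B fun t ht => by
      obtain ⟨i, hi⟩ := ht
      exact ⟨by exact_mod_cast hi.busy.le_card, J.volume_le_total t⟩
  have hOv : ∑ i, volume (Set.Ico (J.release i) (O.completion i + Δ)) =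
      ENNReal.ofReal (O.flowTime + n * Δ) := by
    have hnn : ∀ i ∈ (Finset.univ : Finset (Fin n)),
        0 ≤ O.completion i + Δ - J.release i := fun i _ => by
      linarith [O.proc_le i, J.proc_pos i]
    simp only [Real.volume_Ico]
    rw [← ENNReal.ofReal_sum_of_nonneg hnn]
    congr 1
    have : ∀ i, O.completion i + Δ - J.release i = (O.completion i - J.release i) + Δ := fun i => by
      ring
    simp only [this]
    rw [Finset.sum_add_distrib, PreemptiveSchedule.flowTime]
    simp
  calc ∑ j with J.total / (M * ρ) < 2 ^ L * J.proc j, volume {t | G.ShortPending t j}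
      = ∫⁻ t, ∑ j with J.total / (M * ρ) < 2 ^ L * J.proc j,
          ({t | G.ShortPending t j}).indicator 1 t := by
        rw [lintegral_finsetSum _ fun i _ =>
          measurable_one.indicator (G.measurableSet_shortPending i)]
        refine Finset.sum_congr rfl fun i _ => ?_
        rw [lintegral_indicator_one (G.measurableSet_shortPending i)]
    _ ≤ ∫⁻ t, (2 * ∑ i, (Set.Ico (J.release i) (O.completion i + Δ)).indicator 1 t +
          ENNReal.ofReal (M * ρ * (2 + L)) * B.indicator 1 t) := by
        refine lintegral_mono fun t => ?_
        have h := G.card_shortPending_le hρ hM O hΔ L t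
        simp only [Set.indicator_apply, Set.mem_Ico, Pi.one_apply, Set.mem_ofPred_eq]
        rw [← Finset.sum_filter, ← Finset.sum_filter, Finset.filter_filter]
        simp only [Finset.sum_const, nsmul_eq_mul, mul_one]
        have h' := ENNReal.ofReal_le_ofReal h
        rw [ENNReal.ofReal_add (by positivity) (by split_ifs <;> positivity),
          ENNReal.ofReal_mul (by norm_num), ENNReal.ofReal_natCast, ENNReal.ofReal_natCast] at h'
        refine le_trans (le_of_eq ?_) (h'.trans (le_of_eq ?_))
        · congr 2
          ext i
          simp only [Finset.mem_filter, Finset.mem_univ, true_and]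
          tauto
        · congr 1
          · norm_num
          · by_cases hb : ∃ i, G.ShortPending t i
            · rw [if_pos hb, if_pos (show t ∈ B from hb), mul_one]
            · rw [if_neg hb, if_neg (show t ∉ B from hb), mul_zero, ENNReal.ofReal_zero]
    _ = 2 * ∑ i, volume (Set.Ico (J.release i) (O.completion i + Δ)) +
          ENNReal.ofReal (M * ρ * (2 + L)) * volume B := by
        rw [lintegral_add_right _ ((measurable_one.indicator hBm).const_mul _),
          lintegral_const_mul _ (Finset.measurable_fun_sum _ fun i _ =>
            measurable_one.indicator measurableSet_Ico),
          lintegral_const_mul _ (measurable_one.indicator hBm), lintegral_indicator_one hBm,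
          lintegral_finsetSum _ fun i _ => measurable_one.indicator measurableSet_Ico]
        simp only [lintegral_indicator_one measurableSet_Ico]
    _ ≤ 2 * ENNReal.ofReal (O.flowTime + n * Δ) +
          ENNReal.ofReal (M * ρ * (2 + L)) * ENNReal.ofReal (J.total / M) := by
        rw [hOv]
        gcongr
    _ = _ := by
        have hO : 0 ≤ O.flowTime := htot.trans O.total_le_flowTime
        rw [← ENNReal.ofReal_mul (by positivity), ← ENNReal.ofReal_ofNat 2,
          ← ENNReal.ofReal_mul (by norm_num), ← ENNReal.ofReal_add (by positivity) (by positivity)]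
        congr 1
        field_simp

/-- The total waiting time of a greedy run. -/
theorem sum_wait_le (hρ : 0 < ρ) (hM : 0 < M) (hn : n ≤ ρ ^ 2 * M) (hρn : ρ ≤ n) {L : ℕ}
    (hL : n ≤ 2 ^ L) (hMn : M ≤ n) (O : PreemptiveSchedule J M) :
    ∑ j, (G.start j - J.release j) ≤
      (2 + 9 * (n / M ^ 2) + (11 * L + 12) * ρ) * O.flowTime := by
  have hρ' : (0 : ℝ) < ρ := by exact_mod_cast hρ
  have hM' : (0 : ℝ) < M := by exact_mod_cast hM
  have hρ1 : (1 : ℝ) ≤ ρ := by exact_mod_cast hρ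
  have hM1 : (1 : ℝ) ≤ M := by exact_mod_cast hM
  have hn' : (n : ℝ) ≤ ρ ^ 2 * M := by exact_mod_cast hn
  have hL' : (n : ℝ) ≤ 2 ^ L := by exact_mod_cast hL
  have hρn' : (ρ : ℝ) ≤ n := by exact_mod_cast hρn
  have htot := J.total_nonneg
  set V := J.total with hV
  set Δ : ℝ := (3 * (V / M) + (2 * L + 1) * (V / ρ) + V / 2 ^ L) / M with hΔdef
  have hΔ0 : 0 ≤ Δ := by positivity
  have hΔ : G.BlockedAtMost Δ := fun a => by
    rw [hΔdef, mul_div_cancel₀ _ hM'.ne']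
    exact G.sum_min_le hρ hM L a
  have hnΔ : n * Δ ≤ 3 * (n / M ^ 2) * V + (2 * L + 2) * ρ * V := by
    have h1 : V / 2 ^ L ≤ V / ρ := by
      gcongr
      linarith
    have h2 : (n : ℝ) / (M * ρ) ≤ ρ := by
      rw [div_le_iff₀ (by positivity)]
      linarith
    calc n * Δ ≤ n * ((3 * (V / M) + (2 * L + 1) * (V / ρ) + V / ρ) / M) := by
          rw [hΔdef]
          gcongr
      _ = 3 * (n / M ^ 2) * V + (2 * L + 2) * (n / (M * ρ)) * V := by
          field_simp
          ring
      _ ≤ _ := by gcongr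
  set x := V / (M * ρ) / 2 ^ L with hx
  have hpt : ∀ j, ENNReal.ofReal (G.start j - J.release j) ≤
      ENNReal.ofReal ((1 + 4 * L) * (ρ * J.proc j)) + (ENNReal.ofReal (Δ + n * x / M) +
      if V / (M * ρ) < 2 ^ L * J.proc j then volume {t | G.ShortPending t j} else 0) := by
    intro j
    rw [← Real.volume_Ico]
    have hsub : Set.Ico (J.release j) (G.start j) ⊆
        {t | J.release j ≤ t ∧ t < G.start j ∧ J.volume t < M * ρ * J.proc j} ∪
        {t | G.ShortPending t j} := by
      intro t ht
      rcases lt_or_ge (J.volume t) (M * ρ * J.proc j) with h | h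
      · exact Or.inl ⟨ht.1, ht.2, h⟩
      · exact Or.inr ⟨ht.1, ht.2, h⟩
    refine (measure_mono hsub).trans ((measure_union_le _ _).trans (add_le_add
      (G.volume_long_le hρ hM (hMn.trans hL) (hρn.trans hL) j) ?_))
    split_ifs with h
    · exact le_add_self
    · rw [add_zero]
      refine G.volume_short_le hM hΔ ?_
      rw [hx, le_div_iff₀ (by positivity), mul_comm]
      exact not_lt.1 h
  have hsum := Finset.sum_le_sum fun j (_ : j ∈ (Finset.univ : Finset (Fin n))) => hpt j
  rw [Finset.sum_add_distrib, Finset.sum_add_distrib, ← Finset.sum_filter] at hsum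
  have hfin := hsum.trans (add_le_add le_rfl (add_le_add le_rfl
    (G.sum_volume_short_le hρ hM O hΔ0 hΔ L)))
  have hO : 0 ≤ O.flowTime := htot.trans O.total_le_flowTime
  have hx0 : 0 ≤ x := by positivity
  rw [← ENNReal.ofReal_sum_of_nonneg fun j _ => by linarith [G.release_le_start j],
    ← ENNReal.ofReal_sum_of_nonneg fun j _ => by have := J.proc_pos j; positivity,
    Finset.sum_const, Finset.card_univ, Fintype.card_fin, nsmul_eq_mul, ← ENNReal.ofReal_natCast,
    ← ENNReal.ofReal_mul (by positivity), ← ENNReal.ofReal_add (by positivity) (by positivity),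
    ← ENNReal.ofReal_add (by
      refine Finset.sum_nonneg fun j _ => ?_
      have := J.proc_pos j
      positivity) (by positivity),
    ENNReal.ofReal_le_ofReal_iff (add_nonneg (Finset.sum_nonneg fun j _ => by
      have := J.proc_pos j
      positivity) (by positivity)), ← Finset.mul_sum, ← Finset.mul_sum,
    show ∑ j, J.proc j = V from rfl] at hfin
  have hnx : n * (n * x / M) ≤ ρ * V := by
    have h1 : n * x ≤ V / (M * ρ) := by
      rw [hx, mul_div_assoc', div_le_iff₀ (by positivity), mul_comm]
      gcongr
    calc n * (n * x / M) ≤ n * (V / (M * ρ) / M) := by gcongr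
      _ ≤ ρ ^ 2 * M * (V / (M * ρ) / M) := by gcongr
      _ = ρ * V / M := by field_simp
      _ ≤ ρ * V := div_le_self (by positivity) hM1
  have hVO : V ≤ O.flowTime := O.total_le_flowTime
  have hρV : (0 : ℝ) ≤ ρ * V := by positivity
  calc ∑ j, (G.start j - J.release j)
      ≤ (1 + 4 * L) * (ρ * V) + (n * (Δ + n * x / M) +
        (2 * (O.flowTime + n * Δ) + ρ * (2 + L) * V)) := hfin
    _ ≤ 2 * O.flowTime + (9 * (n / M ^ 2) + (11 * L + 10) * ρ) * V := by
        rw [mul_add (n : ℝ)]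
        linarith
    _ ≤ 2 * O.flowTime + (9 * (n / M ^ 2) + (11 * L + 12) * ρ) * O.flowTime := by
        gcongr
        norm_num
    _ = _ := by ring

end GreedyRun

end FlowTime

/-! ### The competitive ratio of greedy runs -/

namespace FlowTime

open scoped Classical

/-- The least natural number that is at least `√(n / M)`. -/
noncomputable def rootRatio (n M : ℕ) : ℕ := sInf {r | n ≤ r ^ 2 * M}

theorem le_rootRatio_sq {n M : ℕ} (h : 0 < M ∨ n = 0) : n ≤ rootRatio n M ^ 2 * M := by
  have hne : {r : ℕ | n ≤ r ^ 2 * M}.Nonempty := by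
    rcases h with h | h
    · exact ⟨n, (Nat.le_self_pow two_ne_zero n).trans (Nat.le_mul_of_pos_right _ h)⟩
    · exact ⟨0, show n ≤ 0 ^ 2 * M by simp [h]⟩
  exact Nat.sInf_mem hne

theorem rootRatio_le_iff {n M r : ℕ} (h : 0 < M ∨ n = 0) :
    rootRatio n M ≤ r ↔ n ≤ r ^ 2 * M := by
  refine ⟨fun hr => (le_rootRatio_sq h).trans ?_, fun hr => Nat.sInf_le hr⟩
  gcongr

theorem rootRatio_le {n M : ℕ} (h : 0 < M ∨ n = 0) : rootRatio n M ≤ n := by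
  rw [rootRatio_le_iff h]
  rcases h with h | h
  · exact (Nat.le_self_pow two_ne_zero n).trans (Nat.le_mul_of_pos_right _ h)
  · simp [h]

theorem rootRatio_pos {n M : ℕ} (hM : 0 < M) (hn : 0 < n) : 0 < rootRatio n M := by
  by_contra h0
  have := (rootRatio_le_iff (n := n) (M := M) (r := 0) (Or.inl hM)).1 (by omega)
  simp at this
  omega

theorem rootRatio_self {n : ℕ} (hn : 0 < n) : rootRatio n n = 1 :=
  le_antisymm ((rootRatio_le_iff (Or.inl hn)).2 (by simp)) (rootRatio_pos hn hn)

theorem rootRatio_le_two_mul_sqrt {n m : ℕ} (hm : 0 < m) (hmn : m ≤ n) :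
    (rootRatio n m : ℝ) ≤ 2 * Real.sqrt (n / m) := by
  have hm' : (0 : ℝ) < m := by exact_mod_cast hm
  have hmn' : (m : ℝ) ≤ n := by exact_mod_cast hmn
  have hq : 1 ≤ Real.sqrt (n / m) := Real.one_le_sqrt.2 ((one_le_div hm').2 hmn')
  have hpos := rootRatio_pos hm (hm.trans_le hmn)
  have h1 : (rootRatio n m - 1) ^ 2 * m < n := by
    by_contra hle
    have := (rootRatio_le_iff (Or.inl hm)).2 (not_lt.1 hle)
    omega
  have h2 : ((rootRatio n m - 1 : ℕ) : ℝ) ≤ Real.sqrt (n / m) := by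
    refine Real.le_sqrt_of_sq_le ?_
    rw [le_div_iff₀ hm']
    exact_mod_cast h1.le
  rw [Nat.cast_sub hpos, Nat.cast_one] at h2
  linarith

/-- With `n` machines nobody waits. -/
theorem GreedyRun.start_eq_release {n : ℕ} {J : Instance n} (G : GreedyRun J n 1) (j : Fin n) :
    G.start j = J.release j := by
  by_contra hne
  have hlt : J.release j < G.start j := lt_of_le_of_ne (G.release_le_start j) (Ne.symm hne)
  have hcard : (G.running (J.release j)).card < n := by
    have : G.running (J.release j) ⊂ Finset.univ := by
      refine Finset.ssubset_univ_iff.2 fun h => ?_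
      have := G.mem_running.1 (h ▸ Finset.mem_univ j)
      linarith [this.1]
    simpa using Finset.card_lt_card this
  rcases G.nonidle _ j le_rfl hlt with h | h
  · exact absurd (Busy.le_card h) (not_le.2 hcard)
  · refine h (Or.inr ?_)
    rw [mul_one]
    refine le_trans (Finset.card_le_card fun a ha => ?_) hcard.le
    simp only [Finset.mem_filter, Finset.mem_univ, true_and] at ha
    exact G.mem_running.2 ⟨ha.1, ha.2.1⟩

/-- The logarithm of `n` can be replaced by that of `m`: when `n` is larger than a power of `m`, the
term `n / m ^ 2` dominates. -/
theorem sqrt_mul_log_le {n m : ℕ} (hm : 0 < m) (hmn : m ≤ n) :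
    Real.sqrt (n / m) * (1 + Real.log n) ≤
      8 * (n / m ^ 2 + Real.sqrt (n / m) * Real.log m) := by
  have hm' : (0 : ℝ) < m := by exact_mod_cast hm
  have hm1 : (1 : ℝ) ≤ m := by exact_mod_cast hm
  have hmn' : (m : ℝ) ≤ n := by exact_mod_cast hmn
  set q := Real.sqrt (n / m) with hq
  have hq1 : 1 ≤ q := Real.one_le_sqrt.2 ((one_le_div hm').2 hmn')
  have hqsq : q ^ 2 = n / m := Real.sq_sqrt (by positivity)
  have hn : (n : ℝ) = q ^ 2 * m := by rw [hqsq]; field_simp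
  have hlogn : Real.log n = 2 * Real.log q + Real.log m := by
    rw [hn, Real.log_mul (by positivity) (by positivity), Real.log_pow]
    push_cast
    ring
  have hlogm : 0 ≤ Real.log m := Real.log_nonneg hm1
  have hnm : (n : ℝ) / m ^ 2 = q ^ 2 / m := by rw [hn]; field_simp
  rw [hlogn, hnm]
  rcases le_or_gt ((m : ℝ) ^ 2) q with h | h
  · set w := Real.sqrt q with hw
    have hw1 : 1 ≤ w := Real.one_le_sqrt.2 hq1
    have hwsq : w ^ 2 = q := Real.sq_sqrt (by positivity)
    have hmw : (m : ℝ) ≤ w := Real.le_sqrt_of_sq_le h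
    have hlogq : Real.log q ≤ 2 * w := by
      rw [← hwsq, Real.log_pow]
      have := Real.log_le_sub_one_of_pos (show 0 < w by linarith)
      push_cast
      linarith
    have h1 : q * (1 + 2 * Real.log q) ≤ 8 * (q ^ 2 / m) := by
      rw [← mul_div_assoc, le_div_iff₀ hm']
      calc q * (1 + 2 * Real.log q) * m ≤ q * (w + 2 * (2 * w)) * w := by gcongr
        _ = 5 * q ^ 2 := by rw [← hwsq]; ring
        _ ≤ 8 * q ^ 2 := by nlinarith [sq_nonneg q]
    have h2 : 0 ≤ q * Real.log m := by positivity
    linarith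
  · have hm2 : (2 : ℝ) ≤ m := by
      by_contra hlt
      have h1 : m = 1 := by
        have : (m : ℝ) < 2 := not_le.1 hlt
        have : m < 2 := by exact_mod_cast this
        omega
      rw [h1] at h
      norm_num at h
      linarith
    have hlog2 : 1 ≤ 2 * Real.log m := by
      have := Real.log_le_log (by norm_num) hm2
      linarith [Real.log_two_gt_d9]
    have hlogq : Real.log q ≤ 2 * Real.log m := by
      have := Real.log_le_log (by linarith) h.le
      rw [Real.log_pow] at this
      exact_mod_cast this
    have h1 : q * (1 + (2 * Real.log q + Real.log m)) ≤ q * (8 * Real.log m) := by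
      gcongr
      linarith
    have h2 : 0 ≤ q ^ 2 / m := by positivity
    linarith

theorem clog_le_two_add {n : ℕ} (hn : 0 < n) : (Nat.clog 2 n : ℝ) ≤ 2 * (1 + Real.log n) := by
  have hn1 : (1 : ℝ) ≤ n := by exact_mod_cast hn
  have hlogn := Real.log_nonneg hn1
  have hlt : 2 ^ Nat.clog 2 n ≤ 2 * n := by
    rcases Nat.lt_or_ge 1 n with h | h
    · have h1 := Nat.pow_pred_clog_lt_self (by norm_num : 1 < 2) h
      have h2 := Nat.clog_pos (by norm_num : 1 < 2) h
      obtain ⟨k, hk⟩ := Nat.exists_eq_succ_of_ne_zero h2.ne'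
      rw [hk] at h1 ⊢
      rw [pow_succ]
      simp only [Nat.pred_succ] at h1
      omega
    · have : n = 1 := by omega
      subst this
      simp
  have h1 : (2 : ℝ) ^ Nat.clog 2 n ≤ 2 * n := by exact_mod_cast hlt
  have h2 := Real.log_le_log (by positivity) h1
  rw [Real.log_pow, Real.log_mul (by norm_num) (by positivity)] at h2
  have h3 : (0 : ℝ) ≤ Nat.clog 2 n := by positivity
  nlinarith [Real.log_two_gt_d9, Real.log_two_lt_d9]

/-- Greedy runs have the claimed competitive ratio. -/
theorem GreedyRun.flowTime_le {n m M ρ : ℕ} (hm : 0 < m) (hM : M = min m n)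
    (hρ : ρ = rootRatio n M) {J : Instance n} (G : GreedyRun J M ρ) (O : PreemptiveSchedule J m) :
    ∑ j, (G.start j + J.proc j - J.release j) ≤
      (600 * max 1 ((n : ℝ) / (m : ℝ) ^ 2 + Real.sqrt ((n : ℝ) / (m : ℝ)) * Real.log (m : ℝ))) *
        O.flowTime := by
  have hVO : J.total ≤ O.flowTime := O.total_le_flowTime
  have hO : 0 ≤ O.flowTime := J.total_nonneg.trans hVO
  set Γ := (n : ℝ) / (m : ℝ) ^ 2 + Real.sqrt ((n : ℝ) / (m : ℝ)) * Real.log (m : ℝ) with hΓ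
  have hmax1 : 1 ≤ max 1 Γ := le_max_left _ _
  have hmaxΓ : Γ ≤ max 1 Γ := le_max_right _ _
  have hsplit : ∑ j, (G.start j + J.proc j - J.release j) =
      ∑ j, (G.start j - J.release j) + J.total := by
    rw [Instance.total, ← Finset.sum_add_distrib]
    exact Finset.sum_congr rfl fun j _ => by ring
  rw [hsplit]
  rcases Nat.eq_zero_or_pos n with hn | hn
  · subst hn
    have h1 : ∑ j, (G.start j - J.release j) = 0 := by simp
    rw [h1, zero_add]
    nlinarith
  rcases le_or_gt m n with hmn | hmn
  · rw [min_eq_left hmn] at hM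
    subst hM hρ
    have hL : n ≤ 2 ^ Nat.clog 2 n := Nat.le_pow_clog (by norm_num) n
    have h := G.sum_wait_le (rootRatio_pos hm hn) hm (le_rootRatio_sq (Or.inl hm))
      (rootRatio_le (Or.inl hm)) hL hmn O
    have hm' : (0 : ℝ) < M := by exact_mod_cast hm
    have hn1 : (1 : ℝ) ≤ n := by exact_mod_cast hn
    have hlogn := Real.log_nonneg hn1
    have hlogm : 0 ≤ Real.log M := Real.log_nonneg (by exact_mod_cast hm)
    have h1 : (n : ℝ) / M ^ 2 ≤ Γ := by
      rw [hΓ]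
      have : 0 ≤ Real.sqrt ((n : ℝ) / M) * Real.log M := by positivity
      linarith
    have h2 : (11 * (Nat.clog 2 n : ℝ) + 12) * rootRatio n M ≤ 560 * Γ := by
      calc (11 * (Nat.clog 2 n : ℝ) + 12) * rootRatio n M
          ≤ (11 * (2 * (1 + Real.log n)) + 12 * (1 + Real.log n)) *
            (2 * Real.sqrt (n / M)) := by
              have := clog_le_two_add hn
              have := rootRatio_le_two_mul_sqrt hm hmn
              gcongr
              linarith
        _ = 68 * (Real.sqrt (n / M) * (1 + Real.log n)) := by ring
        _ ≤ 68 * (8 * Γ) := by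
              have := sqrt_mul_log_le hm hmn
              gcongr
        _ ≤ 560 * Γ := by
              have : 0 ≤ Γ := by rw [hΓ]; positivity
              linarith
    have h3 : (2 + 9 * ((n : ℝ) / M ^ 2) + (11 * (Nat.clog 2 n : ℝ) + 12) * rootRatio n M) + 1 ≤
        600 * max 1 Γ := by linarith
    calc _ ≤ (2 + 9 * ((n : ℝ) / M ^ 2) + (11 * (Nat.clog 2 n : ℝ) + 12) * rootRatio n M) *
          O.flowTime + O.flowTime := add_le_add h hVO
      _ = ((2 + 9 * ((n : ℝ) / M ^ 2) + (11 * (Nat.clog 2 n : ℝ) + 12) * rootRatio n M) + 1) *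
          O.flowTime := by ring
      _ ≤ _ := by gcongr
  · rw [min_eq_right hmn.le] at hM
    subst hM
    rw [rootRatio_self hn] at hρ
    subst hρ
    have h1 : ∑ j, (G.start j - J.release j) = 0 :=
      Finset.sum_eq_zero fun j _ => sub_eq_zero.2 (G.start_eq_release j)
    rw [h1, zero_add]
    nlinarith

end FlowTime

/-! ### Greedy decisions and the runs they generate -/

namespace FlowTime

open scoped Classical

namespace View

variable (v : View)

/-- The total processing time of the released jobs. -/
noncomputable def load : ℝ := ∑ j ∈ Finset.range v.k, v.proc j

/-- The number of machines in use. -/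
def machines : ℕ := min v.m v.n

/-- The number of released jobs that have been started, will still run at the time `t`, and are
heavy for job `j`. -/
noncomputable def heavyCount (t : ℝ) (j : ℕ) : ℕ :=
  Finset.card {a ∈ Finset.range v.k | (∃ i s, v.started a = some (i, s) ∧ t < s + v.proc a) ∧
    (v.proc j ≤ 2 * v.proc a ∨ v.load ≤ 2 * (v.machines * v.proc a))}

/-- Machine `i` will be idle at the time `t`. -/
def Idle (t : ℝ) (i : ℕ) : Prop :=
  i < v.machines ∧ ∀ a < v.k, ∀ s, v.started a = some (i, s) → s + v.proc a ≤ t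

/-- The greedy rule permits to start job `j` on machine `i` at the time `t`. -/
def Permits (t : ℝ) (j i : ℕ) : Prop :=
  j < v.k ∧ v.started j = none ∧ v.Idle t i ∧
    Startable v.machines (rootRatio v.n v.machines) (v.heavyCount t j) (v.proc j) v.load

/-- The announced start is permitted, it is at the earliest time at which a start is permitted, and
the job is a shortest one at that time. -/
structure IsGreedyDecision (d : Option Start) : Prop where
  exists_le : ∀ t j i, v.now ≤ t → v.Permits t j i → ∃ a, d = some a ∧ a.time ≤ t
  permits : ∀ a, d = some a → v.now ≤ a.time ∧ v.Permits a.time a.job a.machine ∧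
    ∀ j i, v.Permits a.time j i → v.proc a.job ≤ v.proc j

end View

theorem Instance.releaseAt_val {n : ℕ} (J : Instance n) (j : Fin n) :
    J.releaseAt j = J.release j := by simp [Instance.releaseAt]

theorem Instance.procAt_val {n : ℕ} (J : Instance n) (j : Fin n) : J.procAt j = J.proc j := by
  simp [Instance.procAt]

/-- What holds in every state of a greedy run. -/
structure RunState.Inv {n : ℕ} (J : Instance n) (m : ℕ) (s : RunState) : Prop where
  k_le : s.k ≤ n
  release_le : ∀ j : Fin n, (j : ℕ) < s.k → J.release j ≤ s.now
  le_release : ∀ j : Fin n, s.k ≤ j → s.now ≤ J.release j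
  started : ∀ a i t, s.started a = some (i, t) →
    a < s.k ∧ i < min m n ∧ J.releaseAt a ≤ t ∧ t ≤ s.now
  disjoint : ∀ a b i t u, a ≠ b → s.started a = some (i, t) → s.started b = some (i, u) →
    t + J.procAt a ≤ u ∨ u + J.procAt b ≤ t

/-- The state after the start `a`. -/
def RunState.start (s : RunState) (a : Start) : RunState :=
  { s with
    now := a.time
    started := Function.update s.started a.job (some (a.machine, a.time)) }

section Run

variable {n m : ℕ} {A : OnlineAlgorithm} (J : Instance n)

/-- The three kinds of events: a release, a start, or nothing when all jobs have been started. -/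
theorem RunState.step_cases (hm : 0 < m)
    (hA : ∀ v : View, 0 < v.m → v.k ≤ v.n → v.IsGreedyDecision (A v)) {s : RunState}
    (hs : s.Inv J m) :
    (∃ h : s.k < n, s.step A J m = { s with k := s.k + 1, now := J.release ⟨s.k, h⟩ } ∧
      ∀ t j i, s.now ≤ t → (s.view J m).Permits t j i → J.release ⟨s.k, h⟩ ≤ t) ∨
    (∃ a, A (s.view J m) = some a ∧ s.Admits J a ∧ s.step A J m = s.start a) ∨
    (s.k = n ∧ (∀ j < n, s.started j ≠ none) ∧ s.step A J m = s) := by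
  have hd := hA (s.view J m) hm hs.k_le
  have harr : ∀ h : s.k < n, s.arrive J = { s with k := s.k + 1, now := J.release ⟨s.k, h⟩ } := by
    intro h
    simp [RunState.arrive, h, Instance.releaseAt]
  have hnone : ∀ j < n, s.k = n → s.started j = none → ∃ t ≥ s.now, (s.view J m).Permits t j 0 := by
    intro j hj hk hjn
    obtain ⟨B, hB⟩ : ∃ B : ℝ, ∀ a ∈ Finset.range n, ∀ i u, s.started a = some (i, u) →
        u + (s.view J m).proc a ≤ B := by
      set f : ℕ → ℝ := fun a =>
        |(s.started a).elim 0 fun x => x.2 + (s.view J m).proc a| with hf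
      refine ⟨∑ a ∈ Finset.range n, f a, fun a ha i u hau => ?_⟩
      refine le_trans ?_ (Finset.single_le_sum (f := f) (fun _ _ => abs_nonneg _) ha)
      simp only [hf, hau, Option.elim_some]
      exact le_abs_self _
    refine ⟨max s.now B, le_max_left _ _, by simpa [RunState.view, hk] using hj, hjn,
      ⟨by simp only [View.machines, RunState.view]; omega, fun a ha u hau =>
        (hB a (by simpa [RunState.view, hk] using ha) _ u hau).trans (le_max_right _ _)⟩, Or.inl ?_⟩
    have : (s.view J m).heavyCount (max s.now B) j = 0 := by
      rw [View.heavyCount, Finset.card_eq_zero, Finset.filter_eq_empty_iff]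
      rintro a ha ⟨⟨i, u, hau, hlt⟩, -⟩
      exact absurd hlt (not_lt.2 ((hB a (by simpa [RunState.view, hk] using ha) _ u hau).trans
        (le_max_right _ _)))
    rw [this]
    simp only [Nat.cast_zero, zero_mul]
    refine Finset.sum_nonneg fun a _ => ?_
    simp only [RunState.view, Instance.procAt]
    split_ifs
    · exact (J.proc_pos _).le
    all_goals exact le_rfl
  cases hAv : A (s.view J m) with
  | none =>
    have hno : ∀ t j i, s.now ≤ t → ¬ (s.view J m).Permits t j i := by
      intro t j i ht hp
      obtain ⟨a, ha, -⟩ := hd.exists_le t j i ht hp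
      rw [hAv] at ha
      cases ha
    have hstep : s.step A J m = s.arrive J := by simp [RunState.step, hAv]
    rcases hs.k_le.lt_or_eq with h | h
    · exact Or.inl ⟨h, hstep.trans (harr h), fun t j i ht hp => absurd hp (hno t j i ht)⟩
    · refine Or.inr (Or.inr ⟨h, fun j hj hjn => ?_, hstep.trans (by simp [RunState.arrive, h])⟩)
      obtain ⟨t, ht, hp⟩ := hnone j hj h hjn
      exact hno t j 0 ht hp
  | some a =>
    obtain ⟨hnow, hperm, -⟩ := hd.permits a hAv
    by_cases hadm : s.Admits J a
    · exact Or.inr (Or.inl ⟨a, rfl, hadm, by simp [RunState.step, hAv, hadm, RunState.start]⟩)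
    · have hstep : s.step A J m = s.arrive J := by simp [RunState.step, hAv, hadm]
      have hex : ∃ j : Fin n, s.k ≤ j ∧ J.release j ≤ a.time := by
        by_contra hcon
        push Not at hcon
        exact hadm ⟨hperm.1, hperm.2.1, hnow, hcon⟩
      obtain ⟨j, hkj, hj⟩ := hex
      have h : s.k < n := hkj.trans_lt j.2
      refine Or.inl ⟨h, hstep.trans (harr h), fun t j' i ht hp => ?_⟩
      obtain ⟨b, hb, hbt⟩ := hd.exists_le t j' i ht hp
      rw [hAv] at hb
      cases hb
      exact (J.release_mono (show (⟨s.k, h⟩ : Fin n) ≤ j from hkj)).trans (hj.trans hbt)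

theorem RunState.Inv.step (hm : 0 < m)
    (hA : ∀ v : View, 0 < v.m → v.k ≤ v.n → v.IsGreedyDecision (A v)) {s : RunState}
    (hs : s.Inv J m) : (s.step A J m).Inv J m := by
  rcases RunState.step_cases J hm hA hs with ⟨h, hstep, -⟩ | ⟨a, hAa, hadm, hstep⟩ | ⟨-, -, hstep⟩
  · rw [hstep]
    refine ⟨h, fun j hj => J.release_mono ?_, fun j hj => J.release_mono ?_, ?_, hs.disjoint⟩
    · exact Fin.mk_le_mk.2 (Nat.lt_succ_iff.1 hj)
    · exact Fin.mk_le_mk.2 ((Nat.le_succ _).trans hj)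
    · intro b i t hb
      obtain ⟨h1, h2, h3, h4⟩ := hs.started b i t hb
      exact ⟨h1.trans (Nat.lt_succ_self _), h2, h3, h4.trans (hs.le_release ⟨s.k, h⟩ le_rfl)⟩
  · rw [hstep]
    obtain ⟨h1, h2, h3, h4⟩ := hadm
    obtain ⟨-, ⟨-, -, ⟨him, hidle⟩, -⟩, -⟩ := (hA (s.view J m) hm hs.k_le).permits a hAa
    have hproc : ∀ b < s.k, (s.view J m).proc b = J.procAt b := fun b hb => by
      simp [RunState.view, hb]
    refine ⟨hs.k_le, fun j hj => (hs.release_le j hj).trans h3, fun j hj => (h4 j hj).le, ?_, ?_⟩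
    · intro b i t hb
      by_cases hba : b = a.job
      · subst hba
        simp only [RunState.start, Function.update_self, Option.some.injEq, Prod.mk.injEq] at hb
        obtain ⟨rfl, rfl⟩ := hb
        refine ⟨h1, him, ?_, le_rfl⟩
        have := hs.release_le ⟨a.job, h1.trans_le hs.k_le⟩ h1
        rw [← Instance.releaseAt_val] at this
        exact this.trans h3
      · simp only [RunState.start, Function.update_of_ne hba] at hb
        obtain ⟨g1, g2, g3, g4⟩ := hs.started b i t hb
        exact ⟨g1, g2, g3, g4.trans h3⟩
    · intro b c i t u hbc hb hc
      by_cases hba : b = a.job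
      · have hca : c ≠ a.job := fun h => hbc (hba.trans h.symm)
        subst hba
        simp only [RunState.start, Function.update_self, Option.some.injEq, Prod.mk.injEq] at hb
        simp only [RunState.start, Function.update_of_ne hca] at hc
        obtain ⟨rfl, rfl⟩ := hb
        right
        have hck := (hs.started c _ u hc).1
        rw [← hproc c hck]
        exact hidle c hck u hc
      · simp only [RunState.start, Function.update_of_ne hba] at hb
        by_cases hca : c = a.job
        · subst hca
          simp only [RunState.start, Function.update_self, Option.some.injEq, Prod.mk.injEq] at hc
          obtain ⟨rfl, rfl⟩ := hc
          left
          have hbk := (hs.started b _ t hb).1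
          rw [← hproc b hbk]
          exact hidle b hbk t hb
        · simp only [RunState.start, Function.update_of_ne hca] at hc
          exact hs.disjoint b c i t u hbc hb hc
  · rw [hstep]
    exact hs

theorem OnlineAlgorithm.state_zero :
    A.state J m 0 = { k := 0, now := 0, started := fun _ => none } := rfl

theorem OnlineAlgorithm.state_succ (i : ℕ) :
    A.state J m (i + 1) = (A.state J m i).step A J m :=
  Function.iterate_succ_apply' _ _ _

theorem OnlineAlgorithm.inv_state (hm : 0 < m)
    (hA : ∀ v : View, 0 < v.m → v.k ≤ v.n → v.IsGreedyDecision (A v)) (i : ℕ) :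
    (A.state J m i).Inv J m := by
  induction i with
  | zero =>
    rw [OnlineAlgorithm.state_zero]
    refine ⟨Nat.zero_le _, fun j hj => absurd hj (Nat.not_lt_zero _),
      fun j _ => J.release_nonneg j, ?_, ?_⟩
    · intro a i t h
      cases h
    · intro a b i t u _ h
      cases h
  | succ i ih =>
    rw [OnlineAlgorithm.state_succ]
    exact ih.step J hm hA

/-- The view in a state tells the released volume. -/
theorem RunState.load_view {s : RunState} (hk : s.k ≤ n) {t : ℝ}
    (hrel : ∀ j : Fin n, (j : ℕ) < s.k ↔ J.release j ≤ t) :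
    (s.view J m).load = J.volume t := by
  have h1 : (s.view J m).load =
      ∑ j ∈ Finset.range n, if j < s.k then J.procAt j else 0 := by
    rw [← Finset.sum_filter]
    have : Finset.filter (fun j => j < s.k) (Finset.range n) = Finset.range s.k := by
      ext j
      simp only [Finset.mem_filter, Finset.mem_range]
      omega
    rw [this]
    refine Finset.sum_congr rfl fun j hj => ?_
    simp [RunState.view, Finset.mem_range.1 hj]
  rw [h1, ← Fin.sum_univ_eq_sum_range (fun j => if j < s.k then J.procAt j else 0),
    Instance.volume, Finset.sum_filter]
  refine Finset.sum_congr rfl fun j _ => ?_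
  simp only [hrel, Instance.procAt_val]

/-- The final schedule `(μ, S)` agrees with the starts made in the state `s`. -/
def RunState.Agrees (s : RunState) (μ : Fin n → ℕ) (S : Fin n → ℝ) : Prop :=
  ∀ (a : Fin n) i t, s.started a = some (i, t) → i = μ a ∧ t = S a

theorem RunState.heavyCount_view {s : RunState} (hs : s.Inv J m) {t : ℝ}
    (hrel : ∀ j : Fin n, (j : ℕ) < s.k ↔ J.release j ≤ t) {μ : Fin n → ℕ} {S : Fin n → ℝ}
    (hμ : s.Agrees μ S) {j : Fin n} (hj : (j : ℕ) < s.k) :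
    (s.view J m).heavyCount t j = Finset.card {a : Fin n | s.started a ≠ none ∧
      t < S a + J.proc a ∧ J.Heavy (min m n) (J.volume t) a j} := by
  rw [View.heavyCount, RunState.load_view J hs.k_le hrel, ← Finset.card_map Fin.valEmbedding]
  congr 1
  ext a
  have hproc : ∀ b : Fin n, (b : ℕ) < s.k → (s.view J m).proc b = J.proc b := fun b hb => by
    simp [RunState.view, hb, Instance.procAt_val]
  rw [hproc j hj]
  simp only [Finset.mem_filter, Finset.mem_range, Finset.mem_map, Finset.mem_univ, true_and,
    Fin.valEmbedding_apply]
  constructor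
  · rintro ⟨hak, ⟨i, u, hau, hlt⟩, hheavy⟩
    have han : a < n := hak.trans_le hs.k_le
    refine ⟨⟨a, han⟩, ⟨fun h => ?_, ?_, ?_⟩, rfl⟩
    · have : s.started a = some (i, u) := hau
      rw [this] at h
      cases h
    · rw [← (hμ ⟨a, han⟩ i u hau).2, ← hproc ⟨a, han⟩ hak]
      exact hlt
    · rw [Instance.Heavy, ← hproc ⟨a, han⟩ hak]
      exact hheavy
  · rintro ⟨b, ⟨hne, hlt, hheavy⟩, rfl⟩
    obtain ⟨⟨i, u⟩, hau⟩ := Option.ne_none_iff_exists'.1 hne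
    have hbk := (hs.started b i u hau).1
    refine ⟨hbk, ⟨i, u, hau, ?_⟩, ?_⟩
    · rw [(hμ b i u hau).2, hproc b hbk]
      exact hlt
    · rw [hproc b hbk]
      exact hheavy

/-- Every event up to number `2 * n` is a release or a start. -/
theorem OnlineAlgorithm.card_state (hm : 0 < m)
    (hA : ∀ v : View, 0 < v.m → v.k ≤ v.n → v.IsGreedyDecision (A v)) {i : ℕ} (hi : i ≤ 2 * n) :
    (A.state J m i).k + Finset.card {a ∈ Finset.range n | (A.state J m i).started a ≠ none} = i := by
  induction i with
  | zero => simp [OnlineAlgorithm.state_zero]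
  | succ i ih =>
    have ih := ih (by omega)
    have hinv := OnlineAlgorithm.inv_state J hm hA i
    rw [OnlineAlgorithm.state_succ]
    rcases RunState.step_cases J hm hA hinv with
      ⟨h, hstep, -⟩ | ⟨a, -, hadm, hstep⟩ | ⟨hk, hall, -⟩
    · rw [hstep]
      simp only
      omega
    · rw [hstep]
      have : Finset.filter (fun b => ((A.state J m i).start a).started b ≠ none)
          (Finset.range n) = insert a.job (Finset.filter (fun b =>
            (A.state J m i).started b ≠ none) (Finset.range n)) := by
        ext b
        rw [Finset.mem_insert, Finset.mem_filter, Finset.mem_filter, Finset.mem_range]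
        by_cases hb : b = a.job
        · subst hb
          simp [RunState.start, hadm.1.trans_le hinv.k_le]
        · simp [RunState.start, hb]
      rw [this, Finset.card_insert_of_notMem (by simp [hadm.2.1])]
      simp only [RunState.start]
      omega
    · rw [Finset.filter_true_of_mem fun b hb => hall b (Finset.mem_range.1 hb), hk,
        Finset.card_range] at ih
      omega

theorem OnlineAlgorithm.now_mono (hm : 0 < m)
    (hA : ∀ v : View, 0 < v.m → v.k ≤ v.n → v.IsGreedyDecision (A v)) :
    Monotone fun i => (A.state J m i).now := by
  refine monotone_nat_of_le_succ fun i => ?_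
  have hinv := OnlineAlgorithm.inv_state J hm hA i
  rw [OnlineAlgorithm.state_succ]
  rcases RunState.step_cases J hm hA hinv with
    ⟨h, hstep, -⟩ | ⟨a, -, hadm, hstep⟩ | ⟨-, -, hstep⟩
  · rw [hstep]
    exact hinv.le_release _ le_rfl
  · rw [hstep]
    exact hadm.2.2.1
  · rw [hstep]

theorem OnlineAlgorithm.started_succ (hm : 0 < m)
    (hA : ∀ v : View, 0 < v.m → v.k ≤ v.n → v.IsGreedyDecision (A v)) {i a : ℕ} {x : ℕ × ℝ}
    (h : (A.state J m i).started a = some x) : (A.state J m (i + 1)).started a = some x := by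
  have hinv := OnlineAlgorithm.inv_state J hm hA i
  rw [OnlineAlgorithm.state_succ]
  rcases RunState.step_cases J hm hA hinv with
    ⟨_, hstep, -⟩ | ⟨b, -, hadm, hstep⟩ | ⟨-, -, hstep⟩
  · rw [hstep]
    exact h
  · rw [hstep]
    have : a ≠ b.job := by
      rintro rfl
      rw [hadm.2.1] at h
      cases h
    simpa [RunState.start, this] using h
  · rw [hstep]
    exact h

theorem OnlineAlgorithm.started_mono (hm : 0 < m)
    (hA : ∀ v : View, 0 < v.m → v.k ≤ v.n → v.IsGreedyDecision (A v)) {i i' a : ℕ} {x : ℕ × ℝ}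
    (hii' : i ≤ i') (h : (A.state J m i).started a = some x) :
    (A.state J m i').started a = some x := by
  induction i', hii' using Nat.le_induction with
  | base => exact h
  | succ i' _ ih => exact OnlineAlgorithm.started_succ J hm hA ih

/-- An algorithm whose decisions are greedy generates a greedy run. -/
theorem OnlineAlgorithm.exists_greedyRun (hm : 0 < m)
    (hA : ∀ v : View, 0 < v.m → v.k ≤ v.n → v.IsGreedyDecision (A v)) :
    ∃ G : GreedyRun J (min m n) (rootRatio n (min m n)),
      ∀ j : Fin n, (A.state J m (2 * n)).started j = some (G.machine j, G.start j) := by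
  set σ := fun i => A.state J m i with hσ
  have hinv : ∀ i, (σ i).Inv J m := OnlineAlgorithm.inv_state J hm hA
  have hnow : Monotone fun i => (σ i).now := OnlineAlgorithm.now_mono J hm hA
  have hsucc : ∀ i, σ (i + 1) = (σ i).step A J m := OnlineAlgorithm.state_succ J
  have hpersist : ∀ i i' a x, i ≤ i' → (σ i).started a = some x → (σ i').started a = some x :=
    fun i i' a x => OnlineAlgorithm.started_mono J hm hA
  have hall : ∀ j : Fin n, (σ (2 * n)).started j ≠ none := by
    have h1 := OnlineAlgorithm.card_state J hm hA (i := 2 * n) le_rfl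
    have h2 := (hinv (2 * n)).k_le
    have h3 : Finset.card {a ∈ Finset.range n | (A.state J m (2 * n)).started a ≠ none} =
        (Finset.range n).card := by
      have := Finset.card_filter_le (Finset.range n)
        (fun a => (A.state J m (2 * n)).started a ≠ none)
      rw [Finset.card_range] at this ⊢
      simp only [hσ] at h2
      omega
    intro j
    have := Finset.card_filter_eq_iff.1 h3 j (Finset.mem_range.2 j.2)
    exact this
  have hallS : ∀ j : Fin n, ∃ i t, (σ (2 * n)).started j = some (i, t) := fun j => by
    obtain ⟨x, hx⟩ := Option.ne_none_iff_exists'.1 (hall j)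
    exact ⟨x.1, x.2, hx⟩
  choose μ S hμS using hallS
  have hagree : ∀ i ≤ 2 * n, (σ i).Agrees μ S := by
    intro i hi a k t h
    have := hpersist i (2 * n) a _ hi h
    rw [hμS a] at this
    simp only [Option.some.injEq, Prod.mk.injEq] at this
    exact ⟨this.1.symm, this.2.symm⟩
  have hstart : ∀ i ≤ 2 * n, ∀ a : Fin n, (σ i).started a ≠ none →
      (σ i).started a = some (μ a, S a) := by
    intro i hi a h
    obtain ⟨⟨k, t⟩, hx⟩ := Option.ne_none_iff_exists'.1 h
    obtain ⟨rfl, rfl⟩ := hagree i hi a k t hx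
    exact hx
  -- The event at which a job is started.
  have hrank : ∀ j : Fin n, ∃ e < 2 * n, (σ e).started j = none ∧
      ∃ a, A ((σ e).view J m) = some a ∧ (σ e).Admits J a ∧ a.job = j ∧ a.machine = μ j ∧
        a.time = S j ∧ σ (e + 1) = (σ e).start a := by
    intro j
    have hex : ∃ i, (σ i).started j ≠ none := ⟨2 * n, hall j⟩
    have h1 := Nat.find_spec hex
    have hle : Nat.find hex ≤ 2 * n := Nat.find_min' hex (hall j)
    obtain ⟨e, he⟩ : ∃ e, Nat.find hex = e + 1 := by
      refine Nat.exists_eq_succ_of_ne_zero fun h0 => ?_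
      rw [h0] at h1
      exact h1 rfl
    have hnone : (σ e).started j = none := not_not.1 (Nat.find_min hex (m := e) (by omega))
    rw [he] at h1
    have h2 := hstart (e + 1) (by omega) j h1
    refine ⟨e, by omega, hnone, ?_⟩
    rcases RunState.step_cases J hm hA (hinv e) with
      ⟨_, hstep, -⟩ | ⟨a, hAa, hadm, hstep⟩ | ⟨-, -, hstep⟩
    · rw [hsucc, hstep] at h1
      exact absurd hnone h1
    · refine ⟨a, hAa, hadm, ?_⟩
      rw [← hsucc] at hstep
      rw [hstep] at h2
      have haj : a.job = j := by
        by_contra hne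
        simp only [RunState.start, Function.update_of_ne (Ne.symm hne), hnone] at h2
        cases h2
      simp only [RunState.start, haj, Function.update_self, Option.some.injEq, Prod.mk.injEq] at h2
      exact ⟨haj, h2.1, h2.2, hstep⟩
    · rw [hsucc, hstep] at h1
      exact absurd hnone h1
  choose e he hnone dec hdec hadm hjob hmach htime hnext using hrank
  have hstarted_iff : ∀ i ≤ 2 * n, ∀ a : Fin n, (σ i).started a ≠ none ↔ e a < i := by
    intro i hi a
    constructor
    · intro h
      by_contra hle
      have := hpersist i (e a) a _ (not_lt.1 hle) (hstart i hi a h)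
      rw [hnone a] at this
      cases this
    · intro h
      have : (σ (e a + 1)).started a = some (μ a, S a) := by
        rw [hnext a]
        simp [RunState.start, hjob, hmach, htime]
      rw [hpersist _ i a _ h this]
      simp
  have hS_now : ∀ a, (σ (e a + 1)).now = S a := fun a => by
    rw [hnext a]
    exact htime a
  have hrel_event : ∀ (y j : Fin n), (j : ℕ) < (σ (e y)).k ↔ J.release j ≤ S y := by
    intro y j
    constructor
    · intro h
      rw [← htime y]
      exact ((hinv (e y)).release_le j h).trans (hadm y).2.2.1
    · intro h
      by_contra hk
      have := (hadm y).2.2.2 j (not_lt.1 hk)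
      rw [htime y] at this
      linarith
  have hdisj : ∀ i j : Fin n, i ≠ j → μ i = μ j → S i + J.proc i ≤ S j ∨ S j + J.proc j ≤ S i := by
    intro i j hij hμ
    have h2 := hμS j
    rw [← hμ] at h2
    have := (hinv (2 * n)).disjoint i j _ _ _ (fun h => hij (Fin.ext h)) (hμS i) h2
    rwa [Instance.procAt_val, Instance.procAt_val] at this
  have hμlt : ∀ j, μ j < min m n := fun j => ((hinv (2 * n)).started j _ _ (hμS j)).2.1
  have hproc : ∀ i (b : Fin n), (b : ℕ) < (σ i).k → ((σ i).view J m).proc b = J.proc b :=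
    fun i b hb => by simp [RunState.view, hb, Instance.procAt_val]
  refine ⟨⟨μ, S, e, hμlt, ?_, hdisj, ?_, ?_, ?_, ?_⟩, hμS⟩
  · intro j
    have := ((hinv (2 * n)).started j _ _ (hμS j)).2.2.1
    rwa [Instance.releaseAt_val] at this
  · intro i j hij
    have h1 := hjob i
    have h2 := hdec i
    rw [hij, hdec j] at h2
    simp only [Option.some.injEq] at h2
    rw [← h2, hjob j] at h1
    exact Fin.ext h1.symm
  · intro j
    obtain ⟨-, hperm, -⟩ := (hA ((σ (e j)).view J m) hm (hinv (e j)).k_le).permits _ (hdec j)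
    obtain ⟨hjk, -, -, hst⟩ := hperm
    rw [hjob j, htime j] at hst
    have hjk' : (j : ℕ) < (σ (e j)).k := by
      rw [← hjob j]
      exact hjk
    rw [RunState.heavyCount_view J (hinv (e j)) (hrel_event j) (hagree _ (he j).le) hjk',
      hproc _ j hjk', RunState.load_view J (hinv (e j)).k_le (hrel_event j)] at hst
    simp only [hstarted_iff _ (he j).le] at hst
    exact hst
  · intro y i hi hyi hshort
    obtain ⟨-, hperm, hmin⟩ :=
      (hA ((σ (e y)).view J m) hm (hinv (e y)).k_le).permits _ (hdec y)
    obtain ⟨hyk, -, hidle, -⟩ := hperm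
    rw [hjob y] at hyk
    have hik := (hrel_event y i).2 hi
    have := hmin i (dec y).machine ⟨hik, ?_, hidle, ?_⟩
    · rwa [hjob y, hproc _ y hyk, hproc _ i hik] at this
    · by_contra hne
      have h1 := (hstarted_iff _ (he y).le i).1 hne
      have h2 : S i ≤ S y := by
        rw [← hS_now i, ← hS_now y]
        exact hnow (by omega)
      linarith
    · rw [htime y, RunState.heavyCount_view J (hinv (e y)) (hrel_event y)
        (hagree _ (he y).le) hik, hproc _ i hik,
        RunState.load_view J (hinv (e y)).k_le (hrel_event y)]
      refine Or.inl (le_trans ?_ hshort)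
      have hcard : Finset.card {a : Fin n | (σ (e y)).started a ≠ none ∧
          S y < S a + J.proc a ∧ J.Heavy (min m n) (J.volume (S y)) a i} ≤ min m n := by
        refine card_le_of_disjoint hμlt hdisj (t := S y) _ fun a ha => ?_
        simp only [Finset.mem_filter, Finset.mem_univ, true_and] at ha
        refine ⟨?_, ha.2.1⟩
        have h1 := (hstarted_iff _ (he y).le a).1 ha.1
        rw [← hS_now a, ← hS_now y]
        exact hnow (by omega)
      have hp := J.proc_pos i
      have hcard' : ((Finset.card {a : Fin n | (σ (e y)).started a ≠ none ∧
          S y < S a + J.proc a ∧ J.Heavy (min m n) (J.volume (S y)) a i} : ℕ) : ℝ) ≤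
          ((min m n : ℕ) : ℝ) := by exact_mod_cast hcard
      change _ * ((rootRatio n (min m n) : ℝ) * J.proc i) ≤ _
      rw [mul_assoc]
      gcongr
  · intro t j hjt htj
    -- The last event up to the time `t`.
    have hex : ∃ i, i < 2 * n ∧ (σ i).now ≤ t ∧ t < (σ (i + 1)).now := by
      set i := Nat.findGreatest (fun i => (σ i).now ≤ t) (2 * n) with hi
      have h0 : (σ 0).now ≤ t := (J.release_nonneg j).trans hjt
      have h1 : (σ i).now ≤ t :=
        Nat.findGreatest_spec (P := fun i => (σ i).now ≤ t) (Nat.zero_le _) h0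
      have hlast : t < (σ (2 * n)).now :=
        htj.trans_le ((hinv (2 * n)).started j _ _ (hμS j)).2.2.2
      have h2 : i < 2 * n := by
        refine lt_of_le_of_ne (Nat.findGreatest_le _) fun h => ?_
        rw [h] at h1
        linarith
      exact ⟨i, h2, h1, not_le.1 (Nat.findGreatest_is_greatest (P := fun i => (σ i).now ≤ t)
        (Nat.lt_succ_self i) h2)⟩
    obtain ⟨i, hi, hit, hti⟩ := hex
    have hrel : ∀ b : Fin n, (b : ℕ) < (σ i).k ↔ J.release b ≤ t := by
      intro b
      refine ⟨fun h => ((hinv i).release_le b h).trans hit, fun h => ?_⟩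
      by_contra hk
      have hk := not_lt.1 hk
      rw [hsucc] at hti
      rcases RunState.step_cases J hm hA (hinv i) with
        ⟨hkn, hstep, -⟩ | ⟨a, -, hadm, hstep⟩ | ⟨hkn, -, -⟩
      · rw [hstep] at hti
        have := J.release_mono (show (⟨(σ i).k, hkn⟩ : Fin n) ≤ b from hk)
        simp only at hti
        linarith
      · rw [hstep] at hti
        have := hadm.2.2.2 b hk
        simp only [RunState.start] at hti
        linarith
      · omega
    have hst : ∀ a : Fin n, (σ i).started a ≠ none ↔ S a ≤ t := by
      intro a
      rw [hstarted_iff i hi.le]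
      constructor
      · intro h
        rw [← hS_now a]
        exact (hnow (show e a + 1 ≤ i by omega)).trans hit
      · intro h
        by_contra hle
        have := hnow (show i + 1 ≤ e a + 1 by omega)
        simp only [hS_now a] at this
        linarith
    by_contra hcon
    rw [not_or, not_not] at hcon
    obtain ⟨hbusy, hstartable⟩ := hcon
    push Not at hbusy
    obtain ⟨k, hk, hidle⟩ := hbusy
    have hjk := (hrel j).2 hjt
    have hjn : (σ i).started j = none := by
      by_contra hne
      have := (hst j).1 hne
      linarith
    have hperm : ((σ i).view J m).Permits t j k := by
      refine ⟨hjk, hjn, ⟨hk, fun a ha u hau => ?_⟩, ?_⟩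
      · have han : a < n := lt_of_lt_of_le ha (hinv i).k_le
        obtain ⟨h1, h2⟩ := hagree i hi.le ⟨a, han⟩ k u hau
        have h3 := hidle ⟨a, han⟩ h1.symm ((hst ⟨a, han⟩).1 (by
          have : (σ i).started a = some (k, u) := hau
          simp [this]))
        rw [h2, hproc i ⟨a, han⟩ ha]
        exact h3
      · rw [RunState.heavyCount_view J (hinv i) hrel (hagree i hi.le) hjk, hproc i j hjk,
          RunState.load_view J (hinv i).k_le hrel]
        simp only [hst]
        exact hstartable
    rw [hsucc] at hti
    rcases RunState.step_cases J hm hA (hinv i) with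
      ⟨hkn, hstep, hmin⟩ | ⟨a, hAa, -, hstep⟩ | ⟨-, hfull, -⟩
    · rw [hstep] at hti
      have := hmin t j k hit hperm
      simp only at hti
      linarith
    · rw [hstep] at hti
      obtain ⟨b, hb, hbt⟩ :=
        (hA ((σ i).view J m) hm (hinv i).k_le).exists_le t j k hit hperm
      rw [hAa] at hb
      cases hb
      simp only [RunState.start] at hti
      linarith
    · exact hfull j j.2 hjn

end Run

end FlowTime

/-! ### Reasoning about programs -/

namespace FlowTime

open scoped Classical

/-- Started in a memory with property `P`, the program `p` halts within `c` steps in a memory with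
property `Q`. -/
def Hoare (P : Store → Prop) (p : Program) (c : ℕ) (Q : Store → Prop) : Prop :=
  ∀ σ, P σ → ∃ t τ, Exec p σ t τ ∧ t ≤ c ∧ Q τ

namespace Program

/-- The programs without loops. -/
def LoopFree : Program → Prop
  | skip => True
  | setNat _ _ _ => True
  | setReal _ _ _ => True
  | seq p q => p.LoopFree ∧ q.LoopFree
  | ite _ p q => p.LoopFree ∧ q.LoopFree
  | loop _ _ => False

/-- The effect of a loop-free program; loops are treated like `skip`. -/
noncomputable def effect : Program → Store → Store
  | skip, σ => σ
  | setNat a i e, σ => σ.writeNat a (i.eval σ) (e.eval σ)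
  | setReal a i e, σ => σ.writeReal a (i.eval σ) (e.eval σ)
  | seq p q, σ => q.effect (p.effect σ)
  | ite b p q, σ => if b.Holds σ then p.effect σ else q.effect σ
  | loop _ _, σ => σ

/-- A bound for the number of steps of a loop-free program. -/
def maxCost : Program → ℕ
  | skip => 1
  | setNat _ i e => i.cost + e.cost + 1
  | setReal _ i e => i.cost + e.cost + 1
  | seq p q => p.maxCost + q.maxCost
  | ite b p q => b.cost + (p.maxCost + q.maxCost)
  | loop _ _ => 0

theorem LoopFree.exec {p : Program} (hp : p.LoopFree) (σ : Store) :
    ∃ t, Exec p σ t (p.effect σ) ∧ t ≤ p.maxCost := by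
  induction p generalizing σ with
  | skip => exact ⟨_, Exec.skip σ, le_rfl⟩
  | setNat a i e => exact ⟨_, Exec.setNat a i e σ, le_rfl⟩
  | setReal a i e => exact ⟨_, Exec.setReal a i e σ, le_rfl⟩
  | seq p q ihp ihq =>
    obtain ⟨s, hs, hs'⟩ := ihp hp.1 σ
    obtain ⟨t, ht, ht'⟩ := ihq hp.2 (p.effect σ)
    exact ⟨_, Exec.seq hs ht, Nat.add_le_add hs' ht'⟩
  | ite b p q ihp ihq =>
    by_cases hb : b.Holds σ
    · obtain ⟨s, hs, hs'⟩ := ihp hp.1 σ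
      refine ⟨_, ?_, Nat.add_le_add_left (hs'.trans (Nat.le_add_right _ q.maxCost)) b.cost⟩
      simp only [effect, if_pos hb]
      exact Exec.iteTrue hb hs
    · obtain ⟨s, hs, hs'⟩ := ihq hp.2 σ
      refine ⟨_, ?_, Nat.add_le_add_left (hs'.trans (Nat.le_add_left _ p.maxCost)) b.cost⟩
      simp only [effect, if_neg hb]
      exact Exec.iteFalse hb hs
  | loop b p => exact hp.elim

/-- `forLoop x b p` runs `p` with the values `0, …, b - 1` of the loop variable, which is entry `x`
of array `3` of naturals. -/
def forLoop (x : ℕ) (b : NatExpr) (p : Program) : Program :=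
  .seq (.setNat 3 (.const x) (.const 0))
    (.loop (.natLt (.get 3 (.const x)) b)
      (.seq p (.setNat 3 (.const x) (.add (.get 3 (.const x)) (.const 1)))))

end Program

namespace Hoare

variable {P P' Q R : Store → Prop} {p q : Program} {c c' d : ℕ}

theorem of_loopFree (hp : p.LoopFree) (h : ∀ σ, P σ → Q (p.effect σ)) : Hoare P p p.maxCost Q := by
  intro σ hσ
  obtain ⟨t, ht, hc⟩ := hp.exec σ
  exact ⟨t, _, ht, hc, h σ hσ⟩

theorem seq (h₁ : Hoare P p c Q) (h₂ : Hoare Q q d R) : Hoare P (.seq p q) (c + d) R := by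
  intro σ hσ
  obtain ⟨s, τ, hs, hc, hτ⟩ := h₁ σ hσ
  obtain ⟨t, υ, ht, hd, hυ⟩ := h₂ τ hτ
  exact ⟨_, υ, Exec.seq hs ht, Nat.add_le_add hc hd, hυ⟩

theorem mono (h : Hoare P p c Q) (hc : c ≤ d) : Hoare P p d Q := by
  intro σ hσ
  obtain ⟨t, τ, ht, hle, hτ⟩ := h σ hσ
  exact ⟨t, τ, ht, hle.trans hc, hτ⟩

theorem weaken (h : Hoare P p c Q) (hQ : ∀ σ, Q σ → R σ) : Hoare P p c R := by
  intro σ hσ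
  obtain ⟨t, τ, ht, hle, hτ⟩ := h σ hσ
  exact ⟨t, τ, ht, hle, hQ τ hτ⟩

theorem ite {b : Test} (h₁ : Hoare (fun σ => P σ ∧ b.Holds σ) p c Q)
    (h₂ : Hoare (fun σ => P σ ∧ ¬ b.Holds σ) q d Q) :
    Hoare P (.ite b p q) (b.cost + (c + d)) Q := by
  intro σ hσ
  by_cases hb : b.Holds σ
  · obtain ⟨t, τ, ht, hle, hτ⟩ := h₁ σ ⟨hσ, hb⟩
    exact ⟨_, τ, Exec.iteTrue hb ht, by omega, hτ⟩
  · obtain ⟨t, τ, ht, hle, hτ⟩ := h₂ σ ⟨hσ, hb⟩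
    exact ⟨_, τ, Exec.iteFalse hb ht, by omega, hτ⟩

/-- A loop with the invariant `I i` after `i` rounds that ends after `N` rounds. -/
theorem loop {b : Test} {I : ℕ → Store → Prop} {N : ℕ}
    (hb : ∀ i ≤ N, ∀ σ, I i σ → (b.Holds σ ↔ i < N))
    (hp : ∀ i < N, Hoare (I i) p c (I (i + 1))) :
    Hoare (I 0) (.loop b p) (N * (b.cost + c) + b.cost) (I N) := by
  suffices h : ∀ k ≤ N, Hoare (I (N - k)) (.loop b p) (k * (b.cost + c) + b.cost) (I N) by
    simpa using h N le_rfl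
  intro k
  induction k with
  | zero =>
    intro _ σ hσ
    exact ⟨_, σ, Exec.loopFalse fun h => by simpa using (hb N le_rfl σ hσ).1 h, by simp, hσ⟩
  | succ k ih =>
    intro hk σ hσ
    obtain ⟨s, τ, hs, hc, hτ⟩ := hp _ (by omega) σ hσ
    rw [show N - (k + 1) + 1 = N - k by omega] at hτ
    obtain ⟨t, υ, ht, hd, hυ⟩ := ih (by omega) τ hτ
    refine ⟨_, υ, Exec.loopTrue ((hb _ (by omega) σ hσ).2 (by omega)) hs ht, ?_, hυ⟩
    rw [Nat.add_mul]
    omega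

theorem forLoop {x : ℕ} {b : NatExpr} {I : ℕ → Store → Prop} {N B : ℕ}
    (h0 : ∀ σ, P σ → I 0 (σ.writeNat 3 x 0))
    (hI : ∀ i σ, I i σ → σ.nat 3 x = i ∧ b.eval σ = N) (hN : N ≤ B)
    (hp : ∀ i < N, Hoare (I i) p c fun τ => I (i + 1) (τ.writeNat 3 x (τ.nat 3 x + 1))) :
    Hoare P (.forLoop x b p) ((B + 1) * (c + b.cost + 12)) (I N) := by
  have hinit : Hoare P (.setNat 3 (.const x) (.const 0)) 3 (I 0) :=
    of_loopFree (p := .setNat 3 (.const x) (.const 0)) trivial h0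
  have hround : ∀ i < N, Hoare (I i)
      (.seq p (.setNat 3 (.const x) (.add (.get 3 (.const x)) (.const 1)))) (c + 6)
      (I (i + 1)) := fun i hi => (hp i hi).seq
    (of_loopFree (p := .setNat 3 (.const x) (.add (.get 3 (.const x)) (.const 1))) trivial
      fun τ hτ => hτ)
  have hloop := loop (b := .natLt (.get 3 (.const x)) b) (I := I) (N := N)
    (fun i _ σ hσ => by simp [Test.Holds, NatExpr.eval, hI i σ hσ]) hround
  refine (hinit.seq hloop).mono ?_
  simp only [Test.cost, NatExpr.cost]
  calc 3 + (N * (1 + 1 + b.cost + 1 + (c + 6)) + (1 + 1 + b.cost + 1))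
      ≤ 3 + (B * (1 + 1 + b.cost + 1 + (c + 6)) + (1 + 1 + b.cost + 1)) := by gcongr
    _ ≤ _ := by nlinarith

end Hoare

/-! ### The program -/

/-- The natural number register `x`. -/
def nreg (x : ℕ) : NatExpr := .get 3 (.const x)

/-- The real register `x`. -/
def rreg (x : ℕ) : RealExpr := .get 5 (.const x)

/-- Assignment to the natural number register `x`. -/
def setN (x : ℕ) (e : NatExpr) : Program := .setNat 3 (.const x) e

/-- Assignment to the real register `x`. -/
def setR (x : ℕ) (e : RealExpr) : Program := .setReal 5 (.const x) e

/-- The number of released jobs. -/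
def kExpr : NatExpr := .get 0 (.const 2)

/-- The completion time of the started job whose number is in register `x`. -/
def complExpr (x : ℕ) : RealExpr := .add (.get 3 (nreg x)) (.get 2 (nreg x))

/-- Register `0` becomes the number of machines in use; the registers `1`, `2`, `3` are prepared for
the computation of the root. -/
def initCode : Program :=
  .seq (.ite (.natLt (.get 0 (.const 1)) (.get 0 (.const 0)))
      (setN 0 (.get 0 (.const 1))) (setN 0 (.get 0 (.const 0))))
    (.seq (setN 1 (.const 0)) (.seq (setN 2 (.const 0)) (setN 3 (nreg 0))))

/-- The squares of `0, 1, 2, …` times the number of machines are computed in register `2`, their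
differences in register `3`. -/
def rootBody : Program :=
  .seq (setN 2 (.add (nreg 2) (nreg 3)))
    (.seq (setN 3 (.add (nreg 3) (.add (nreg 0) (nreg 0)))) (setN 1 (.add (nreg 1) (.const 1))))

/-- Register `1` becomes the least number whose square times the number of machines is at least the
number of jobs. -/
def rootCode : Program := .loop (.natLt (nreg 2) (.get 0 (.const 0))) rootBody

/-- Adds the processing time of the job in register `7` to the entry of array `b` for this job. -/
def addProcCode (b : ℕ) : Program :=
  .setReal b (nreg 7) (.add (.get b (nreg 7)) (.get 2 (nreg 7)))

/-- Adds the processing time of the job in register `7` to the volume and clears its table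
entries. -/
def loadCode : Program :=
  .seq (setR 0 (.add (rreg 0) (.get 2 (nreg 7))))
    (.seq (.setReal 6 (nreg 7) .zero) (.setReal 7 (nreg 7) .zero))

/-- Array `6` becomes the processing times multiplied by the number of machines, array `7` the
processing times multiplied by the root, real register `0` the released volume. -/
def prepCode : Program :=
  .seq (setR 0 .zero) (.forLoop 7 kExpr (.seq loadCode
    (.seq (.forLoop 8 (nreg 0) (addProcCode 6)) (.forLoop 8 (nreg 1) (addProcCode 7)))))

/-- Real register `1` becomes the candidate time given by the job in register `4`. -/
def timeCode : Program :=
  .ite (.and (.and (.natLt (nreg 4) kExpr) (.natLt (.const 0) (.get 1 (nreg 4))))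
      (.realLt (.get 0 (.const 0)) (complExpr 4)))
    (setR 1 (complExpr 4)) (setR 1 (.get 0 (.const 0)))

/-- The job in register `7` occupies its machine. -/
def markCode : Program :=
  .ite (.and (.not (.natLt (.get 1 (nreg 7)) (.add (nreg 6) (.const 1))))
      (.not (.natLt (.add (nreg 6) (.const 1)) (.get 1 (nreg 7)))))
    (setN 9 (.const 1)) .skip

/-- The job in register `7` is counted if it is heavy for the job in register `5`. -/
def heavyCode : Program :=
  .ite (.and (.realLt (.add (.get 2 (nreg 7)) (.get 2 (nreg 7))) (.get 2 (nreg 5)))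
      (.realLt (.add (.get 6 (nreg 7)) (.get 6 (nreg 7))) (rreg 0)))
    .skip
    (.seq (setN 8 (.add (nreg 8) (nreg 1))) (setR 2 (.add (rreg 2) (.get 7 (nreg 5)))))

/-- The job in register `7` is taken into account if it is still running at the candidate time. -/
def countBody : Program :=
  .ite (.and (.natLt (.const 0) (.get 1 (nreg 7))) (.realLt (rreg 1) (complExpr 7)))
    (.seq markCode heavyCode) .skip

/-- If the start of the job in register `5` on the machine in register `6` is permitted and better than the best one found so far, it
is recorded. -/
def selectCode : Program :=
  .ite (.and (.natLt (nreg 9) (.const 1))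
      (.not (.and (.realLt (rreg 0) (rreg 2)) (.natLt (nreg 0) (nreg 8)))))
    (.ite (.and (.natLt (.const 0) (.get 2 (.const 0)))
        (.and (.not (.realLt (rreg 1) (.get 4 (.const 0))))
          (.not (.and (.not (.realLt (.get 4 (.const 0)) (rreg 1)))
            (.realLt (.get 2 (nreg 5)) (.get 2 (.get 2 (.const 1))))))))
      .skip
      (.seq (.setNat 2 (.const 0) (.const 1)) (.seq (.setNat 2 (.const 1) (nreg 5))
        (.seq (.setNat 2 (.const 2) (nreg 6)) (.setReal 4 (.const 0) (rreg 1))))))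
    .skip

/-- Register `9`, which marks an occupied machine, and the two counters are cleared. -/
def resetCode : Program := .seq (setN 8 (.const 0)) (.seq (setN 9 (.const 0)) (setR 2 .zero))

/-- All machines are tried for the job in register `5` at the candidate time. -/
def machineLoop : Program :=
  .forLoop 6 (nreg 0) (.seq resetCode (.seq (.forLoop 7 kExpr countBody) selectCode))

/-- The job in register `5` has not been started. -/
def pendingTest : Test := .natLt (.get 1 (nreg 5)) (.const 1)

/-- All pending jobs are tried at the candidate time. -/
def jobLoop : Program := .forLoop 5 kExpr (.ite pendingTest machineLoop .skip)

/-- All candidate times are tried. The last round, in which register `4` holds the number of released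
jobs, gives the current time. -/
def searchCode : Program := .forLoop 4 (.add kExpr (.const 1)) (.seq timeCode jobLoop)

/-- The program that computes a greedy decision: for all candidate times, jobs and machines it tests
whether the start is permitted. -/
def greedyCode : Program := .seq (.seq initCode rootCode) (.seq prepCode searchCode)

end FlowTime

/-! ### Correctness of the preparations -/

namespace FlowTime

open scoped Classical

namespace Store

variable (σ : Store) (a b i j : ℕ)

@[simp] theorem writeNat_real (x : ℕ) : (σ.writeNat a i x).real = σ.real := rfl

@[simp] theorem writeReal_nat (x : ℝ) : (σ.writeReal a i x).nat = σ.nat := rfl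

@[simp] theorem writeNat_nat_self (x : ℕ) :
    (σ.writeNat a i x).nat a j = if j = i then x else σ.nat a j := by
  simp [writeNat]

@[simp] theorem writeReal_real_self (x : ℝ) :
    (σ.writeReal a i x).real a j = if j = i then x else σ.real a j := by
  simp [writeReal]

variable {a b}

theorem writeNat_nat_of_ne (h : b ≠ a) (x : ℕ) : (σ.writeNat a i x).nat b = σ.nat b := by
  funext j
  simp [writeNat, h]

theorem writeReal_real_of_ne (h : b ≠ a) (x : ℝ) : (σ.writeReal a i x).real b = σ.real b := by
  funext j
  simp [writeReal, h]

end Store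

namespace View

variable (v : View)

/-- The memory still contains the input. -/
structure Input (σ : Store) : Prop where
  n : σ.nat 0 0 = v.n
  m : σ.nat 0 1 = v.m
  k : σ.nat 0 2 = v.k
  machine : σ.nat 1 = v.toStore.nat 1
  now : σ.real 0 0 = v.now
  proc : σ.real 2 = v.proc
  start : σ.real 3 = v.toStore.real 3

/-- The memory after the preparations. -/
structure Ready (σ : Store) : Prop extends v.Input σ where
  machines : σ.nat 3 0 = v.machines
  root : σ.nat 3 1 = rootRatio v.n v.machines
  load : σ.real 5 0 = v.load
  mul_machines : ∀ a < v.k, σ.real 6 a = v.machines * v.proc a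
  mul_root : ∀ a < v.k, σ.real 7 a = rootRatio v.n v.machines * v.proc a

variable {v} {σ : Store}

theorem input_toStore : v.Input v.toStore := by
  refine ⟨rfl, rfl, rfl, rfl, rfl, ?_, rfl⟩
  funext j
  simp [toStore]

theorem Input.writeNat (h : v.Input σ) {a : ℕ} (ha : 2 ≤ a) (i x : ℕ) :
    v.Input (σ.writeNat a i x) := by
  have h0 : 0 ≠ a := by omega
  have h1 : 1 ≠ a := by omega
  constructor <;>
    simp only [Store.writeNat_real, Store.writeNat_nat_of_ne _ _ h0, Store.writeNat_nat_of_ne _ _ h1,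
      h.n, h.m, h.k, h.machine, h.now, h.proc, h.start]

theorem Input.writeReal (h : v.Input σ) {a : ℕ} (ha : 4 ≤ a) (i : ℕ) (x : ℝ) :
    v.Input (σ.writeReal a i x) := by
  have h0 : 0 ≠ a := by omega
  have h2 : 2 ≠ a := by omega
  have h3 : 3 ≠ a := by omega
  constructor <;>
    simp only [Store.writeReal_nat, Store.writeReal_real_of_ne _ _ h0,
      Store.writeReal_real_of_ne _ _ h2, Store.writeReal_real_of_ne _ _ h3,
      h.n, h.m, h.k, h.machine, h.now, h.proc, h.start]

theorem Ready.writeNat_register (h : v.Ready σ) {i : ℕ} (hi : 2 ≤ i) (x : ℕ) :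
    v.Ready (σ.writeNat 3 i x) := by
  have h0 : ¬ 0 = i := by omega
  have h1 : ¬ 1 = i := by omega
  exact ⟨h.toInput.writeNat (by norm_num) i x, by simp [h0, h.machines], by simp [h1, h.root],
    h.load, h.mul_machines, h.mul_root⟩

theorem Ready.writeNat_output (h : v.Ready σ) (i x : ℕ) : v.Ready (σ.writeNat 2 i x) :=
  ⟨h.toInput.writeNat (by norm_num) i x,
    by simp [Store.writeNat_nat_of_ne, h.machines], by simp [Store.writeNat_nat_of_ne, h.root],
    h.load, h.mul_machines, h.mul_root⟩

theorem Ready.writeReal_register (h : v.Ready σ) {i : ℕ} (hi : 1 ≤ i) (x : ℝ) :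
    v.Ready (σ.writeReal 5 i x) := by
  have h0 : ¬ 0 = i := by omega
  exact ⟨h.toInput.writeReal (by norm_num) i x, h.machines, h.root, by simp [h0, h.load],
    by simpa [Store.writeReal_real_of_ne] using h.mul_machines,
    by simpa [Store.writeReal_real_of_ne] using h.mul_root⟩

theorem Ready.writeReal_output (h : v.Ready σ) (i : ℕ) (x : ℝ) : v.Ready (σ.writeReal 4 i x) :=
  ⟨h.toInput.writeReal (by norm_num) i x, h.machines, h.root,
    by simp [Store.writeReal_real_of_ne, h.load],
    by simpa [Store.writeReal_real_of_ne] using h.mul_machines,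
    by simpa [Store.writeReal_real_of_ne] using h.mul_root⟩

/-- The number of machines and its root are stored in their registers. -/
structure Rooted (v : View) (σ : Store) : Prop extends v.Input σ where
  flag : σ.nat 2 0 = 0
  machines : σ.nat 3 0 = v.machines
  root : σ.nat 3 1 = rootRatio v.n v.machines

theorem hoare_root (hm : 0 < v.m) :
    Hoare (fun σ => σ = v.toStore) (.seq initCode rootCode)
      (initCode.maxCost + (v.n * (5 + rootBody.maxCost) + 5)) (Rooted v) := by
  set I : ℕ → Store → Prop := fun r σ => v.Input σ ∧ σ.nat 2 0 = 0 ∧ σ.nat 3 0 = v.machines ∧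
    σ.nat 3 1 = r ∧ σ.nat 3 2 = r ^ 2 * v.machines ∧ σ.nat 3 3 = (2 * r + 1) * v.machines with hI
  have hpos : 0 < v.machines ∨ v.n = 0 := by
    unfold machines
    omega
  have hinit : Hoare (fun σ => σ = v.toStore) initCode initCode.maxCost (I 0) := by
    refine Hoare.of_loopFree (by simp [initCode, setN, Program.LoopFree]) ?_
    rintro σ rfl
    have hin := input_toStore (v := v)
    simp only [hI, initCode, Program.effect, setN, nreg, NatExpr.eval, Test.Holds, hin.n, hin.m]
    split_ifs with h
    all_goals
      refine ⟨?_, rfl, ?_, ?_, ?_, ?_⟩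
      · exact ((((hin.writeNat (by norm_num) _ _).writeNat (by norm_num) _ _).writeNat
          (by norm_num) _ _).writeNat (by norm_num) _ _)
      all_goals simp [machines]
      all_goals omega
  have hloop : Hoare (I 0) rootCode
      (rootRatio v.n v.machines * (5 + rootBody.maxCost) + 5) (I (rootRatio v.n v.machines)) := by
    refine Hoare.loop (b := .natLt (nreg 2) (.get 0 (.const 0))) (fun r _ σ hσ => ?_)
      fun r _ => Hoare.of_loopFree (by simp [rootBody, setN, Program.LoopFree]) fun σ hσ => ?_
    · have hin := hσ.1
      simp only [Test.Holds, NatExpr.eval, nreg, hσ.2.2.2.2.1, hin.n]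
      rw [← not_le, ← rootRatio_le_iff hpos, not_le]
    · obtain ⟨hin, hflag, h0, h1, h2, h3⟩ := hσ
      refine ⟨((hin.writeNat (by norm_num) _ _).writeNat (by norm_num) _ _).writeNat
        (by norm_num) _ _, ?_⟩
      simp [rootBody, setN, nreg, Program.effect, NatExpr.eval, Store.writeNat_nat_of_ne, hflag,
        h0, h1, h2, h3]
      constructor <;> ring
  refine ((hinit.seq hloop).mono ?_).weaken fun σ hσ => ⟨hσ.1, hσ.2.1, hσ.2.2.1, hσ.2.2.2.1⟩
  have := rootRatio_le hpos
  gcongr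

theorem Rooted.writeNat_register (h : v.Rooted σ) {i : ℕ} (hi : 2 ≤ i) (x : ℕ) :
    v.Rooted (σ.writeNat 3 i x) := by
  have h0 : ¬ 0 = i := by omega
  have h1 : ¬ 1 = i := by omega
  exact ⟨h.toInput.writeNat (by norm_num) i x, by simp [Store.writeNat_nat_of_ne, h.flag],
    by simp [h0, h.machines], by simp [h1, h.root]⟩

theorem Rooted.writeReal (h : v.Rooted σ) {a : ℕ} (ha : 4 ≤ a) (i : ℕ) (x : ℝ) :
    v.Rooted (σ.writeReal a i x) :=
  ⟨h.toInput.writeReal ha i x, h.flag, h.machines, h.root⟩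

/-- The tables of `prepCode` are complete up to the job `a`, whose entries are `x` and `y`. -/
structure Prepared (v : View) (a : ℕ) (V x y : ℝ) (σ : Store) : Prop extends v.Rooted σ where
  index : σ.nat 3 7 = a
  load : σ.real 5 0 = V
  mul_machines : ∀ b < a, σ.real 6 b = v.machines * v.proc b
  mul_root : ∀ b < a, σ.real 7 b = rootRatio v.n v.machines * v.proc b
  entry_machines : σ.real 6 a = x
  entry_root : σ.real 7 a = y

theorem Prepared.writeNat {a : ℕ} {V x y : ℝ} (h : Prepared v a V x y σ) (z : ℕ) :
    Prepared v a V x y (σ.writeNat 3 8 z) :=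
  ⟨h.toRooted.writeNat_register (by norm_num) z, by simp [h.index], h.load, h.mul_machines,
    h.mul_root, h.entry_machines, h.entry_root⟩

/-- The number of steps of `prepCode`, for `n` jobs. -/
def prepCost (n : ℕ) : ℕ :=
  3 + (n + 1) * (loadCode.maxCost + ((n + 1) * ((addProcCode 6).maxCost + 2 + 12) +
    (n + 1) * ((addProcCode 7).maxCost + 2 + 12)) + 2 + 12)

theorem hoare_prep (hn : v.machines ≤ v.n) (hr : rootRatio v.n v.machines ≤ v.n)
    (hk : v.k ≤ v.n) :
    Hoare (v.Rooted) prepCode (prepCost v.n) fun σ => v.Ready σ ∧ σ.nat 2 0 = 0 := by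
  set W : ℕ → ℝ := fun a => ∑ j ∈ Finset.range a, v.proc j with hW
  set I : ℕ → Store → Prop := fun a σ => v.Rooted σ ∧ σ.nat 3 7 = a ∧ σ.real 5 0 = W a ∧
    (∀ b < a, σ.real 6 b = v.machines * v.proc b) ∧
    (∀ b < a, σ.real 7 b = rootRatio v.n v.machines * v.proc b) with hI
  have hzero : Hoare v.Rooted (setR 0 .zero) 3 (fun σ => v.Rooted σ ∧ σ.real 5 0 = 0) := by
    refine Hoare.of_loopFree (p := setR 0 .zero) trivial fun σ hσ => ?_
    refine ⟨hσ.writeReal (by norm_num) _ _, ?_⟩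
    simp [setR, Program.effect, NatExpr.eval, RealExpr.eval]
  refine (hzero.seq (Hoare.forLoop (I := I) (N := v.k) (B := v.n) ?_ ?_ hk ?_)).weaken ?_
  · rintro σ ⟨hσ, h0⟩
    exact ⟨hσ.writeNat_register (by norm_num) _, by simp, by simp [h0, hW], by simp, by simp⟩
  · rintro i σ ⟨hσ, h7, -⟩
    exact ⟨h7, hσ.k⟩
  · intro a _
    have hload : Hoare (I a) loadCode loadCode.maxCost (Prepared v a (W (a + 1)) 0 0) := by
      refine Hoare.of_loopFree (by simp [loadCode, setR, Program.LoopFree]) ?_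
      rintro σ ⟨hσ, h7, hV, h1, h2⟩
      simp only [loadCode, setR, rreg, nreg, Program.effect, NatExpr.eval, RealExpr.eval,
        Store.writeReal_nat, h7, hσ.proc]
      refine ⟨((hσ.writeReal (by norm_num) _ _).writeReal (by norm_num) _ _).writeReal
        (by norm_num) _ _, h7, ?_, fun b hb => ?_, fun b hb => ?_, ?_, ?_⟩
      · simp [Store.writeReal_real_of_ne, hV, hW, Finset.sum_range_succ]
      · simp [Store.writeReal_real_of_ne, hb.ne, h1 b hb]
      · simp [Store.writeReal_real_of_ne, hb.ne, h2 b hb]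
      · simp [Store.writeReal_real_of_ne]
      · simp
    have h6 : Hoare (Prepared v a (W (a + 1)) 0 0) (.forLoop 8 (nreg 0) (addProcCode 6))
        ((v.n + 1) * ((addProcCode 6).maxCost + 2 + 12))
        (Prepared v a (W (a + 1)) (v.machines * v.proc a) 0) := by
      refine (Hoare.forLoop (p := addProcCode 6) (b := nreg 0) (N := v.machines)
        (I := fun l σ => Prepared v a (W (a + 1)) (l * v.proc a) 0 σ ∧ σ.nat 3 8 = l) (fun σ hσ => ?_) (fun l σ hσ => ⟨hσ.2, hσ.1.machines⟩) hn
        fun l _ => Hoare.of_loopFree trivial fun σ hσ => ?_).weaken fun σ hσ => hσ.1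
      · have := hσ.writeNat 0
        simpa using this
      · obtain ⟨h, h8⟩ := hσ
        refine ⟨Prepared.writeNat (σ := (addProcCode 6).effect σ) ?_ _, by
          simp [addProcCode, Program.effect, h8]⟩
        simp only [addProcCode, nreg, Program.effect, NatExpr.eval, RealExpr.eval, h.index, h.proc,
          h.entry_machines]
        refine ⟨h.toRooted.writeReal (by norm_num) _ _, h.index,
          by simp [Store.writeReal_real_of_ne, h.load], fun b hb => ?_, fun b hb => ?_, ?_, ?_⟩
        · simp [hb.ne, h.mul_machines b hb]
        · simp [Store.writeReal_real_of_ne, h.mul_root b hb]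
        · simp
          ring
        · simp [Store.writeReal_real_of_ne, h.entry_root]
    have h7 : Hoare (Prepared v a (W (a + 1)) (v.machines * v.proc a) 0)
        (.forLoop 8 (nreg 1) (addProcCode 7))
        ((v.n + 1) * ((addProcCode 7).maxCost + 2 + 12))
        (Prepared v a (W (a + 1)) (v.machines * v.proc a)
          (rootRatio v.n v.machines * v.proc a)) := by
      refine (Hoare.forLoop (p := addProcCode 7) (b := nreg 1) (N := rootRatio v.n v.machines)
        (I := fun l σ => Prepared v a (W (a + 1)) (v.machines * v.proc a) (l * v.proc a) σ ∧
          σ.nat 3 8 = l) (fun σ hσ => ?_) (fun l σ hσ => ⟨hσ.2, hσ.1.root⟩) hr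
        fun l _ => Hoare.of_loopFree trivial fun σ hσ => ?_).weaken fun σ hσ => hσ.1
      · have := hσ.writeNat 0
        simpa using this
      · obtain ⟨h, h8⟩ := hσ
        refine ⟨Prepared.writeNat (σ := (addProcCode 7).effect σ) ?_ _, by
          simp [addProcCode, Program.effect, h8]⟩
        simp only [addProcCode, nreg, Program.effect, NatExpr.eval, RealExpr.eval, h.index, h.proc,
          h.entry_root]
        refine ⟨h.toRooted.writeReal (by norm_num) _ _, h.index,
          by simp [Store.writeReal_real_of_ne, h.load], fun b hb => ?_, fun b hb => ?_, ?_, ?_⟩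
        · simp [Store.writeReal_real_of_ne, h.mul_machines b hb]
        · simp [hb.ne, h.mul_root b hb]
        · simp [Store.writeReal_real_of_ne, h.entry_machines]
        · simp
          ring
    refine (hload.seq (h6.seq h7)).weaken fun σ h => ?_
    refine ⟨h.toRooted.writeNat_register (by norm_num) _, by simp [h.index], h.load,
      fun b hb => ?_, fun b hb => ?_⟩
    · rcases Nat.lt_succ_iff_lt_or_eq.1 hb with hb | rfl
      · exact h.mul_machines b hb
      · exact h.entry_machines
    · rcases Nat.lt_succ_iff_lt_or_eq.1 hb with hb | rfl
      · exact h.mul_root b hb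
      · exact h.entry_root
  · rintro σ ⟨hσ, h7, hV, h1, h2⟩
    exact ⟨⟨hσ.toInput, hσ.machines, hσ.root, hV, h1, h2⟩, hσ.flag⟩

/-! ### Correctness of the search -/

variable (v) in
/-- The time at which job `e` completes if it is running, and otherwise the current time. -/
noncomputable def candidate (e : ℕ) : ℝ :=
  match v.started e with
  | none => v.now
  | some (_, s) => if e < v.k ∧ v.now < s + v.proc e then s + v.proc e else v.now

variable (v) in
/-- The output holds the best permitted start among the triples of a time, a job and a machine in
`D`: first the time is minimized and then the processing time. -/
structure Best (D : ℝ → ℕ → ℕ → Prop) (σ : Store) : Prop where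
  none : σ.nat 2 0 = 0 → ∀ t j i, D t j i → ¬ v.Permits t j i
  some : σ.nat 2 0 ≠ 0 → (∃ e, σ.real 4 0 = v.candidate e) ∧
    v.Permits (σ.real 4 0) (σ.nat 2 1) (σ.nat 2 2) ∧ ∀ t j i, D t j i → v.Permits t j i →
      σ.real 4 0 < t ∨ (σ.real 4 0 = t ∧ v.proc (σ.nat 2 1) ≤ v.proc j)

theorem Best.mono {D D' : ℝ → ℕ → ℕ → Prop} (h : v.Best D σ)
    (hD : ∀ t j i, D' t j i → v.Permits t j i → D t j i) : v.Best D' σ :=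
  ⟨fun h0 t j i hd hp => h.none h0 t j i (hD t j i hd hp) hp,
    fun h0 => ⟨(h.some h0).1, (h.some h0).2.1,
      fun t j i hd hp => (h.some h0).2.2 t j i (hD t j i hd hp) hp⟩⟩

theorem Best.of_eq {D : ℝ → ℕ → ℕ → Prop} {τ : Store} (h : v.Best D σ) (h2 : τ.nat 2 = σ.nat 2)
    (h4 : τ.real 4 = σ.real 4) : v.Best D τ :=
  ⟨by rw [h2]; exact h.none, by rw [h2, h4]; exact h.some⟩

theorem Best.writeNat {D : ℝ → ℕ → ℕ → Prop} (h : v.Best D σ) (i x : ℕ) :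
    v.Best D (σ.writeNat 3 i x) :=
  h.of_eq (Store.writeNat_nat_of_ne _ _ (by norm_num) _) rfl

theorem Best.writeReal {D : ℝ → ℕ → ℕ → Prop} (h : v.Best D σ) (i : ℕ) (x : ℝ) :
    v.Best D (σ.writeReal 5 i x) :=
  h.of_eq rfl (Store.writeReal_real_of_ne _ _ (by norm_num) _)

/-- The search has considered the triples in `D` and is now at the candidate time of job `e`, at
job `j` and machine `i`. -/
structure Search (v : View) (D : ℝ → ℕ → ℕ → Prop) (e j i : ℕ) (σ : Store) : Prop
    extends v.Ready σ where
  best : v.Best D σ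
  timeIndex : σ.nat 3 4 = e
  time : σ.real 5 1 = v.candidate e
  jobIndex : σ.nat 3 5 = j
  machineIndex : σ.nat 3 6 = i

theorem Search.writeNat {D : ℝ → ℕ → ℕ → Prop} {e j i : ℕ} (h : Search v D e j i σ) {a : ℕ}
    (ha : 7 ≤ a) (x : ℕ) : Search v D e j i (σ.writeNat 3 a x) := by
  have h4 : ¬ 4 = a := by omega
  have h5 : ¬ 5 = a := by omega
  have h6 : ¬ 6 = a := by omega
  exact ⟨h.toReady.writeNat_register (by omega) x, h.best.writeNat _ _, by simp [h4, h.timeIndex],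
    h.time, by simp [h5, h.jobIndex], by simp [h6, h.machineIndex]⟩

theorem Search.writeReal {D : ℝ → ℕ → ℕ → Prop} {e j i : ℕ} (h : Search v D e j i σ) (x : ℝ) :
    Search v D e j i (σ.writeReal 5 2 x) :=
  ⟨h.toReady.writeReal_register (by norm_num) x, h.best.writeReal _ _, h.timeIndex,
    by simp [h.time], h.jobIndex, h.machineIndex⟩

variable (v) in
/-- The part of `heavyCount` due to the jobs before `a`. -/
noncomputable def heavyCountTo (t : ℝ) (j a : ℕ) : ℕ :=
  Finset.card {b ∈ Finset.range a | (∃ i s, v.started b = some (i, s) ∧ t < s + v.proc b) ∧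
    (v.proc j ≤ 2 * v.proc b ∨ v.load ≤ 2 * (v.machines * v.proc b))}

/-- The state of the inner loop: register `9` tells whether machine `i` is idle as far as the jobs
before `a` are concerned, register `8` and real register `2` count the heavy ones. -/
structure Counting (v : View) (D : ℝ → ℕ → ℕ → Prop) (e j i a : ℕ) (σ : Store) : Prop
    extends Search v D e j i σ where
  index : σ.nat 3 7 = a
  idle : σ.nat 3 9 = 0 ↔
    ∀ b < a, ∀ s, v.started b = some (i, s) → s + v.proc b ≤ v.candidate e
  count : σ.nat 3 8 = v.heavyCountTo (v.candidate e) j a * rootRatio v.n v.machines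
  sum : σ.real 5 2 =
    v.heavyCountTo (v.candidate e) j a * (rootRatio v.n v.machines * v.proc j)

theorem Input.running_iff (h : v.Input σ) (t : ℝ) (a : ℕ) :
    (0 < σ.nat 1 a ∧ t < σ.real 3 a + σ.real 2 a) ↔
      ∃ i s, v.started a = some (i, s) ∧ t < s + v.proc a := by
  rw [h.machine, h.start, h.proc]
  cases hs : v.started a with
  | none => simp [toStore, hs]
  | some x =>
    obtain ⟨i, s⟩ := x
    simp [toStore, hs]

theorem Input.machine_iff (h : v.Input σ) (i a : ℕ) :
    (¬ σ.nat 1 a < i + 1 ∧ ¬ i + 1 < σ.nat 1 a) ↔ ∃ s, v.started a = some (i, s) := by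
  rw [h.machine]
  cases hs : v.started a with
  | none => simp [toStore, hs]
  | some x =>
    simp only [toStore, hs, Option.some.injEq, Prod.ext_iff, exists_and_left, exists_eq', and_true]
    omega

theorem hoare_count {D : ℝ → ℕ → ℕ → Prop} {e j i a : ℕ} (hj : j < v.k) (ha : a < v.k) :
    Hoare (Counting v D e j i a) countBody countBody.maxCost
      fun τ => Counting v D e j i (a + 1) (τ.writeNat 3 7 (τ.nat 3 7 + 1)) := by
  refine Hoare.of_loopFree (by simp [countBody, markCode, heavyCode, setN, setR, Program.LoopFree]) fun σ h => ?_
  have hrun := h.running_iff (v.candidate e) a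
  have hmach := h.machine_iff i a
  have hidle : (∀ b < a + 1, ∀ s, v.started b = some (i, s) → s + v.proc b ≤ v.candidate e) ↔
      (∀ b < a, ∀ s, v.started b = some (i, s) → s + v.proc b ≤ v.candidate e) ∧
      ∀ s, v.started a = some (i, s) → s + v.proc a ≤ v.candidate e := by
    constructor
    · exact fun H => ⟨fun b hb => H b (by omega), H a (by omega)⟩
    · rintro ⟨H1, H2⟩ b hb
      rcases Nat.lt_succ_iff_lt_or_eq.1 hb with hb | rfl
      · exact H1 b hb
      · exact H2
  have hcount : v.heavyCountTo (v.candidate e) j (a + 1) = v.heavyCountTo (v.candidate e) j a +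
      if (∃ i s, v.started a = some (i, s) ∧ v.candidate e < s + v.proc a) ∧
        (v.proc j ≤ 2 * v.proc a ∨ v.load ≤ 2 * (v.machines * v.proc a)) then 1 else 0 := by
    unfold heavyCountTo
    rw [Finset.range_add_one, Finset.filter_insert]
    split_ifs
    · rw [Finset.card_insert_of_notMem (by simp)]
    · rfl
  have hmark : markCode.effect σ =
      if ∃ s, v.started a = some (i, s) then σ.writeNat 3 9 1 else σ := by
    simp only [markCode, setN, Program.effect, Test.Holds, NatExpr.eval, nreg, h.index,
      h.machineIndex]
    exact if_congr hmach rfl rfl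
  have hheavy : ∀ τ, Search v D e j i τ → τ.nat 3 7 = a → heavyCode.effect τ =
      if v.proc j ≤ 2 * v.proc a ∨ v.load ≤ 2 * (v.machines * v.proc a) then
        (τ.writeNat 3 8 (τ.nat 3 8 + rootRatio v.n v.machines)).writeReal 5 2
          (τ.real 5 2 + rootRatio v.n v.machines * v.proc j) else τ := by
    intro τ hτ h7
    simp only [heavyCode, setN, setR, Program.effect, Test.Holds, NatExpr.eval, RealExpr.eval, nreg,
      rreg, h7, hτ.jobIndex, hτ.proc, hτ.mul_machines a ha, hτ.load, hτ.root, Store.writeNat_real,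
      Store.writeNat_nat_self]
    by_cases hc : v.proc j ≤ 2 * v.proc a ∨ v.load ≤ 2 * (v.machines * v.proc a)
    · rw [if_pos hc, if_neg]
      · simp [hτ.mul_root j hj]
      · rintro ⟨h1, h2⟩
        rcases hc with hc | hc <;> linarith
    · rw [if_neg hc, if_pos]
      rw [not_or] at hc
      exact ⟨by linarith [hc.1], by linarith [hc.2]⟩
  have hbody : countBody.effect σ =
      if ∃ i s, v.started a = some (i, s) ∧ v.candidate e < s + v.proc a then
        heavyCode.effect (markCode.effect σ) else σ := by
    simp only [countBody, complExpr, Program.effect, Test.Holds, NatExpr.eval, RealExpr.eval, nreg,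
      rreg, h.index, h.time]
    exact if_congr hrun rfl rfl
  have key : ∀ τ, Search v D e j i τ → τ.nat 3 7 = a →
      (τ.nat 3 9 = 0 ↔ ∀ b < a + 1, ∀ s, v.started b = some (i, s) →
        s + v.proc b ≤ v.candidate e) →
      τ.nat 3 8 = v.heavyCountTo (v.candidate e) j (a + 1) * rootRatio v.n v.machines →
      τ.real 5 2 = v.heavyCountTo (v.candidate e) j (a + 1) *
        (rootRatio v.n v.machines * v.proc j) →
      Counting v D e j i (a + 1) (τ.writeNat 3 7 (τ.nat 3 7 + 1)) := by
    intro τ hτ h7 h9 h8 h2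
    exact ⟨hτ.writeNat (by norm_num) _, by simp [h7], by simpa using h9, by simpa using h8, h2⟩
  rw [hbody]
  by_cases hR : ∃ i s, v.started a = some (i, s) ∧ v.candidate e < s + v.proc a
  swap
  · rw [if_neg hR]
    refine key σ h.toSearch h.index ?_ ?_ ?_
    · rw [hidle, h.idle, iff_self_and]
      intro _ s hs
      by_contra hlt
      exact hR ⟨i, s, hs, not_le.1 hlt⟩
    · rw [hcount, if_neg fun H => hR H.1, add_zero, h.count]
    · rw [hcount, if_neg fun H => hR H.1, add_zero, h.sum]
  rw [if_pos hR]
  have hmarked : Search v D e j i (markCode.effect σ) ∧ (markCode.effect σ).nat 3 7 = a ∧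
      ((markCode.effect σ).nat 3 9 = 0 ↔ ∀ b < a + 1, ∀ s, v.started b = some (i, s) →
        s + v.proc b ≤ v.candidate e) ∧ (markCode.effect σ).nat 3 8 = σ.nat 3 8 ∧
      (markCode.effect σ).real 5 2 = σ.real 5 2 := by
    rw [hmark, hidle]
    split_ifs with hi
    · refine ⟨h.toSearch.writeNat (by norm_num) _, by simp [h.index], ?_, by simp, rfl⟩
      simp only [Store.writeNat_nat_self, if_true, one_ne_zero, false_iff, not_and]
      intro _ H
      obtain ⟨s, hs⟩ := hi
      obtain ⟨i', s', hs', hlt⟩ := hR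
      rw [hs] at hs'
      cases hs'
      exact absurd (H s hs) (not_le.2 hlt)
    · refine ⟨h.toSearch, h.index, ?_, rfl, rfl⟩
      rw [h.idle, iff_self_and]
      exact fun _ s hs => absurd ⟨s, hs⟩ hi
  obtain ⟨g, g7, g9, g8, g2⟩ := hmarked
  rw [hheavy _ g g7]
  split_ifs with hc
  · refine key _ ((g.writeNat (by norm_num) _).writeReal _) (by simp [g7]) ?_ ?_ ?_
    · simpa using g9
    · rw [hcount, if_pos ⟨hR, hc⟩]
      simp only [Store.writeReal_nat, Store.writeNat_nat_self, if_true, g8, h.count]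
      ring
    · rw [hcount, if_pos ⟨hR, hc⟩]
      simp only [Store.writeReal_real_self, if_true, g2, h.sum]
      push_cast
      ring
  · refine key _ g g7 g9 ?_ ?_
    · rw [hcount, if_neg fun H => hc H.2, add_zero, g8, h.count]
    · rw [hcount, if_neg fun H => hc H.2, add_zero, g2, h.sum]

variable (v) in
/-- The triples before the candidate time of job `e`, job `j` and machine `i` in the order of the
search. -/
def Considered (e j i : ℕ) (t : ℝ) (j' i' : ℕ) : Prop :=
  (∃ e' < e, t = v.candidate e') ∨ (t = v.candidate e ∧ (j' < j ∨ (j' = j ∧ i' < i)))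

theorem heavyCountTo_k (t : ℝ) (j : ℕ) : v.heavyCountTo t j v.k = v.heavyCount t j := rfl

theorem hoare_select {e j i : ℕ} (hj : j < v.k) (hstart : v.started j = none)
    (hi : i < v.machines) :
    Hoare (Counting v (v.Considered e j i) e j i v.k) selectCode selectCode.maxCost
      fun τ => Search v (v.Considered e j (i + 1)) e j (i + 1)
        (τ.writeNat 3 6 (τ.nat 3 6 + 1)) := by
  refine Hoare.of_loopFree (by simp [selectCode, Program.LoopFree]) fun σ h => ?_
  set T := v.candidate e with hT
  have hperm : (σ.nat 3 9 < 1 ∧ ¬ (v.load < σ.real 5 2 ∧ v.machines < σ.nat 3 8)) ↔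
      v.Permits T j i := by
    rw [h.count, h.sum, heavyCountTo_k, Nat.lt_one_iff, h.idle, not_and_or, not_lt, not_lt]
    unfold Permits Idle Startable
    tauto
  have hnew : ∀ t j' i', v.Considered e j (i + 1) t j' i' →
      v.Considered e j i t j' i' ∨ (t = T ∧ j' = j ∧ i' = i) := by
    rintro t j' i' (hd | ⟨rfl, hd | ⟨rfl, hd⟩⟩)
    · exact Or.inl (Or.inl hd)
    · exact Or.inl (Or.inr ⟨rfl, Or.inl hd⟩)
    · rcases Nat.lt_succ_iff_lt_or_eq.1 hd with hd | rfl
      · exact Or.inl (Or.inr ⟨rfl, Or.inr ⟨rfl, hd⟩⟩)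
      · exact Or.inr ⟨rfl, rfl, rfl⟩
  have key : ∀ τ, v.Ready τ → v.Best (v.Considered e j (i + 1)) τ → τ.nat 3 = σ.nat 3 →
      τ.real 5 = σ.real 5 → Search v (v.Considered e j (i + 1)) e j (i + 1)
        (τ.writeNat 3 6 (τ.nat 3 6 + 1)) := by
    intro τ hτ hb h3 h5
    exact ⟨hτ.writeNat_register (by norm_num) _, hb.writeNat _ _, by simp [h3, h.timeIndex],
      by simp [h5, h.time], by simp [h3, h.jobIndex], by simp [h3, h.machineIndex]⟩
  simp only [selectCode, Program.effect, Test.Holds, NatExpr.eval, RealExpr.eval, nreg, rreg,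
    h.time, h.load, h.machines, h.jobIndex, h.proc]
  by_cases hp : v.Permits T j i
  swap
  · rw [if_neg fun H => hp (hperm.1 H)]
    refine key σ h.toReady (h.best.mono fun t j' i' hd hp' => ?_) rfl rfl
    rcases hnew t j' i' hd with hd | ⟨rfl, rfl, rfl⟩
    · exact hd
    · exact absurd hp' hp
  rw [if_pos (hperm.2 hp)]
  split_ifs with hbest
  · obtain ⟨hflag, hle, hshort⟩ := hbest
    have hb := h.best.some hflag.ne'
    refine key σ h.toReady ⟨fun h0 => absurd h0 hflag.ne', fun _ => ⟨hb.1, hb.2.1, ?_⟩⟩ rfl rfl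
    intro t j' i' hd hp'
    rcases hnew t j' i' hd with hd | ⟨rfl, rfl, rfl⟩
    · exact hb.2.2 t j' i' hd hp'
    · rcases (not_lt.1 hle).lt_or_eq with hlt | heq
      · exact Or.inl hlt
      · refine Or.inr ⟨heq, ?_⟩
        by_contra hcon
        exact hshort ⟨not_lt.2 heq.ge, not_le.1 hcon⟩
  · refine key _ ?_ ⟨?_, fun _ => ?_⟩ ?_ ?_
    · exact (((h.toReady.writeNat_output _ _).writeNat_output _ _).writeNat_output _ _).writeReal_output
        _ _
    · intro h0
      simp at h0
    · simp only [Store.writeReal_real_self, Store.writeReal_nat, Store.writeNat_nat_self,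
        Store.writeNat_real, h.time, h.jobIndex, h.machineIndex,
        Store.writeNat_nat_of_ne _ _ (show 3 ≠ 2 by norm_num)]
      refine ⟨⟨e, rfl⟩, hp, fun t j' i' hd hp' => ?_⟩
      simp only [if_true, show ¬ (1 : ℕ) = 2 by norm_num, if_false]
      rcases hnew t j' i' hd with hd | ⟨rfl, rfl, rfl⟩
      swap
      · exact Or.inr ⟨rfl, le_rfl⟩
      by_cases h0 : σ.nat 2 0 = 0
      · exact absurd hp' (h.best.none h0 t j' i' hd)
      have hb := (h.best.some h0).2.2 t j' i' hd hp'
      by_cases hlt : T < σ.real 4 0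
      · rcases hb with hb | ⟨hb, -⟩
        · exact Or.inl (hlt.trans hb)
        · exact Or.inl (hlt.trans_eq hb)
      · have hshort : ¬ σ.real 4 0 < T ∧ v.proc j < v.proc (σ.nat 2 1) := by
          by_contra hcon
          exact hbest ⟨Nat.pos_of_ne_zero h0, hlt, hcon⟩
        have heq : T = σ.real 4 0 := le_antisymm (not_lt.1 hshort.1) (not_lt.1 hlt)
        change T < t ∨ T = t ∧ _
        rw [heq]
        rcases hb with hb | ⟨hb, hb'⟩
        · exact Or.inl hb
        · exact Or.inr ⟨hb, hshort.2.le.trans hb'⟩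
    · simp only [Store.writeReal_nat]
      rw [Store.writeNat_nat_of_ne _ _ (by norm_num), Store.writeNat_nat_of_ne _ _ (by norm_num),
        Store.writeNat_nat_of_ne _ _ (by norm_num)]
    · rw [Store.writeReal_real_of_ne _ _ (by norm_num)]
      rfl

/-- The number of steps of `machineLoop`, for `n` jobs. -/
def machineCost (n : ℕ) : ℕ :=
  (n + 1) * (resetCode.maxCost + ((n + 1) * (countBody.maxCost + 2 + 12) + selectCode.maxCost) +
    2 + 12)

theorem hoare_machineLoop (hk : v.k ≤ v.n) (hM : v.machines ≤ v.n) {e j : ℕ} (hj : j < v.k)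
    (hstart : v.started j = none) :
    Hoare (fun σ => ∃ i, Search v (v.Considered e j 0) e j i σ) machineLoop (machineCost v.n)
      (Search v (v.Considered e j v.machines) e j v.machines) := by
  refine Hoare.forLoop (b := nreg 0) (N := v.machines)
    (I := fun i => Search v (v.Considered e j i) e j i) ?_
    (fun i σ h => ⟨h.machineIndex, h.machines⟩) hM fun i hi => ?_
  · rintro σ ⟨i, h⟩
    exact ⟨h.toReady.writeNat_register (by norm_num) _, h.best.writeNat _ _, by simp [h.timeIndex],
      h.time, by simp [h.jobIndex], by simp⟩
  · have hreset : Hoare (Search v (v.Considered e j i) e j i) resetCode resetCode.maxCost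
        (fun σ => Search v (v.Considered e j i) e j i σ ∧ σ.nat 3 8 = 0 ∧ σ.nat 3 9 = 0 ∧
          σ.real 5 2 = 0) := by
      refine Hoare.of_loopFree (by simp [resetCode, setN, setR, Program.LoopFree]) fun σ h => ?_
      refine ⟨((h.writeNat (show 7 ≤ 8 by norm_num) _).writeNat (show 7 ≤ 9 by norm_num) _).writeReal _, ?_⟩
      simp [resetCode, setN, setR, Program.effect, NatExpr.eval, RealExpr.eval]
    refine hreset.seq ((Hoare.forLoop (b := kExpr) (p := countBody) (N := v.k)
      (I := Counting v (v.Considered e j i) e j i) ?_ (fun a σ h => ⟨h.index, h.k⟩) hk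
      fun a ha => hoare_count hj ha).seq (hoare_select hj hstart hi))
    rintro σ ⟨h, h8, h9, h2⟩
    exact ⟨h.writeNat (by norm_num) _, by simp, by simp [h9],
      by simp [h8, heavyCountTo], by simp [h2, heavyCountTo]⟩

/-- The number of steps of `jobLoop`, for `n` jobs. -/
def jobCost (n : ℕ) : ℕ := (n + 1) * (pendingTest.cost + (machineCost n + 1) + 2 + 12)

theorem hoare_jobLoop (hk : v.k ≤ v.n) (hM : v.machines ≤ v.n) {e : ℕ} :
    Hoare (fun σ => v.Ready σ ∧ v.Best (v.Considered e 0 0) σ ∧ σ.nat 3 4 = e ∧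
        σ.real 5 1 = v.candidate e) jobLoop (jobCost v.n)
      (fun σ => ∃ i, Search v (v.Considered e v.k 0) e v.k i σ) := by
  refine Hoare.forLoop (b := kExpr) (N := v.k)
    (I := fun j σ => ∃ i, Search v (v.Considered e j 0) e j i σ) ?_ ?_ hk fun j hj => ?_
  · rintro σ ⟨h, hb, h4, h1⟩
    exact ⟨_, h.writeNat_register (by norm_num) _, hb.writeNat _ _, by simp [h4], h1, by simp, rfl⟩
  · rintro j σ ⟨i, h⟩
    exact ⟨h.jobIndex, h.k⟩
  · have hnext : ∀ τ i D, Search v D e j i τ → (∀ t j' i', v.Considered e (j + 1) 0 t j' i' →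
        v.Permits t j' i' → D t j' i') →
        ∃ i, Search v (v.Considered e (j + 1) 0) e (j + 1) i
          (τ.writeNat 3 5 (τ.nat 3 5 + 1)) := by
      intro τ i D h hD
      exact ⟨_, h.toReady.writeNat_register (by norm_num) _, (h.best.mono hD).writeNat _ _,
        by simp [h.timeIndex], h.time, by simp [h.jobIndex], rfl⟩
    have hpend : ∀ σ i, Search v (v.Considered e j 0) e j i σ →
        (pendingTest.Holds σ ↔ v.started j = none) := by
      intro σ i h
      simp only [pendingTest, Test.Holds, NatExpr.eval, nreg, h.jobIndex, h.toInput.machine]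
      cases hs : v.started j with
      | none => simp [toStore, hs]
      | some x => simp [toStore, hs]
    have hlast : ∀ t j' i', v.Considered e (j + 1) 0 t j' i' → v.Considered e j 0 t j' i' ∨
        (t = v.candidate e ∧ j' = j) := by
      rintro t j' i' (h | ⟨rfl, h | ⟨-, h⟩⟩)
      · exact Or.inl (Or.inl h)
      · rcases Nat.lt_succ_iff_lt_or_eq.1 h with h | rfl
        · exact Or.inl (Or.inr ⟨rfl, Or.inl h⟩)
        · exact Or.inr ⟨rfl, rfl⟩
      · omega
    refine Hoare.ite ?_ (Hoare.of_loopFree (p := .skip) trivial ?_)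
    · by_cases hs : v.started j = none
      · intro σ hσ
        refine ((hoare_machineLoop hk hM hj hs).weaken fun τ h => hnext τ _ _ h ?_) σ hσ.1
        intro t j' i' hd hp
        rcases hlast t j' i' hd with hd | ⟨rfl, rfl⟩
        · rcases hd with hd | ⟨rfl, hd | ⟨-, hd⟩⟩
          · exact Or.inl hd
          · exact Or.inr ⟨rfl, Or.inl hd⟩
          · omega
        · exact Or.inr ⟨rfl, Or.inr ⟨rfl, hp.2.2.1.1⟩⟩
      · rintro σ ⟨⟨i, h⟩, hb⟩
        exact absurd ((hpend σ i h).1 hb) hs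
    · rintro σ ⟨⟨i, h⟩, hb⟩
      refine hnext σ i _ h fun t j' i' hd hp => ?_
      rcases hlast t j' i' hd with hd | ⟨rfl, rfl⟩
      · exact hd
      · exact absurd ((hpend σ i h).2 hp.2.1) hb

/-- The number of steps of `searchCode`, for `n` jobs. -/
def searchCost (n : ℕ) : ℕ := (n + 1 + 1) * (timeCode.maxCost + jobCost n + 4 + 12)

theorem hoare_search (hk : v.k ≤ v.n) (hM : v.machines ≤ v.n) :
    Hoare (fun σ => v.Ready σ ∧ σ.nat 2 0 = 0) searchCode (searchCost v.n)
      (v.Best (v.Considered (v.k + 1) 0 0)) := by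
  refine (Hoare.forLoop (b := .add kExpr (.const 1)) (N := v.k + 1)
    (I := fun e σ => v.Ready σ ∧ v.Best (v.Considered e 0 0) σ ∧ σ.nat 3 4 = e) ?_ ?_
    (Nat.succ_le_succ hk) fun e _ => ?_).weaken fun σ h => h.2.1
  · rintro σ ⟨h, h0⟩
    refine ⟨h.writeNat_register (by norm_num) _, Best.writeNat ⟨fun _ t j i hd => ?_,
      fun hne => absurd h0 hne⟩ _ _, by simp⟩
    simp [Considered] at hd
  · rintro e σ ⟨h, -, h4⟩
    exact ⟨h4, by simp [NatExpr.eval, kExpr, h.k]⟩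
  · have htime : Hoare (fun σ => v.Ready σ ∧ v.Best (v.Considered e 0 0) σ ∧ σ.nat 3 4 = e)
        timeCode timeCode.maxCost (fun σ => v.Ready σ ∧ v.Best (v.Considered e 0 0) σ ∧
          σ.nat 3 4 = e ∧ σ.real 5 1 = v.candidate e) := by
      refine Hoare.of_loopFree (by simp [timeCode, setR, Program.LoopFree]) ?_
      rintro σ ⟨h, hb, h4⟩
      have heff : timeCode.effect σ = σ.writeReal 5 1 (v.candidate e) := by
        have hcand : v.candidate e =
            if (e < v.k ∧ 0 < σ.nat 1 e) ∧ v.now < σ.real 3 e + v.proc e then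
              σ.real 3 e + v.proc e else v.now := by
          rw [h.toInput.machine, h.toInput.start]
          unfold candidate
          cases hs : v.started e with
          | none => simp [toStore, hs]
          | some x =>
            obtain ⟨i, s⟩ := x
            simp [toStore, hs]
        simp only [timeCode, complExpr, kExpr, setR, Program.effect, Test.Holds, NatExpr.eval,
          RealExpr.eval, nreg, h4, h.k, h.now, h.proc]
        rw [hcand]
        split_ifs <;> rfl
      rw [heff]
      exact ⟨h.writeReal_register le_rfl _, hb.writeReal _ _, h4, by simp⟩
    refine (htime.seq (hoare_jobLoop hk hM)).weaken fun σ h => ?_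
    obtain ⟨i, h⟩ := h
    refine ⟨h.toReady.writeNat_register (by norm_num) _,
      (h.best.mono fun t j' i' hd hp => ?_).writeNat _ _, by simp [h.timeIndex]⟩
    rcases hd with ⟨e', he', rfl⟩ | ⟨-, hd | ⟨-, hd⟩⟩
    · rcases Nat.lt_succ_iff_lt_or_eq.1 he' with he' | rfl
      · exact Or.inl ⟨e', he', rfl⟩
      · exact Or.inr ⟨rfl, Or.inl hp.1⟩
    · omega
    · omega

theorem now_le_candidate (e : ℕ) : v.now ≤ v.candidate e := by
  unfold candidate
  split
  · exact le_rfl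
  · split_ifs with h
    · exact h.2.le
    · exact le_rfl

theorem candidate_k : v.candidate v.k = v.now := by
  unfold candidate
  split <;> simp

/-- A start that is permitted at the time `t` is already permitted at the last candidate time up to
`t`, because no job completes in between. -/
theorem exists_candidate {t : ℝ} {j i : ℕ} (ht : v.now ≤ t) (h : v.Permits t j i) :
    ∃ e ≤ v.k, v.candidate e ≤ t ∧ v.Permits (v.candidate e) j i := by
  obtain ⟨e, he, hmax⟩ := Finset.exists_max_image
    ((Finset.range (v.k + 1)).filter fun e => v.candidate e ≤ t) v.candidate
    ⟨v.k, by simp [candidate_k, ht]⟩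
  simp only [Finset.mem_filter, Finset.mem_range, Nat.lt_succ_iff] at he hmax
  have hcompl : ∀ a < v.k, ∀ i' s, v.started a = some (i', s) →
      (s + v.proc a ≤ t ↔ s + v.proc a ≤ v.candidate e) := by
    intro a ha i' s hs
    refine ⟨fun hle => ?_, fun hle => hle.trans he.2⟩
    by_contra hlt
    have hca : v.candidate a = s + v.proc a := by
      simp [candidate, hs, ha, (now_le_candidate e).trans_lt (not_le.1 hlt)]
    have := hmax a ⟨ha.le, by rw [hca]; exact hle⟩
    rw [hca] at this
    exact hlt this
  have hcount : v.heavyCount (v.candidate e) j = v.heavyCount t j := by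
    unfold heavyCount
    congr 1
    refine Finset.filter_congr fun a ha => ?_
    have : (∃ i s, v.started a = some (i, s) ∧ v.candidate e < s + v.proc a) ↔
        ∃ i s, v.started a = some (i, s) ∧ t < s + v.proc a := by
      constructor
      · rintro ⟨i, s, hs, hlt⟩
        exact ⟨i, s, hs, not_le.1 fun hle =>
          not_le.2 hlt ((hcompl a (Finset.mem_range.1 ha) i s hs).1 hle)⟩
      · rintro ⟨i, s, hs, hlt⟩
        exact ⟨i, s, hs, he.2.trans_lt hlt⟩
    rw [this]
  obtain ⟨h1, h2, ⟨h3, h4⟩, h5⟩ := h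
  exact ⟨e, he.1, he.2, h1, h2, ⟨h3, fun a ha s hs => (hcompl a ha i s hs).1 (h4 a ha s hs)⟩,
    by rwa [hcount]⟩

theorem Best.isGreedyDecision (h : v.Best (v.Considered (v.k + 1) 0 0) σ) :
    v.IsGreedyDecision σ.decision := by
  have hcons : ∀ t j i, v.now ≤ t → v.Permits t j i → ∃ e, v.candidate e ≤ t ∧
      v.Considered (v.k + 1) 0 0 (v.candidate e) j i ∧ v.Permits (v.candidate e) j i := by
    intro t j i ht hp
    obtain ⟨e, he, hle, hp'⟩ := exists_candidate ht hp
    exact ⟨e, hle, Or.inl ⟨e, Nat.lt_succ_iff.2 he, rfl⟩, hp'⟩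
  constructor
  · intro t j i ht hp
    obtain ⟨e, hle, hd, hp'⟩ := hcons t j i ht hp
    have h0 : σ.nat 2 0 ≠ 0 := fun h0 => h.none h0 _ j i hd hp'
    refine ⟨_, if_neg h0, ?_⟩
    rcases (h.some h0).2.2 _ j i hd hp' with hlt | ⟨heq, -⟩
    · exact (hlt.trans_le hle).le
    · exact heq.le.trans hle
  · intro a ha
    unfold Store.decision at ha
    split_ifs at ha with h0
    cases ha
    obtain ⟨⟨e, he⟩, hp, hbest⟩ := h.some h0
    have hnow : v.now ≤ σ.real 4 0 := he ▸ now_le_candidate e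
    refine ⟨hnow, hp, fun j i hp' => ?_⟩
    obtain ⟨e', hle, hd, hp''⟩ := hcons _ j i hnow hp'
    rcases hbest _ j i hd hp'' with hlt | ⟨-, hle'⟩
    · exact absurd hle (not_le.2 hlt)
    · exact hle'

/-- The number of steps of `greedyCode`, for `n` jobs. -/
def greedyCost (n : ℕ) : ℕ :=
  initCode.maxCost + (n * (5 + rootBody.maxCost) + 5) + (prepCost n + searchCost n)

theorem hoare_greedy (hm : 0 < v.m) (hk : v.k ≤ v.n) :
    Hoare (fun σ => σ = v.toStore) (.seq (.seq initCode rootCode) (.seq prepCode searchCode))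
      (greedyCost v.n) (fun τ => v.IsGreedyDecision τ.decision) := by
  have hM : v.machines ≤ v.n := min_le_right _ _
  have hpos : 0 < v.machines ∨ v.n = 0 := by
    unfold machines
    omega
  exact (hoare_root hm).seq ((hoare_prep hM (rootRatio_le hpos) hk).seq
    ((hoare_search hk hM).weaken fun σ h => h.isGreedyDecision))

end View

/-! ### The algorithm -/

/-- The online algorithm computed by `greedyCode`. -/
noncomputable def greedyAlgorithm : OnlineAlgorithm := fun v =>
  if h : ∃ t τ, Exec greedyCode v.toStore t τ then h.choose_spec.choose.decision else none

theorem greedyAlgorithm_eq {v : View} {t : ℕ} {τ : Store} (h : Exec greedyCode v.toStore t τ) :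
    greedyAlgorithm v = τ.decision := by
  have hex : ∃ t τ, Exec greedyCode v.toStore t τ := ⟨t, τ, h⟩
  rw [greedyAlgorithm, dif_pos hex, (hex.choose_spec.choose_spec.unique h).2]

theorem isGreedyDecision_greedyAlgorithm (v : View) (hm : 0 < v.m) (hk : v.k ≤ v.n) :
    v.IsGreedyDecision (greedyAlgorithm v) := by
  obtain ⟨t, τ, hexec, -, hτ⟩ := View.hoare_greedy hm hk _ rfl
  rw [greedyAlgorithm_eq hexec]
  exact hτ

/-- The polynomial that bounds the number of steps of `greedyCode`. -/
noncomputable def greedyPolynomial : Polynomial ℕ :=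
  let X : Polynomial ℕ := .X
  let c : ℕ → Polynomial ℕ := fun a => .C a
  c initCode.maxCost + (X * c (5 + rootBody.maxCost) + c 5) +
  ((c 3 + (X + 1) * (c loadCode.maxCost + ((X + 1) * c ((addProcCode 6).maxCost + 2 + 12) +
    (X + 1) * c ((addProcCode 7).maxCost + 2 + 12)) + c 2 + c 12)) +
  (X + 1 + 1) * (c timeCode.maxCost + (X + 1) * (c pendingTest.cost +
    ((X + 1) * (c resetCode.maxCost + ((X + 1) * c (countBody.maxCost + 2 + 12) +
      c selectCode.maxCost) + c 2 + c 12) + 1) + c 2 + c 12) + c 4 + c 12))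

theorem eval_greedyPolynomial (n : ℕ) : greedyPolynomial.eval n = View.greedyCost n := by
  simp only [greedyPolynomial, Polynomial.eval_add, Polynomial.eval_mul, Polynomial.eval_X,
    Polynomial.eval_C, Polynomial.eval_one]
  rfl

theorem greedyAlgorithm_polynomialTime : greedyAlgorithm.PolynomialTime := by
  refine ⟨greedyCode, greedyPolynomial, fun n m hm J i => ?_⟩
  have hk := (OnlineAlgorithm.inv_state J hm isGreedyDecision_greedyAlgorithm i).k_le
  obtain ⟨t, τ, hexec, ht, -⟩ :=
    View.hoare_greedy (v := (greedyAlgorithm.state J m i).view J m) hm hk _ rfl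
  exact ⟨t, τ, hexec, by rw [eval_greedyPolynomial]; exact ht, (greedyAlgorithm_eq hexec).symm⟩

end FlowTime

theorem mainTheorem4 :
    ∃ A : FlowTime.OnlineAlgorithm, A.PolynomialTime ∧
      ∃ C : ℝ, 0 < C ∧
        A.IsCompetitive (fun n m : ℕ =>
          C * max 1 ((n : ℝ) / (m : ℝ) ^ 2 + Real.sqrt ((n : ℝ) / (m : ℝ)) * Real.log (m : ℝ))) := by
  refine ⟨FlowTime.greedyAlgorithm, FlowTime.greedyAlgorithm_polynomialTime, 600, by norm_num,
    fun n m hm J => ?_⟩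
  obtain ⟨G, hG⟩ := FlowTime.OnlineAlgorithm.exists_greedyRun J hm
    FlowTime.isGreedyDecision_greedyAlgorithm
  refine ⟨⟨fun j => ⟨G.machine j, (G.machine_lt j).trans_le (min_le_left _ _)⟩, G.start,
    G.release_le_start, fun i j hij hmach => ?_⟩, hG, fun O => G.flowTime_le hm rfl rfl O⟩
  rw [Set.disjoint_left]
  rintro t ⟨h1, h2⟩ ⟨h3, h4⟩
  rcases G.disjoint i j hij (Fin.mk.inj hmach) with h | h <;> linarith
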